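/- **Setting.** Let $d\in\{2,3\}$, let $\Omega\subset\mathbb R^d$ be connected, $T>0$, $0<\rho_{\min}\le\rho_{\max}$, and let $\mu:[\rho_{\min},\rho_{\max}]\to(0,\infty)$ be continuous. *Grid.* A structured grid consists of strictly increasing coordinates $(x^i_m)_{m\in\mathbb Z}$ in each direction $i$ and a finite set $\mathcal M$ of cells $K=\prod_i[x^i_{K_i},x^i_{K_i+1}]$, $K\in\mathbb Z^d$; it is a mesh of $\Omega$ if $\Omega$ is the interior of the union of the cells. Let $h^i_K$ be the width of $K$ in direction $i$. A face orthogonal to $e_i$ is interior if it is shared by two cells $K,L\in\mathcal M$, written $\sigma=K|L$ with $L=K+e_i$, and otherwise it is a boundary face. For $\sigma=K|L$, the dual cell $D_\sigma$ is the union of the halves of $K$ and $L$ adjacent to $\sigma$. Put $\eta_{\mathcal M}=\max\{|\sigma|/|\sigma'|:\ \sigma\perp e_i,\ \sigma'\perp e_j,\ i\ne j\}$ over all (interior and boundary) faces. *Unknowns.* Densities and pressures have one value $\rho_K,p_K$ per cell. The $i$-th velocity component has one value $u_\sigma$ per face $\sigma\perp e_i$, with $u_\sigma=0$ on boundary faces;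 $H_0$ is the space of such velocities. For $u,v\in H_0$ write $(u,v)=\sum_{\sigma\ \mathrm{interior}}|D_\sigma|u_\sigma v_\sigma$. *Operators.* For $\sigma=K|L\perp e_i$ as above: $F_\sigma=|\sigma|\rho_\sigma u_\sigma$ with $\rho_\sigma=\rho_K$ if $u_\sigma\ge0$ and $\rho_\sigma=\rho_L$ otherwise ($F_\sigma=0$ on boundary faces); $(\operatorname{div}u)_K$ and $(\operatorname{div}\rho u)_K$ are $|K|^{-1}$ times the sum over the faces of $K$ of the outward fluxes $\pm|\sigma|u_\sigma$, resp. $\pm F_\sigma$; $|D_\sigma|\rho_{D_\sigma}=\frac12|K|\rho_K+\frac12|L|\rho_L$; $(\nabla p)_\sigma=\frac{|\sigma|}{|D_\sigma|}(p_L-p_K)$. The convection operator is $(C(\rho u)v)_\sigma=|D_\sigma|^{-1}\sum_{\epsilon}F_{\sigma,\epsilon}v_\epsilon$, summed over the faces $\epsilon$ of $D_\sigma$. The flux $F_{\sigma,\epsilon}$ is outward. On an $\epsilon\perp e_i$, which cuts a cell in two, it is the mean of the fluxes, in the direction out of $D_\sigma$, through the two faces of that cell orthogonal to $e_i$. On an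 $\epsilon\perp e_j$, $j\ne i$, it is half the sum of the outward fluxes through the faces of $K$ and of $L$ that contain the two halves of $\epsilon$. The value $v_\epsilon$ is upwind: $v_\sigma$ if $F_{\sigma,\epsilon}\ge0$, and otherwise the value of $v$ on the face $\sigma'\perp e_i$ whose dual cell lies on the other side of $\epsilon$. The midplanes of each cell $K$ cut it into $2^d$ orthants. The discrete derivatives $\partial_ju_i$ are constant on orthants. On all of $K$, $\partial_iu_i$ is the difference quotient of $u_i$ between the two faces of $K$ orthogonal to $e_i$. For $j\ne i$, on an orthant of $K$ touching the face $\sigma\perp e_i$ of $K$ and the side of $K$ in direction $se_j$ ($s=\pm1$), let $K'=K+se_j$; if $K'\in\mathcal M$ then $\partial_ju_i=s(u_{\sigma'}-u_\sigma)/\big(\tfrac12(h^j_K+h^j_{K'})\big)$, with $\sigma'=\sigma+se_j$ the corresponding face of $K'$; if $K'\notin\mathcal M$ then $\partial_ju_i=-s\,u_\sigma/(\tfrac12h^j_K)$. Let $D_{ij}(u)=\frac12(\partial_ju_i+\partial_iu_j)$. The viscosity $\mu_{ij}$ is also constant on orthants: $\mu_{ii}=\mu(\rho_K)$ on $K$,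 and for $i\ne j$, $\mu_{ij}$ is the mean, weighted by $|L|$, of $\mu(\rho_L)$ over the (at most four) cells $L\in\mathcal M$ that share with $K$ the edge (vertex if $d=2$) of $K$ orthogonal to $e_i,e_j$ touched by the orthant. Put $a_\rho(u,v)=\int_\Omega\sum_{i,j}\mu_{ij}D_{ij}(u)D_{ij}(v)\,dx$. *Scheme.* Let $N\ge1$, $\delta t=T/N$, $t_n=n\,\delta t$. Let $\rho_0\in L^\infty(\Omega)$ with $\rho_{\min}\le\rho_0\le\rho_{\max}$ a.e., $u_0\in L^2(\Omega)^d$, and $f(t_n,\cdot)\in L^2(\Omega)^d$ for $1\le n\le N$. Let $\rho^0_K$ be the mean of $\rho_0$ over $K$, and let $u^0=\Pi u_0$ and $f^{n}=\Pi f(t_n,\cdot)$, where $\Pi v\in H_0$ has on each interior $\sigma\perp e_i$ the mean of $v_i$ over $D_\sigma$. A discrete solution $(\rho,u,p)$ is a family $(\rho^{n},u^{n},p^{n})_{1\le n\le N}$ with $u^n\in H_0$ and $\sum_K|K|p^n_K=0$ such that for $0\le n<N$, all $K\in\mathcal M$ and all $v\in H_0$ $$\tfrac1{\delta t}(\rho^{n+1}_K-\rho^n_K)+(\operatorname{div}\rho^{n+1}u^{n+1})_K=0,\qquad(\operatorname{div}u^{n+1})_K=0,$$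 $$\Big(\tfrac{\rho_D^{n+1}u^{n+1}-\rho_D^{n}u^{n}}{\delta t},v\Big)+\big(C(\rho^{n+1}u^{n+1})u^{n+1},v\big)+a_{\rho^{n+1}}(u^{n+1},v)+(\nabla p^{n+1},v)=(f^{n+1},v),$$ where $(\rho_Du)_\sigma=\rho_{D_\sigma}u_\sigma$. Its velocity function is $u_i(t,x)=u_\sigma^{n+1}$ for $t\in(t_n,t_{n+1}]$ and $x\in D_\sigma$, $\sigma\perp e_i$ interior, and $0$ elsewhere. **Lemma (time translates).** For all $U,F,\eta\in\mathbb R$ there is a constant $C>0$, depending only on $d,\Omega,T,\rho_{\min},\rho_{\max},\mu,U,F$ and $\eta$, such that the following holds. For every mesh of $\Omega$ with $\eta_{\mathcal M}\le\eta$, every $N\ge1$, all data as above with $\|u_0\|_{L^2(\Omega)^d}^2\le U^2$ and $\sum_{n=1}^{N}\delta t\,\|f(t_n,\cdot)\|^2_{L^2(\Omega)^d}\le F^2$, every discrete solution $(\rho,u,p)$ and every $0<\tau<T$, $$\int_0^{T-\tau}\!\!\int_\Omega|u(t+\tau,x)-u(t,x)|^2\,dx\,dt\ \le\ C\sqrt{\tau+\delta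 t}.$$ -/

import Mathlib

/-!
The implicit MAC scheme for the incompressible Navier-Stokes equations with variable density and
viscosity, on a structured non-uniform grid.

Index conventions. A primal cell is a multi-index `K : Fin d → ℤ`. The face orthogonal to `e_i`
that separates `K - e_i` from `K` is written `(i, K)`; so the two faces of `K` orthogonal to `e_i`
are `(i, K)` and `(i, K + e_i)`. A cell function is a map `(Fin d → ℤ) → ℝ` (only its values on the
cells of the mesh matter); a velocity field is `u : Fin d → (Fin d → ℤ) → ℝ`, where `u i K` is the
`i`-th component on the face `(i, K)`.
-/

/-- The `i`-th unit multi-index. -/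
def unitIdx {d : ℕ} (i : Fin d) : Fin d → ℤ := Pi.single i 1

/-- A structured grid: the hyperplanes `{y_i = x i m}` for each direction `i`, and a finite set of
cells `∏ i, [x i (K i), x i (K i + 1)]` of the product grid. -/
structure MACGrid (d : ℕ) where
  x : Fin d → ℤ → ℝ
  strictMono_x : ∀ i, StrictMono (x i)
  cells : Finset (Fin d → ℤ)

noncomputable section

namespace MACGrid

variable {d : ℕ}

/-! ### Geometry -/

/-- The closed primal cell `K`. -/
def cell (M : MACGrid d) (K : Fin d → ℤ) : Set (Fin d → ℝ) :=
  Set.Icc (fun i => M.x i (K i)) (fun i => M.x i (K i + 1))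

/-- `M` is a mesh of the open set `Ω`: the closed cells fill the closure of `Ω`, and `Ω` has no
slits along faces. -/
def IsMeshOf (M : MACGrid d) (Ω : Set (Fin d → ℝ)) : Prop :=
  Ω = interior (⋃ K ∈ M.cells, M.cell K)

/-- Length of the `m`-th interval in direction `i`. -/
def width (M : MACGrid d) (i : Fin d) (m : ℤ) : ℝ := M.x i (m + 1) - M.x i m

/-- Midpoint of the `m`-th interval in direction `i`. -/
def mid (M : MACGrid d) (i : Fin d) (m : ℤ) : ℝ := (M.x i m + M.x i (m + 1)) / 2

/-- `|K|`. -/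
def vol (M : MACGrid d) (K : Fin d → ℤ) : ℝ := ∏ i, M.width i (K i)

/-- `|σ|` for the face `σ = (i, K)`. -/
def area (M : MACGrid d) (i : Fin d) (K : Fin d → ℤ) : ℝ :=
  ∏ j ∈ Finset.univ.erase i, M.width j (K j)

/-- `(i, K)` is a face of the mesh (interior or on the boundary). -/
def IsFace (M : MACGrid d) (i : Fin d) (K : Fin d → ℤ) : Prop :=
  K ∈ M.cells ∨ K - unitIdx i ∈ M.cells

/-- The interior faces orthogonal to `e_i`. -/
def intFaces (M : MACGrid d) (i : Fin d) : Finset (Fin d → ℤ) :=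
  M.cells.filter (fun K => K - unitIdx i ∈ M.cells)

/-- The regularity `η_M`: the largest ratio `|σ| / |σ'|` of two faces that are orthogonal to
different axes. The set below is finite. -/
def eta (M : MACGrid d) : ℝ :=
  sSup {r | ∃ (i j : Fin d) (K L : Fin d → ℤ), i ≠ j ∧ M.IsFace i K ∧ M.IsFace j L ∧
    r = M.area i K / M.area j L}

/-- The dual cell `D_σ` of the interior face `σ = (i, K)`: the union of the halves of `K - e_i` and
of `K` that are adjacent to `σ`. -/
def dualCell (M : MACGrid d) (i : Fin d) (K : Fin d → ℤ) : Set (Fin d → ℝ) :=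
  Set.Icc (fun j => if j = i then M.mid i (K i - 1) else M.x j (K j))
    (fun j => if j = i then M.mid i (K i) else M.x j (K j + 1))

/-- `|D_σ|` for the interior face `σ = (i, K)`. -/
def dualVol (M : MACGrid d) (i : Fin d) (K : Fin d → ℤ) : ℝ :=
  M.vol (K - unitIdx i) / 2 + M.vol K / 2

/-- The space of discrete velocities that vanish on the boundary faces (and, by convention, at the
indices that are not faces of the mesh). -/
def IsVelocity (M : MACGrid d) (u : Fin d → (Fin d → ℤ) → ℝ) : Prop :=
  ∀ i K, K ∉ M.intFaces i → u i K = 0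

/-- `∫_Ω w · v` for two discrete velocities. -/
def inner (M : MACGrid d) (w v : Fin d → (Fin d → ℤ) → ℝ) : ℝ :=
  ∑ i, ∑ K ∈ M.intFaces i, M.dualVol i K * w i K * v i K

/-! ### Projections -/

/-- Mean values over the primal cells. -/
def projCells (M : MACGrid d) (q : (Fin d → ℝ) → ℝ) (K : Fin d → ℤ) : ℝ :=
  (∫ y in M.cell K, q y) / M.vol K

/-- Mean values over the dual cells of the interior faces, and zero on the boundary faces. -/
def projFaces (M : MACGrid d) (v : Fin d → (Fin d → ℝ) → ℝ) (i : Fin d) (K : Fin d → ℤ) : ℝ :=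
  if K ∈ M.intFaces i then (∫ y in M.dualCell i K, v i y) / M.dualVol i K else 0

/-! ### Divergence, mass fluxes and pressure gradient -/

/-- The discrete divergence of `u` on `K`. -/
def div (M : MACGrid d) (u : Fin d → (Fin d → ℤ) → ℝ) (K : Fin d → ℤ) : ℝ :=
  (∑ i, (M.area i (K + unitIdx i) * u i (K + unitIdx i) - M.area i K * u i K)) / M.vol K

/-- The upwind density on the face `(i, K)`. -/
def rhoUp (ρ : (Fin d → ℤ) → ℝ) (u : Fin d → (Fin d → ℤ) → ℝ) (i : Fin d) (K : Fin d → ℤ) : ℝ :=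
  if 0 ≤ u i K then ρ (K - unitIdx i) else ρ K

/-- The mass flux through `(i, K)` in the direction `e_i`, that is, the outward flux
`F_{K - e_i, σ} = -F_{K, σ}`. -/
def flux (M : MACGrid d) (ρ : (Fin d → ℤ) → ℝ) (u : Fin d → (Fin d → ℤ) → ℝ) (i : Fin d)
    (K : Fin d → ℤ) : ℝ :=
  M.area i K * rhoUp ρ u i K * u i K

/-- The discrete divergence of `ρ u` on `K`. -/
def massDiv (M : MACGrid d) (ρ : (Fin d → ℤ) → ℝ) (u : Fin d → (Fin d → ℤ) → ℝ)
    (K : Fin d → ℤ) : ℝ :=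
  (∑ i, (M.flux ρ u i (K + unitIdx i) - M.flux ρ u i K)) / M.vol K

/-- The discrete pressure gradient on the interior face `(i, K)`. -/
def gradP (M : MACGrid d) (p : (Fin d → ℤ) → ℝ) (i : Fin d) (K : Fin d → ℤ) : ℝ :=
  M.area i K / M.dualVol i K * (p K - p (K - unitIdx i))

/-! ### Convection -/

/-- The density on the dual cell of the interior face `(i, K)`. -/
def rhoDual (M : MACGrid d) (ρ : (Fin d → ℤ) → ℝ) (i : Fin d) (K : Fin d → ℤ) : ℝ :=
  (M.vol (K - unitIdx i) / 2 * ρ (K - unitIdx i) + M.vol K / 2 * ρ K) / M.dualVol i K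

/-- The mass flux, in the direction `e_j`, through the dual face that separates the dual cells of
`(i, K - e_j)` and `(i, K)`. For `j = i` this dual face cuts the cell `K - e_i` in two, and the flux
is the mean of the fluxes through the two faces of that cell; for `j ≠ i` it consists of halves of
the faces `(j, K - e_i)` and `(j, K)`, and the flux is half the sum of their fluxes. -/
def dualFlux (M : MACGrid d) (ρ : (Fin d → ℤ) → ℝ) (u : Fin d → (Fin d → ℤ) → ℝ) (i j : Fin d)
    (K : Fin d → ℤ) : ℝ :=
  (M.flux ρ u j (K - unitIdx i) + M.flux ρ u j K) / 2

/-- The upwind value of `v i` on that dual face. -/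
def velUp (M : MACGrid d) (ρ : (Fin d → ℤ) → ℝ) (u v : Fin d → (Fin d → ℤ) → ℝ) (i j : Fin d)
    (K : Fin d → ℤ) : ℝ :=
  if 0 ≤ M.dualFlux ρ u i j K then v i (K - unitIdx j) else v i K

/-- The convection operator `C(ρ u) v` on the interior face `(i, K)`. (On a dual face that lies in
the boundary the flux vanishes when `u` is an `IsVelocity`.) -/
def conv (M : MACGrid d) (ρ : (Fin d → ℤ) → ℝ) (u v : Fin d → (Fin d → ℤ) → ℝ) (i : Fin d)
    (K : Fin d → ℤ) : ℝ :=
  (∑ j, (M.dualFlux ρ u i j (K + unitIdx j) * M.velUp ρ u v i j (K + unitIdx j)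
      - M.dualFlux ρ u i j K * M.velUp ρ u v i j K)) / M.dualVol i K

/-! ### Diffusion

The midplanes of a cell `K` cut it into `2 ^ d` congruent orthants, labelled by
`q : Fin d → Bool` (`q i = true` for the half with larger `i`-th coordinate). All cells `D_ε` that
carry the discrete derivatives are unions of orthants, so the functions that are constant on the
`D_ε` are given by their values on the orthants. -/

/-- Offset of the face of `K` in direction `i` that touches the orthant: `0` or `1`. -/
def off (b : Bool) : ℤ := if b then 1 else 0

/-- Side of the orthant: `1` or `-1`. -/
def sgn (b : Bool) : ℤ := if b then 1 else -1

/-- The discrete derivative `∂_j u_i` on the orthant `q` of the cell `K`. For `i = j` it is the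
difference quotient across `K`. For `i ≠ j`, let `σ` be the face of `K` orthogonal to `e_i` that
touches the orthant: it is the difference quotient between `σ` and its translate `σ'` in the
adjacent cell across the side `q j`, or, if there is no such cell in the mesh, the difference
quotient between `σ` and the value `0` on the boundary. -/
def deriv (M : MACGrid d) (u : Fin d → (Fin d → ℤ) → ℝ) (i j : Fin d) (K : Fin d → ℤ)
    (q : Fin d → Bool) : ℝ :=
  if i = j then (u i (K + unitIdx i) - u i K) / M.width i (K i)
  else if K + sgn (q j) • unitIdx j ∈ M.cells then
    (sgn (q j) : ℝ) *
      (u i (K + off (q i) • unitIdx i + sgn (q j) • unitIdx j) - u i (K + off (q i) • unitIdx i)) /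
      ((M.width j (K j) + M.width j (K j + sgn (q j))) / 2)
  else
    (sgn (q j) : ℝ) * (0 - u i (K + off (q i) • unitIdx i)) / (M.width j (K j) / 2)

/-- The discrete strain rate `(∂_j u_i + ∂_i u_j) / 2`. -/
def strain (M : MACGrid d) (u : Fin d → (Fin d → ℤ) → ℝ) (i j : Fin d) (K : Fin d → ℤ)
    (q : Fin d → Bool) : ℝ :=
  (M.deriv u i j K q + M.deriv u j i K q) / 2

/-- The cells of the mesh (at most four) that contain the edge of `K`, orthogonal to `e_i` and
`e_j`, that touches the orthant `q`. -/
def edgeCells (M : MACGrid d) (i j : Fin d) (K : Fin d → ℤ) (q : Fin d → Bool) :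
    Finset (Fin d → ℤ) :=
  M.cells.filter (fun L => L = K ∨ L = K + sgn (q i) • unitIdx i ∨ L = K + sgn (q j) • unitIdx j ∨
    L = K + sgn (q i) • unitIdx i + sgn (q j) • unitIdx j)

/-- The discrete viscosity: `μ(ρ_K)` for `i = j`, and otherwise the mean of the viscosities of the
cells around the edge, weighted by their volumes. -/
def visc (M : MACGrid d) (μ : ℝ → ℝ) (ρ : (Fin d → ℤ) → ℝ) (i j : Fin d) (K : Fin d → ℤ)
    (q : Fin d → Bool) : ℝ :=
  if i = j then μ (ρ K)
  else (∑ L ∈ M.edgeCells i j K q, M.vol L * μ (ρ L)) / ∑ L ∈ M.edgeCells i j K q, M.vol L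

/-- `∫_Ω μ D(u) : D(v)`. -/
def diffusion (M : MACGrid d) (μ : ℝ → ℝ) (ρ : (Fin d → ℤ) → ℝ)
    (u v : Fin d → (Fin d → ℤ) → ℝ) : ℝ :=
  ∑ K ∈ M.cells, ∑ q : Fin d → Bool, M.vol K / 2 ^ d *
    ∑ i, ∑ j, M.visc μ ρ i j K q * M.strain u i j K q * M.strain v i j K q

/-! ### The scheme -/

/-- `(ρ ^ n, u ^ n, p ^ n)`, `0 ≤ n ≤ N`, is a discrete solution on `[0, T]` with the time step
`T / N`, viscosity law `μ`, initial data `ρ₀`, `u₀` and source `f`. (`p 0` plays no role.) -/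
structure IsSolution (M : MACGrid d) (N : ℕ) (T : ℝ) (μ : ℝ → ℝ) (ρ₀ : (Fin d → ℝ) → ℝ)
    (u₀ : Fin d → (Fin d → ℝ) → ℝ) (f : ℝ → Fin d → (Fin d → ℝ) → ℝ)
    (ρ : ℕ → (Fin d → ℤ) → ℝ) (u : ℕ → Fin d → (Fin d → ℤ) → ℝ)
    (p : ℕ → (Fin d → ℤ) → ℝ) : Prop where
  initial_density : ∀ K ∈ M.cells, ρ 0 K = M.projCells ρ₀ K
  initial_velocity : u 0 = M.projFaces u₀
  velocity : ∀ n < N, M.IsVelocity (u (n + 1))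
  pressure : ∀ n < N, ∑ K ∈ M.cells, M.vol K * p (n + 1) K = 0
  mass : ∀ n < N, ∀ K ∈ M.cells,
    (ρ (n + 1) K - ρ n K) / (T / N) + M.massDiv (ρ (n + 1)) (u (n + 1)) K = 0
  momentum : ∀ n < N, ∀ v, M.IsVelocity v →
    M.inner (fun i K => (M.rhoDual (ρ (n + 1)) i K * u (n + 1) i K
        - M.rhoDual (ρ n) i K * u n i K) / (T / N)) v
      + M.inner (M.conv (ρ (n + 1)) (u (n + 1)) (u (n + 1))) v
      + M.diffusion μ (ρ (n + 1)) (u (n + 1)) v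
      + M.inner (M.gradP (p (n + 1))) v
      = M.inner (M.projFaces (f ((n + 1 : ℕ) * (T / N)))) v
  divergence_free : ∀ n < N, ∀ K ∈ M.cells, M.div (u (n + 1)) K = 0

/-- The `i`-th component of the piecewise constant velocity: `u_i(t, y) = u_σ ^ (n+1)` for
`t ∈ (t_n, t_{n+1}]` and `y ∈ D_σ`. -/
def velocityFn (M : MACGrid d) (N : ℕ) (T : ℝ) (u : ℕ → Fin d → (Fin d → ℤ) → ℝ) (i : Fin d)
    (t : ℝ) (y : Fin d → ℝ) : ℝ :=
  ∑ n ∈ Finset.range N, ∑ K ∈ M.intFaces i,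
    u (n + 1) i K * (M.dualCell i K).indicator 1 y *
      (Set.Ioc (n * (T / N)) ((n + 1 : ℕ) * (T / N))).indicator 1 t

end MACGrid

end

/-!
The proof compares the velocities at two discrete times `n < m` directly, and then integrates in
time.

*Uniform bounds.* The discrete maximum principle (`max_principle`) keeps the densities between
`ρmin` and `ρmax`. The mass balance on the primal cells yields one on the dual cells
(`tsum_dualMass_balance`), and with it the momentum balance tested with `u` gives an energy
inequality (`energy_step`): the upwind convection is dissipative, and the pressure drops out because
`u` is divergence-free. The diffusion controls the discrete gradient by a discrete Korn inequality
(`gradSq_le_strain`). It rests on a discrete form of `∫ ∂_j u_i ∂_i u_j = ∫ ∂_i u_i ∂_j u_j` in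
terms of the increments of the velocity across the edges (`tsum_cross_eq`). Around an edge that
belongs to four cells the products of the discrete derivatives add up exactly to the product of the
increments; around a reentrant edge, with three cells, they do not, and the excess is absorbed by a
part of the squares of the derivatives (`reentrant_edge_sum_ge`). The result is a bound for `u` in
`L²(0, T; H¹)` (`IsSolution.sum_h1Sq_le`).

*Embedding.* The bound on `η_M` compares the widths of all cells in all directions, so that the mesh
is quasi-uniform (`exists_quasiUniform`), although nothing is assumed on the ratio of the widths of
neighbouring cells. A velocity, extended by zero, is then a finitely supported function on a uniform
lattice up to constants, and the Ladyzhenskaya inequality on the lattice bounds its `L⁴` norm by the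
discrete `H¹` norm, in dimensions two and three. By the Hölder inequality with exponents `4`, `4`
and `2`, the convection is a bounded trilinear form in `H¹`
(`QuasiUniform.abs_sum_tsum_dualFlux_le`).

*Increments.* Put `w = u m - u n`. Then
`ρ n |w| ^ 2 = (ρ m u m - ρ n u n) · w - (ρ m - ρ n) u m · w`. The first term is a sum of momentum
balances tested with the divergence-free `w`, and the second a sum of mass balances tested with
`u m · w`. Both consist of trilinear and lower order terms, so that, with `e l` equal to one plus
the norms of `u l` and of the source, the left-hand side is at most a constant times
`∑ δt (e l ^ 2 (e m + e n) + e l (e m + e n) ^ 2)`, summed over `n < l ≤ m`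
(`IsSolution.inner_increment_le`).

*Integration in time.* Only `∑ δt e l ^ 2` is bounded. In the first kind of terms the sum over `l`
is exchanged with the integral, and each `l` is active for a time `τ` only, which gives `√τ` by the
inequality of Young; in the second kind the Cauchy-Schwarz inequality in `l` gives `√(τ + δt)`,
because the active time steps have total length at most `τ + δt` (`integral_translate_le`).
-/

/-! ### Sums of finitely supported functions on a lattice -/

section LatticeSums

open Function

@[simp]
theorem injective_add_const {α : Type*} [AddGroup α] (e : α) : Injective fun K : α => K + e :=
  add_left_injective e

@[simp]
theorem injective_sub_const {α : Type*} [AddGroup α] (e : α) : Injective fun K : α => K - e :=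
  sub_left_injective

@[fun_prop]
theorem Function.HasFiniteSupport.abs {α : Type*} {f : α → ℝ} (hf : HasFiniteSupport f) :
    HasFiniteSupport fun a => |f a| :=
  hf.fun_comp abs_zero

theorem Function.HasFiniteSupport.summable {α : Type*} {f : α → ℝ} (hf : HasFiniteSupport f) :
    Summable f :=
  summable_of_hasFiniteSupport hf

theorem hasFiniteSupport_of_finset {α : Type*} {f : α → ℝ} (s : Finset α)
    (h : ∀ K, K ∉ s → f K = 0) : HasFiniteSupport f :=
  s.finite_toSet.subset fun K hK => by_contra fun hs => hK (h K hs)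

variable {α : Type*} [AddCommGroup α]

theorem tsum_add_const (f : α → ℝ) (e : α) : ∑' K, f (K + e) = ∑' K, f K :=
  (Equiv.addRight e).tsum_eq f

theorem tsum_sub_const (f : α → ℝ) (e : α) : ∑' K, f (K - e) = ∑' K, f K :=
  (Equiv.subRight e).tsum_eq f

/-- Discrete integration by parts. -/
theorem tsum_diff_mul (G : α → ℝ) {v : α → ℝ} (hv : HasFiniteSupport v) (e : α) :
    ∑' K, (G (K + e) - G K) * v K = -∑' K, G K * (v K - v (K - e)) := by
  have h1 : Summable fun K => G (K + e) * v K :=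
    HasFiniteSupport.summable (by fun_prop (disch := simp))
  have h2 : Summable fun K => G K * v K :=
    HasFiniteSupport.summable (by fun_prop (disch := simp))
  have h3 : Summable fun K => G K * v (K - e) :=
    HasFiniteSupport.summable (by fun_prop (disch := simp))
  have h4 := tsum_add_const (fun K => G K * v (K - e)) e
  simp only [add_sub_cancel_right] at h4
  simp only [sub_mul, mul_sub]
  rw [h1.tsum_sub h2, h2.tsum_sub h3, h4]
  ring

/-- The Cauchy-Schwarz inequality. -/
theorem sq_tsum_mul_le {α : Type*} {f g : α → ℝ} (hf : HasFiniteSupport f)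
    (hg : HasFiniteSupport g) :
    (∑' K, f K * g K) ^ 2 ≤ (∑' K, f K ^ 2) * ∑' K, g K ^ 2 := by
  classical
  obtain ⟨s, hs'⟩ := (Set.Finite.union hf hg).exists_finset
  have hs : ∀ K ∉ s, f K = 0 ∧ g K = 0 := fun K hK => by
    simpa [not_or] using fun h => hK ((hs' K).mpr h)
  rw [tsum_eq_sum (s := s) fun K hK => by simp [hs K hK],
    tsum_eq_sum (s := s) fun K hK => by simp [hs K hK],
    tsum_eq_sum (s := s) fun K hK => by simp [hs K hK]]
  exact Finset.sum_mul_sq_le_sq_mul_sq s f g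

theorem tsum_le_tsum_of_hasFiniteSupport {α : Type*} {f g : α → ℝ} (h : ∀ K, f K ≤ g K)
    (hf : HasFiniteSupport f) (hg : HasFiniteSupport g) : ∑' K, f K ≤ ∑' K, g K :=
  hf.summable.tsum_le_tsum h hg.summable

/-- A Hölder inequality with the exponents `4`, `4` and `2`. -/
theorem abs_tsum_mul_mul_pow_four_le {α : Type*} {a b c : α → ℝ} (ha : HasFiniteSupport a)
    (hb : HasFiniteSupport b) (hc : HasFiniteSupport c) :
    (∑' K, a K * b K * c K) ^ 4 ≤
      (∑' K, a K ^ 4) * (∑' K, b K ^ 4) * (∑' K, c K ^ 2) ^ 2 := by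
  have h1 := sq_tsum_mul_le (f := fun K => a K * b K) (g := c) (by fun_prop (disch := simp)) hc
  have h2 := sq_tsum_mul_le (f := fun K => a K ^ 2) (g := fun K => b K ^ 2)
    (by fun_prop (disch := simp)) (by fun_prop (disch := simp))
  simp only [← pow_mul, ← mul_pow] at h2
  calc (∑' K, a K * b K * c K) ^ 4 = ((∑' K, a K * b K * c K) ^ 2) ^ 2 := by ring
    _ ≤ ((∑' K, (a K * b K) ^ 2) * ∑' K, c K ^ 2) ^ 2 := by gcongr
    _ = (∑' K, (a K * b K) ^ 2) ^ 2 * (∑' K, c K ^ 2) ^ 2 := by ring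
    _ ≤ _ := by gcongr

end LatticeSums

/-! ### A discrete Ladyzhenskaya inequality -/

section Ladyzhenskaya

open Function

theorem le_tsum_abs_diff {f : ℤ → ℝ} (hf : HasFiniteSupport f) (x : ℤ) :
    f x ≤ ∑' t, |f (t + 1) - f t| := by
  obtain ⟨B, hB⟩ := hf.bddAbove
  have hz : ∀ t, B < t → f t = 0 := fun t ht => by
    by_contra h
    exact absurd (hB h) (not_le.mpr ht)
  have hs : HasFiniteSupport fun t => |f (t + 1) - f t| := by fun_prop (disch := simp)
  have key : ∀ n : ℕ, f x ≤ ∑ k ∈ Finset.range n, |f (x + k + 1) - f (x + k)| + f (x + n) := by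
    intro n
    induction n with
    | zero => simp
    | succ n ih =>
      rw [Finset.sum_range_succ]
      have h1 := neg_abs_le (f (x + n + 1) - f (x + n))
      push_cast
      rw [← add_assoc x]
      linarith
  obtain ⟨n, hn⟩ : ∃ n : ℕ, B - x < n := ⟨(B - x + 1).toNat, by omega⟩
  have h1 := key n
  rw [hz (x + n) (by linarith), add_zero] at h1
  refine h1.trans ?_
  have hinj : Injective fun k : ℕ => x + (k : ℤ) := fun a b h => by simpa using h
  have h2 := (hs.fun_comp_of_injective hinj).summable.sum_le_tsum (Finset.range n)
    (fun _ _ => abs_nonneg _)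
  exact h2.trans (tsum_comp_le_tsum_of_inj hs.summable (fun _ => abs_nonneg _) hinj)

/-- In the plane, `G (a, b) ^ 4` is at most the product of the variations of `G ^ 2` along the two
lattice lines through `(a, b)`; these depend on one variable each, and the sum factors. -/
theorem tsum_pow_four_le_prod {G : ℤ × ℤ → ℝ} (hG : HasFiniteSupport G) :
    ∑' p, G p ^ 4 ≤ (∑' p, |G (p + (1, 0)) ^ 2 - G p ^ 2|) *
      ∑' p, |G (p + (0, 1)) ^ 2 - G p ^ 2| := by
  have h1 : HasFiniteSupport fun p => |G (p + (1, 0)) ^ 2 - G p ^ 2| := by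
    fun_prop (disch := simp)
  have h2 : HasFiniteSupport fun p => |G (p + (0, 1)) ^ 2 - G p ^ 2| := by
    fun_prop (disch := simp)
  have hswap : Injective (Prod.swap : ℤ × ℤ → ℤ × ℤ) := Prod.swap_injective
  have h1' := h1.fun_comp_of_injective hswap
  have hA := h1'.summable.prod
  have hB := h2.summable.prod
  have eA := h1'.summable.tsum_prod
  have eB := h2.summable.tsum_prod
  have eS := (Equiv.prodComm ℤ ℤ).tsum_eq (fun p => |G (p + (1, 0)) ^ 2 - G p ^ 2|)
  simp only [Equiv.prodComm_apply] at eS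
  rw [eS] at eA
  rw [eA, eB]
  simp only [Prod.swap_prod_mk] at hA ⊢
  set A : ℤ → ℝ := fun b => ∑' a, |G ((a, b) + (1, 0)) ^ 2 - G (a, b) ^ 2|
  set B : ℤ → ℝ := fun a => ∑' b, |G ((a, b) + (0, 1)) ^ 2 - G (a, b) ^ 2|
  have hA0 : ∀ b, 0 ≤ A b := fun b => tsum_nonneg fun _ => abs_nonneg _
  have hB0 : ∀ a, 0 ≤ B a := fun a => tsum_nonneg fun _ => abs_nonneg _
  have hAB : Summable fun p : ℤ × ℤ => A p.2 * B p.1 := by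
    have := hB.mul_of_nonneg hA hB0 hA0
    simpa only [mul_comm] using this
  have hprod : (∑' b, A b) * ∑' a, B a = ∑' p : ℤ × ℤ, A p.2 * B p.1 := by
    rw [mul_comm, hB.tsum_mul_tsum hA (by simpa only [mul_comm] using hAB)]
    simp only [mul_comm]
  rw [hprod]
  refine Summable.tsum_le_tsum (fun p => ?_)
    (HasFiniteSupport.summable (by fun_prop (disch := simp))) hAB
  have ha : HasFiniteSupport fun a => G (a, p.2) ^ 2 :=
    (hG.fun_comp_of_injective (Prod.mk_left_injective p.2)).fun_comp (g := fun x => x ^ 2)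
      (by norm_num)
  have hb : HasFiniteSupport fun b => G (p.1, b) ^ 2 :=
    (hG.fun_comp_of_injective (Prod.mk_right_injective p.1)).fun_comp (g := fun x => x ^ 2)
      (by norm_num)
  have ka := le_tsum_abs_diff ha p.1
  have kb := le_tsum_abs_diff hb p.2
  have ka' : G p ^ 2 ≤ A p.2 := by simpa [A] using ka
  have kb' : G p ^ 2 ≤ B p.1 := by simpa [B] using kb
  calc G p ^ 4 = G p ^ 2 * G p ^ 2 := by ring
    _ ≤ _ := mul_le_mul ka' kb' (sq_nonneg _) (hA0 _)

/-- The variation of `v ^ 2` in one direction is controlled by the norms of `v` and of its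
increments. -/
theorem sq_tsum_abs_diff_sq_le {α : Type*} [AddCommGroup α] {v : α → ℝ} (hv : HasFiniteSupport v)
    (e : α) :
    (∑' K, |v (K + e) ^ 2 - v K ^ 2|) ^ 2 ≤
      4 * (∑' K, v K ^ 2) * ∑' K, (v (K + e) - v K) ^ 2 := by
  have h1 := sq_tsum_mul_le (f := fun K => |v (K + e) + v K|) (g := fun K => |v (K + e) - v K|)
    (by fun_prop (disch := simp)) (by fun_prop (disch := simp))
  simp only [← abs_mul, sq_abs] at h1
  have h2 : ∑' K, (v (K + e) + v K) ^ 2 ≤ 4 * ∑' K, v K ^ 2 := by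
    have s1 : HasFiniteSupport fun K => v K ^ 2 := by fun_prop (disch := simp)
    have s2 : HasFiniteSupport fun K => v (K + e) ^ 2 := by fun_prop (disch := simp)
    calc ∑' K, (v (K + e) + v K) ^ 2 ≤ ∑' K, (2 * v (K + e) ^ 2 + 2 * v K ^ 2) := by
          refine tsum_le_tsum_of_hasFiniteSupport (fun K => ?_) (by fun_prop (disch := simp))
            (by fun_prop (disch := simp))
          nlinarith [sq_nonneg (v (K + e) - v K)]
      _ = 4 * ∑' K, v K ^ 2 := by
          rw [(s2.summable.mul_left 2).tsum_add (s1.summable.mul_left 2), tsum_mul_left,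
            tsum_mul_left, tsum_add_const (fun K => v K ^ 2)]
          ring
  calc (∑' K, |v (K + e) ^ 2 - v K ^ 2|) ^ 2
      = (∑' K, |(v (K + e) + v K) * (v (K + e) - v K)|) ^ 2 := by
        congr 2
        ext K
        congr 1
        ring
    _ ≤ _ := h1
    _ ≤ _ := by
        gcongr

/-- The `i`-th directional part of the squared norm of the increments of `v`. -/
noncomputable def incrSq {d : ℕ} (v : (Fin d → ℤ) → ℝ) (i : Fin d) : ℝ :=
  ∑' K, (v (K + unitIdx i) - v K) ^ 2

theorem incrSq_nonneg {d : ℕ} (v : (Fin d → ℤ) → ℝ) (i : Fin d) : 0 ≤ incrSq v i :=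
  tsum_nonneg fun _ => sq_nonneg _

theorem tsum_pow_four_le_two {v : (Fin 2 → ℤ) → ℝ} (hv : HasFiniteSupport v) :
    ∑' K, v K ^ 4 ≤ 2 * (∑' K, v K ^ 2) * ∑ i, incrSq v i := by
  set e := (finTwoArrowEquiv ℤ).symm with he
  have hG : HasFiniteSupport fun p => v (e p) := hv.fun_comp_of_injective e.injective
  have e0 : ∀ p, e (p + (1, 0)) = e p + unitIdx 0 := by
    intro p; ext k; fin_cases k <;> simp [e, unitIdx]
  have e1 : ∀ p, e (p + (0, 1)) = e p + unitIdx 1 := by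
    intro p; ext k; fin_cases k <;> simp [e, unitIdx]
  have h := tsum_pow_four_le_prod hG
  simp only [e0, e1] at h
  rw [e.tsum_eq (fun K => v K ^ 4), e.tsum_eq (fun K => |v (K + unitIdx 0) ^ 2 - v K ^ 2|),
    e.tsum_eq (fun K => |v (K + unitIdx 1) ^ 2 - v K ^ 2|)] at h
  have h0 := sq_tsum_abs_diff_sq_le hv (unitIdx 0)
  have h1 := sq_tsum_abs_diff_sq_le hv (unitIdx 1)
  rw [Fin.sum_univ_two]
  refine h.trans ?_
  have n0 := incrSq_nonneg v 0
  have n1 := incrSq_nonneg v 1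
  have nv : 0 ≤ ∑' K, v K ^ 2 := tsum_nonneg fun _ => sq_nonneg _
  simp only [incrSq] at n0 n1 ⊢
  refine (le_abs_self _).trans (abs_le_of_sq_le_sq ?_ (by positivity))
  calc _ = (∑' K, |v (K + unitIdx 0) ^ 2 - v K ^ 2|) ^ 2 *
        (∑' K, |v (K + unitIdx 1) ^ 2 - v K ^ 2|) ^ 2 := by ring
    _ ≤ _ := mul_le_mul h0 h1 (sq_nonneg _) (by positivity)
    _ ≤ _ := by
      have := mul_nonneg (sq_nonneg (∑' K, v K ^ 2)) (sq_nonneg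
        ((∑' K, (v (K + unitIdx 0) - v K) ^ 2) - ∑' K, (v (K + unitIdx 1) - v K) ^ 2))
      linarith

/-- In three dimensions the planar inequality is applied on each slice; the norm on a slice is
controlled by the variation of `v ^ 2` across the slices. -/
theorem sq_tsum_pow_four_le_three {v : (Fin 3 → ℤ) → ℝ} (hv : HasFiniteSupport v) :
    (∑' K, v K ^ 4) ^ 2 ≤ 16 * (∑' K, v K ^ 2) * (∑ i, incrSq v i) ^ 3 := by
  set e : ℤ × (Fin 2 → ℤ) ≃ (Fin 3 → ℤ) := Fin.consEquiv (fun _ => ℤ)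
  have fub : ∀ f : (Fin 3 → ℤ) → ℝ, HasFiniteSupport f →
      Summable (fun c => ∑' L, f (e (c, L))) ∧ ∑' K, f K = ∑' c, ∑' L, f (e (c, L)) := by
    intro f hf
    have h := hf.fun_comp_of_injective e.injective
    exact ⟨h.summable.prod, by rw [← e.tsum_eq f, h.summable.tsum_prod]⟩
  have hsl : ∀ c, HasFiniteSupport fun L => v (e (c, L)) := fun c =>
    hv.fun_comp_of_injective (e.injective.comp (Prod.mk_right_injective c))
  have es : ∀ c L (j : Fin 2), e (c, L + unitIdx j) = e (c, L) + unitIdx j.succ := by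
    intro c L j
    ext k
    refine Fin.cases ?_ (fun k => ?_) k <;>
      simp [e, unitIdx, Fin.consEquiv, Pi.single_apply]
  have e0 : ∀ c L, e (c + 1, L) = e (c, L) + unitIdx 0 := by
    intro c L
    ext k
    refine Fin.cases ?_ (fun k => ?_) k <;>
      simp [e, unitIdx, Fin.consEquiv]
  set D := ∑' K, |v (K + unitIdx 0) ^ 2 - v K ^ 2| with hD
  have s2 : HasFiniteSupport fun K => v K ^ 2 := by fun_prop (disch := simp)
  have sD : HasFiniteSupport fun K => |v (K + unitIdx 0) ^ 2 - v K ^ 2| := by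
    fun_prop (disch := simp)
  have sI : ∀ i, HasFiniteSupport fun K => (v (K + unitIdx i) - v K) ^ 2 := fun i => by
    fun_prop (disch := simp)
  have hM : ∀ c, ∑' L, v (e (c, L)) ^ 2 ≤ D := by
    intro c
    have hm : HasFiniteSupport fun c => ∑' L, v (e (c, L)) ^ 2 := by
      refine ((s2.fun_comp_of_injective e.injective).image Prod.fst).subset fun a ha => ?_
      by_contra hcon
      refine ha ?_
      have : ∀ L, v (e (a, L)) ^ 2 = 0 := fun L => by
        by_contra hL
        exact hcon ⟨(a, L), hL, rfl⟩
      simp [this]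
    refine (le_tsum_abs_diff hm c).trans ?_
    obtain ⟨k1, k2⟩ := fub _ sD
    rw [hD, k2]
    have hm' := hm.fun_comp_of_injective (injective_add_const (1 : ℤ))
    refine Summable.tsum_le_tsum (fun t => ?_) (hm'.fun_sub hm).abs.summable k1
    have q : ∀ c, HasFiniteSupport fun L => v (e (c, L)) ^ 2 := fun c =>
      (hsl c).fun_comp (g := fun x => x ^ 2) (by norm_num)
    rw [← (q _).summable.tsum_sub (q _).summable, ← Real.norm_eq_abs]
    have r : Summable fun L => ‖v (e (t + 1, L)) ^ 2 - v (e (t, L)) ^ 2‖ :=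
      ((q _).summable.sub (q _).summable).norm
    refine (norm_tsum_le_tsum_norm r).trans (le_of_eq ?_)
    simp only [e0, Real.norm_eq_abs]
  have h4 : ∑' K, v K ^ 4 ≤ 2 * D * (incrSq v 1 + incrSq v 2) := by
    obtain ⟨k1, k2⟩ := fub (fun K => v K ^ 4) (by fun_prop (disch := simp))
    obtain ⟨m1, m2⟩ := fub _ (sI 1)
    obtain ⟨n1, n2⟩ := fub _ (sI 2)
    rw [incrSq, incrSq, k2, m2, n2, ← m1.tsum_add n1, ← tsum_mul_left]
    refine Summable.tsum_le_tsum (fun c => ?_) k1 ((m1.add n1).mul_left _)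
    have := tsum_pow_four_le_two (hsl c)
    rw [Fin.sum_univ_two] at this
    simp only [incrSq, es] at this
    refine this.trans ?_
    have z1 : 0 ≤ ∑' L, (v (e (c, L) + unitIdx (Fin.succ 0)) - v (e (c, L))) ^ 2 :=
      tsum_nonneg fun _ => sq_nonneg _
    have z2 : 0 ≤ ∑' L, (v (e (c, L) + unitIdx (Fin.succ 1)) - v (e (c, L))) ^ 2 :=
      tsum_nonneg fun _ => sq_nonneg _
    have := hM c
    exact mul_le_mul_of_nonneg_right (by linarith) (add_nonneg z1 z2)
  have hD2 : D ^ 2 ≤ 4 * (∑' K, v K ^ 2) * incrSq v 0 := sq_tsum_abs_diff_sq_le hv _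
  have n0 := incrSq_nonneg v 0
  have n1 := incrSq_nonneg v 1
  have n2 := incrSq_nonneg v 2
  have nv : 0 ≤ ∑' K, v K ^ 2 := tsum_nonneg fun _ => sq_nonneg _
  have n4 : 0 ≤ ∑' K, v K ^ 4 := tsum_nonneg fun _ => by positivity
  rw [Fin.sum_univ_three]
  calc (∑' K, v K ^ 4) ^ 2 ≤ (2 * D * (incrSq v 1 + incrSq v 2)) ^ 2 := by gcongr
    _ = 4 * D ^ 2 * (incrSq v 1 + incrSq v 2) ^ 2 := by ring
    _ ≤ 4 * (4 * (∑' K, v K ^ 2) * incrSq v 0) * (incrSq v 1 + incrSq v 2) ^ 2 := by gcongr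
    _ = 16 * (∑' K, v K ^ 2) * (incrSq v 0 * (incrSq v 1 + incrSq v 2) ^ 2) := by ring
    _ ≤ 16 * (∑' K, v K ^ 2) * ((incrSq v 0 + incrSq v 1 + incrSq v 2) *
          (incrSq v 0 + incrSq v 1 + incrSq v 2) ^ 2) := by
        gcongr <;> linarith
    _ = _ := by ring

/-- The embedding of the discrete `H¹` norm into `ℓ⁴`, on a uniform lattice of mesh size `h`; here
`E` bounds the squares of the `L²` norms of `v` and of its difference quotients. -/
theorem pow_mul_tsum_pow_four_le {d : ℕ} (hd : d = 2 ∨ d = 3) {v : (Fin d → ℤ) → ℝ}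
    (hv : HasFiniteSupport v) {h E : ℝ} (hh : 0 < h)
    (h2 : h ^ d * ∑' K, v K ^ 2 ≤ E) (h3 : h ^ d * ∑ i, incrSq v i ≤ h ^ 2 * E) :
    h ^ d * ∑' K, v K ^ 4 ≤ 4 * E ^ 2 := by
  have nv : 0 ≤ ∑' K, v K ^ 2 := tsum_nonneg fun _ => sq_nonneg _
  have hE : 0 ≤ E := le_trans (by positivity) h2
  have ni : 0 ≤ ∑ i, incrSq v i := Finset.sum_nonneg fun i _ => incrSq_nonneg v i
  have n4 : 0 ≤ ∑' K, v K ^ 4 := tsum_nonneg fun _ => by positivity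
  obtain rfl | rfl := hd
  · have h3' : ∑ i, incrSq v i ≤ E := le_of_mul_le_mul_left h3 (by positivity)
    calc h ^ 2 * ∑' K, v K ^ 4 ≤ h ^ 2 * (2 * (∑' K, v K ^ 2) * ∑ i, incrSq v i) := by
          gcongr
          exact tsum_pow_four_le_two hv
      _ = 2 * (h ^ 2 * ∑' K, v K ^ 2) * ∑ i, incrSq v i := by ring
      _ ≤ 2 * E * E := by gcongr
      _ ≤ 4 * E ^ 2 := by nlinarith
  · have h3' : h * ∑ i, incrSq v i ≤ E := by
      refine le_of_mul_le_mul_left (a := h ^ 2) ?_ (by positivity)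
      linarith
    refine (le_abs_self _).trans (abs_le_of_sq_le_sq ?_ (by positivity))
    calc (h ^ 3 * ∑' K, v K ^ 4) ^ 2 = h ^ 6 * (∑' K, v K ^ 4) ^ 2 := by ring
      _ ≤ h ^ 6 * (16 * (∑' K, v K ^ 2) * (∑ i, incrSq v i) ^ 3) := by
          gcongr
          exact sq_tsum_pow_four_le_three hv
      _ = 16 * (h ^ 3 * ∑' K, v K ^ 2) * (h * ∑ i, incrSq v i) ^ 3 := by ring
      _ ≤ 16 * E * E ^ 3 := by gcongr
      _ = (4 * E ^ 2) ^ 2 := by ring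

end Ladyzhenskaya

/-! ### Geometry of the mesh, and the discrete `H¹` norm -/

namespace MACGrid

open Function

variable {d : ℕ} {M : MACGrid d}

theorem width_pos (M : MACGrid d) (i : Fin d) (m : ℤ) : 0 < M.width i m :=
  sub_pos.mpr (M.strictMono_x i (lt_add_one m))

theorem vol_pos (M : MACGrid d) (K : Fin d → ℤ) : 0 < M.vol K :=
  Finset.prod_pos fun i _ => M.width_pos i _

theorem area_pos (M : MACGrid d) (i : Fin d) (K : Fin d → ℤ) : 0 < M.area i K :=
  Finset.prod_pos fun j _ => M.width_pos j _

theorem dualVol_pos (M : MACGrid d) (i : Fin d) (K : Fin d → ℤ) : 0 < M.dualVol i K := by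
  have h1 := M.vol_pos K
  have h2 := M.vol_pos (K - unitIdx i)
  unfold dualVol
  positivity

theorem vol_eq (M : MACGrid d) (i : Fin d) (K : Fin d → ℤ) :
    M.vol K = M.width i (K i) * M.area i K :=
  (Finset.mul_prod_erase _ _ (Finset.mem_univ i)).symm

theorem area_add (M : MACGrid d) (i : Fin d) (K : Fin d → ℤ) :
    M.area i (K + unitIdx i) = M.area i K := by
  refine Finset.prod_congr rfl fun j hj => ?_
  simp [unitIdx, Finset.ne_of_mem_erase hj]

theorem area_sub (M : MACGrid d) (i : Fin d) (K : Fin d → ℤ) :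
    M.area i (K - unitIdx i) = M.area i K := by
  rw [← M.area_add i (K - unitIdx i), sub_add_cancel]

theorem mem_intFaces {i : Fin d} {K : Fin d → ℤ} :
    K ∈ M.intFaces i ↔ K ∈ M.cells ∧ K - unitIdx i ∈ M.cells :=
  Finset.mem_filter

theorem IsVelocity.eq_zero_of_notMem {u : Fin d → (Fin d → ℤ) → ℝ} (hu : M.IsVelocity u)
    {i : Fin d} {K : Fin d → ℤ} (h : K ∉ M.cells) : u i K = 0 :=
  hu i K fun hK => h (mem_intFaces.mp hK).1

theorem IsVelocity.eq_zero_of_sub_notMem {u : Fin d → (Fin d → ℤ) → ℝ} (hu : M.IsVelocity u)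
    {i : Fin d} {K : Fin d → ℤ} (h : K - unitIdx i ∉ M.cells) : u i K = 0 :=
  hu i K fun hK => h (mem_intFaces.mp hK).2

theorem IsVelocity.hasFiniteSupport {u : Fin d → (Fin d → ℤ) → ℝ} (hu : M.IsVelocity u)
    (i : Fin d) : HasFiniteSupport (u i) :=
  hasFiniteSupport_of_finset (M.intFaces i) (hu i)

theorem IsVelocity.sub {u v : Fin d → (Fin d → ℤ) → ℝ} (hu : M.IsVelocity u)
    (hv : M.IsVelocity v) : M.IsVelocity (u - v) := fun i K hK => by
  simp [hu i K hK, hv i K hK]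

theorem inner_eq_tsum {v : Fin d → (Fin d → ℤ) → ℝ} (hv : M.IsVelocity v)
    (w : Fin d → (Fin d → ℤ) → ℝ) :
    M.inner w v = ∑ i, ∑' K, M.dualVol i K * w i K * v i K := by
  refine Finset.sum_congr rfl fun i _ => (tsum_eq_sum fun K hK => ?_).symm
  simp [hv i K hK]

theorem inner_self_nonneg (M : MACGrid d) (u : Fin d → (Fin d → ℤ) → ℝ) : 0 ≤ M.inner u u := by
  refine Finset.sum_nonneg fun i _ => Finset.sum_nonneg fun K _ => ?_
  rw [mul_assoc]
  exact mul_nonneg (M.dualVol_pos i K).le (mul_self_nonneg _)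

/-- The squared `L²` norm of the discrete gradient. -/
noncomputable def gradSq (M : MACGrid d) (u : Fin d → (Fin d → ℤ) → ℝ) : ℝ :=
  ∑ K ∈ M.cells, ∑ q : Fin d → Bool, M.vol K / 2 ^ d * ∑ i, ∑ j, M.deriv u i j K q ^ 2

theorem gradSq_nonneg (M : MACGrid d) (u : Fin d → (Fin d → ℤ) → ℝ) : 0 ≤ M.gradSq u := by
  have := M.vol_pos
  unfold gradSq
  exact Finset.sum_nonneg fun K _ => Finset.sum_nonneg fun q _ =>
    mul_nonneg (div_nonneg (this K).le (by positivity))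
      (Finset.sum_nonneg fun i _ => Finset.sum_nonneg fun j _ => sq_nonneg _)

/-- The squared discrete `H¹` norm. -/
noncomputable def h1Sq (M : MACGrid d) (u : Fin d → (Fin d → ℤ) → ℝ) : ℝ :=
  M.inner u u + M.gradSq u

theorem h1Sq_nonneg (M : MACGrid d) (u : Fin d → (Fin d → ℤ) → ℝ) : 0 ≤ M.h1Sq u :=
  add_nonneg (M.inner_self_nonneg u) (M.gradSq_nonneg u)

theorem deriv_sub (M : MACGrid d) (u v : Fin d → (Fin d → ℤ) → ℝ) (i j : Fin d)
    (K : Fin d → ℤ) (q : Fin d → Bool) :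
    M.deriv (u - v) i j K q = M.deriv u i j K q - M.deriv v i j K q := by
  unfold deriv
  split_ifs <;> simp only [Pi.sub_apply] <;> ring

theorem h1Sq_sub_le (M : MACGrid d) (u v : Fin d → (Fin d → ℤ) → ℝ) :
    M.h1Sq (u - v) ≤ 2 * M.h1Sq u + 2 * M.h1Sq v := by
  have h1 : M.inner (u - v) (u - v) ≤ 2 * M.inner u u + 2 * M.inner v v := by
    simp only [inner, Finset.mul_sum, ← Finset.sum_add_distrib]
    refine Finset.sum_le_sum fun i _ => Finset.sum_le_sum fun K _ => ?_
    have := mul_nonneg (M.dualVol_pos i K).le (sq_nonneg (u i K + v i K))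
    simp only [Pi.sub_apply]
    nlinarith
  have h2 : M.gradSq (u - v) ≤ 2 * M.gradSq u + 2 * M.gradSq v := by
    simp only [gradSq, Finset.mul_sum, ← Finset.sum_add_distrib]
    refine Finset.sum_le_sum fun K _ => Finset.sum_le_sum fun q _ => Finset.sum_le_sum fun i _ =>
      Finset.sum_le_sum fun j _ => ?_
    have h := div_nonneg (M.vol_pos K).le (by positivity : (0 : ℝ) ≤ 2 ^ d)
    have := mul_nonneg h (sq_nonneg (M.deriv u i j K q + M.deriv v i j K q))
    rw [deriv_sub]
    nlinarith
  unfold h1Sq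
  linarith

/-- All widths of the cells of the mesh, in all directions, are within the factor `κ` of `h`. -/
structure QuasiUniform (M : MACGrid d) (h κ : ℝ) : Prop where
  pos : 0 < h
  one_le : 1 ≤ κ
  le_width : ∀ K ∈ M.cells, ∀ i, h ≤ κ * M.width i (K i)
  width_le : ∀ K ∈ M.cells, ∀ i, M.width i (K i) ≤ κ * h

theorem area_le_of_eta_le {η : ℝ} (hη : M.eta ≤ η) {i j : Fin d} (hij : i ≠ j)
    {K L : Fin d → ℤ} (hK : K ∈ M.cells) (hL : L ∈ M.cells) : M.area i K ≤ η * M.area j L := by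
  rw [← div_le_iff₀ (M.area_pos j L)]
  refine le_trans ?_ hη
  unfold eta
  refine le_csSup (Set.Finite.bddAbove ?_) ⟨i, j, K, L, hij, Or.inl hK, Or.inl hL, rfl⟩
  have hf : ∀ i, {K | M.IsFace i K}.Finite := fun i => by
    refine (M.cells.finite_toSet.union (M.cells.finite_toSet.image (· + unitIdx i))).subset ?_
    rintro K (h | h)
    · exact Or.inl h
    · exact Or.inr ⟨_, h, sub_add_cancel _ _⟩
  refine (Set.Finite.biUnion (Set.toFinite (Set.univ : Set (Fin d × Fin d))) fun p _ =>
    ((hf p.1).prod (hf p.2)).image fun q => M.area p.1 q.1 / M.area p.2 q.2).subset ?_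
  rintro r ⟨i, j, K, L, _, h1, h2, rfl⟩
  exact Set.mem_biUnion (Set.mem_univ (i, j)) ⟨(K, L), ⟨h1, h2⟩, rfl⟩

/-- A bound on `η_M` makes the mesh quasi-uniform: two faces of one cell compare its widths, and
two faces of different cells then compare the sizes of these cells. -/
theorem exists_quasiUniform (hd : 2 ≤ d) {η : ℝ} (hη : M.eta ≤ η) (hM : M.cells.Nonempty) :
    ∃ h, M.QuasiUniform h (η ^ 3) := by
  obtain ⟨K₀, hK₀⟩ := hM
  let i₀ : Fin d := ⟨0, by omega⟩
  let i₁ : Fin d := ⟨1, by omega⟩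
  have hi : i₀ ≠ i₁ := by simp [i₀, i₁]
  have hη0 : 0 < η := by
    have h1 := area_le_of_eta_le hη hi hK₀ hK₀
    exact pos_of_mul_pos_left ((M.area_pos i₀ K₀).trans_le h1) (M.area_pos i₁ K₀).le
  have hη1 : 1 ≤ η := by
    have h1 := area_le_of_eta_le hη hi hK₀ hK₀
    have h2 := area_le_of_eta_le hη hi.symm hK₀ hK₀
    have h3 : 1 * M.area i₀ K₀ ≤ η ^ 2 * M.area i₀ K₀ := by nlinarith
    have h4 := le_of_mul_le_mul_right h3 (M.area_pos i₀ K₀)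
    nlinarith
  -- the widths of one cell are within the factor `η` of each other
  have hcell : ∀ K ∈ M.cells, ∀ i j, M.width i (K i) ≤ η * M.width j (K j) := by
    intro K hK i j
    rcases eq_or_ne i j with rfl | hij
    · nlinarith [M.width_pos i (K i)]
    · have h1 := area_le_of_eta_le hη hij.symm hK hK
      have h2 := M.vol_eq i K
      rw [M.vol_eq j K] at h2
      have h3 : M.width i (K i) * M.area i K ≤ η * M.width j (K j) * M.area i K := by
        rw [← h2]
        nlinarith [M.width_pos j (K j)]
      exact le_of_mul_le_mul_right h3 (M.area_pos i K)
  have hcard : ∀ i : Fin d, (Finset.univ.erase i).card = d - 1 := fun i => by simp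
  have hall : ∀ K ∈ M.cells, ∀ L ∈ M.cells, ∀ i j,
      M.width i (K i) ≤ η ^ 3 * M.width j (L j) := by
    intro K hK L hL i j
    have hwK := M.width_pos i (K i)
    have hwL := M.width_pos j (L j)
    have h1 : (M.width i (K i) / η) ^ (d - 1) ≤ M.area i₀ K := by
      rw [← hcard i₀, ← Finset.prod_const]
      refine Finset.prod_le_prod (fun _ _ => by positivity) fun k _ => ?_
      rw [div_le_iff₀' hη0]
      exact hcell K hK i k
    have h2 : M.area i₁ L ≤ (η * M.width j (L j)) ^ (d - 1) := by
      rw [← hcard i₁, ← Finset.prod_const]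
      exact Finset.prod_le_prod (fun k _ => (M.width_pos k _).le) fun k _ => hcell L hL k j
    have h3 : η ≤ η ^ (d - 1) := le_self_pow₀ hη1 (by omega)
    have h4 : (M.width i (K i) / η) ^ (d - 1) ≤ (η ^ 2 * M.width j (L j)) ^ (d - 1) :=
      calc _ ≤ _ := h1
        _ ≤ η * M.area i₁ L := area_le_of_eta_le hη hi hK hL
        _ ≤ η ^ (d - 1) * (η * M.width j (L j)) ^ (d - 1) :=
          mul_le_mul h3 h2 (M.area_pos _ _).le (by positivity)
        _ = _ := by rw [← mul_pow]; ring
    have h5 := le_of_pow_le_pow_left₀ (by omega) (by positivity) h4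
    rw [div_le_iff₀ hη0] at h5
    linarith
  exact ⟨M.width i₀ (K₀ i₀), M.width_pos _ _, one_le_pow₀ hη1,
    fun K hK i => hall K₀ hK₀ K hK i₀ i, fun K hK i => hall K hK K₀ hK₀ i i₀⟩

namespace QuasiUniform

variable {h κ : ℝ}

theorem pow_le_vol (H : M.QuasiUniform h κ) {K : Fin d → ℤ} (hK : K ∈ M.cells) :
    h ^ d ≤ κ ^ d * M.vol K := by
  have h1 : ∏ _i : Fin d, h ≤ ∏ i, κ * M.width i (K i) :=
    Finset.prod_le_prod (fun _ _ => H.pos.le) fun i _ => H.le_width K hK i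
  simpa [Finset.prod_mul_distrib, vol] using h1

theorem pow_le_dualVol (H : M.QuasiUniform h κ) {i : Fin d} {K : Fin d → ℤ}
    (hK : K ∈ M.intFaces i) : h ^ d ≤ κ ^ d * M.dualVol i K := by
  have h1 := H.pow_le_vol (mem_intFaces.mp hK).1
  have h2 := H.pow_le_vol (mem_intFaces.mp hK).2
  unfold dualVol
  linarith

theorem area_le (H : M.QuasiUniform h κ) {i : Fin d} {K : Fin d → ℤ} (hK : K ∈ M.cells) :
    M.area i K ≤ (κ * h) ^ (d - 1) := by
  have h1 : M.area i K ≤ ∏ _j ∈ Finset.univ.erase i, κ * h :=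
    Finset.prod_le_prod (fun j _ => (M.width_pos j _).le) fun j _ => H.width_le K hK j
  simpa using h1

theorem pow_mul_tsum_sq_le (H : M.QuasiUniform h κ) {u : Fin d → (Fin d → ℤ) → ℝ}
    (hu : M.IsVelocity u) (i : Fin d) : h ^ d * ∑' K, u i K ^ 2 ≤ κ ^ d * M.inner u u := by
  have hnn : ∀ i, ∀ K ∈ M.intFaces i, 0 ≤ M.dualVol i K * u i K * u i K := fun i K _ => by
    rw [mul_assoc]
    exact mul_nonneg (M.dualVol_pos i K).le (mul_self_nonneg _)
  have h2 : ∑ K ∈ M.intFaces i, M.dualVol i K * u i K * u i K ≤ M.inner u u :=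
    Finset.single_le_sum (f := fun i => ∑ K ∈ M.intFaces i, M.dualVol i K * u i K * u i K)
      (fun i _ => Finset.sum_nonneg (hnn i)) (Finset.mem_univ i)
  have hκ : 0 ≤ κ := zero_le_one.trans H.one_le
  refine le_trans ?_ (mul_le_mul_of_nonneg_left h2 (pow_nonneg hκ d))
  rw [tsum_eq_sum (s := M.intFaces i) fun K hK => by simp [hu i K hK], Finset.mul_sum,
    Finset.mul_sum]
  refine Finset.sum_le_sum fun K hK => ?_
  nlinarith [H.pow_le_dualVol hK, sq_nonneg (u i K)]

/-- Every increment of a velocity, extended by zero, is seen by the discrete derivative on an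
orthant of one of the two cells involved. -/
theorem sq_incr_le (H : M.QuasiUniform h κ) {u : Fin d → (Fin d → ℤ) → ℝ}
    (hu : M.IsVelocity u) (i j : Fin d) (K : Fin d → ℤ) :
    (u i (K + unitIdx j) - u i K) ^ 2 ≤ (κ * h) ^ 2 *
      ((if K ∈ M.cells then ∑ q : Fin d → Bool, M.deriv u i j K q ^ 2 else 0) +
        if K + unitIdx j ∈ M.cells then
          ∑ q : Fin d → Bool, M.deriv u i j (K + unitIdx j) q ^ 2 else 0) := by
  classical
  have hκh : 0 < κ * h := mul_pos (zero_lt_one.trans_le H.one_le) H.pos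
  have hT : ∀ L, 0 ≤ (if L ∈ M.cells then ∑ q : Fin d → Bool, M.deriv u i j L q ^ 2 else 0) :=
    fun L => by
      split_ifs
      · exact Finset.sum_nonneg fun _ _ => sq_nonneg _
      · exact le_rfl
  have h0 := hT K
  have h1 := hT (K + unitIdx j)
  -- it is enough to write the increment as `l` times a derivative, with `0 ≤ l ≤ κ * h`
  have key : ∀ L ∈ M.cells, ∀ q l, 0 ≤ l → l ≤ κ * h →
      u i (K + unitIdx j) - u i K = l * M.deriv u i j L q →
      (u i (K + unitIdx j) - u i K) ^ 2 ≤ (κ * h) ^ 2 *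
        (if L ∈ M.cells then ∑ q : Fin d → Bool, M.deriv u i j L q ^ 2 else 0) := by
    intro L hL q l hl hl' he
    rw [he, mul_pow, if_pos hL]
    have := Finset.single_le_sum (f := fun q => M.deriv u i j L q ^ 2)
      (fun _ _ => sq_nonneg _) (Finset.mem_univ q)
    gcongr
  by_cases hK : K ∈ M.cells
  · refine le_trans ?_ (mul_le_mul_of_nonneg_left (le_add_of_nonneg_right h1) (sq_nonneg _))
    have hw := M.width_pos j (K j)
    have hwle := H.width_le K hK j
    rcases eq_or_ne i j with rfl | hij
    · refine key K hK (fun _ => true) _ hw.le hwle ?_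
      simp only [deriv, if_true]
      field_simp
    · by_cases hK' : K + unitIdx j ∈ M.cells
      · have hw' := M.width_pos j (K j + 1)
        have hwle' := H.width_le _ hK' j
        simp only [unitIdx, Pi.add_apply, Pi.single_eq_same] at hwle'
        refine key K hK (fun k => k = j) ((M.width j (K j) + M.width j (K j + 1)) / 2)
          (by positivity) (by linarith) ?_
        simp only [deriv, hij, sgn, off, decide_true, if_true, one_smul, hK', decide_false,
          Bool.false_eq_true, if_false, zero_smul, add_zero, Int.cast_one, one_mul]
        field_simp
      · refine key K hK (fun k => k = j) (M.width j (K j) / 2) (by positivity) (by linarith) ?_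
        simp only [deriv, hij, sgn, off, decide_true, if_true, one_smul, hK', decide_false,
          Bool.false_eq_true, if_false, zero_smul, add_zero, Int.cast_one, one_mul,
          hu.eq_zero_of_notMem hK']
        field_simp
  · by_cases hK' : K + unitIdx j ∈ M.cells
    · refine le_trans ?_ (mul_le_mul_of_nonneg_left (le_add_of_nonneg_left h0) (sq_nonneg _))
      have hz := hu.eq_zero_of_notMem (i := i) hK
      rcases eq_or_ne i j with rfl | hij
      · have : u i (K + unitIdx i) = 0 := hu.eq_zero_of_sub_notMem (by simpa using hK)
        rw [hz, this, sub_zero, zero_pow two_ne_zero]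
        positivity
      · have hw := M.width_pos j ((K + unitIdx j) j)
        have hwle := H.width_le _ hK' j
        refine key _ hK' (fun _ => false) (M.width j ((K + unitIdx j) j) / 2) (by positivity)
          (by linarith) ?_
        simp only [deriv, hij, sgn, off, Bool.false_eq_true, if_false, neg_smul, one_smul,
          add_neg_cancel_right, hK, zero_smul, add_zero, Int.cast_neg, Int.cast_one, hz]
        field_simp
        ring
    · rw [hu.eq_zero_of_notMem hK, hu.eq_zero_of_notMem hK', sub_zero, zero_pow two_ne_zero]
      positivity

theorem pow_mul_incrSq_le (H : M.QuasiUniform h κ) {u : Fin d → (Fin d → ℤ) → ℝ}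
    (hu : M.IsVelocity u) (i : Fin d) :
    h ^ d * ∑ j, incrSq (u i) j ≤ h ^ 2 * (2 * 2 ^ d * κ ^ (d + 2) * M.gradSq u) := by
  have hκ : 0 < κ := zero_lt_one.trans_le H.one_le
  have hh := H.pos
  set T : Fin d → (Fin d → ℤ) → ℝ := fun j K =>
    if K ∈ M.cells then ∑ q : Fin d → Bool, M.deriv u i j K q ^ 2 else 0 with hTdef
  have hTs : ∀ j, HasFiniteSupport (T j) := fun j =>
    hasFiniteSupport_of_finset M.cells fun K hK => by simp [T, hK]
  have hu' := hu.hasFiniteSupport i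
  have h1 : ∀ j, incrSq (u i) j ≤ 2 * (κ * h) ^ 2 * ∑' K, T j K := by
    intro j
    have h2 := tsum_le_tsum_of_hasFiniteSupport (H.sq_incr_le hu i j)
      (by fun_prop (disch := simp)) (by
        have := hTs j
        exact ((this.fun_add
          (this.fun_comp_of_injective (injective_add_const (unitIdx j)))).fun_mul_right _))
    refine h2.trans (le_of_eq ?_)
    have h3 := tsum_add_const (T j) (unitIdx j)
    have h4 : Summable fun K => T j (K + unitIdx j) :=
      ((hTs j).fun_comp_of_injective (injective_add_const (unitIdx j))).summable
    have h5 := (hTs j).summable.tsum_add h4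
    rw [h3] at h5
    rw [tsum_mul_left]
    simp only [T] at h5 ⊢
    rw [h5]
    ring
  have h6 : ∀ j, h ^ d * ∑' K, T j K ≤
      κ ^ d * ∑ K ∈ M.cells, ∑ q : Fin d → Bool, M.vol K * M.deriv u i j K q ^ 2 := by
    intro j
    rw [tsum_eq_sum (s := M.cells) fun K hK => by simp [T, hK], Finset.mul_sum, Finset.mul_sum]
    refine Finset.sum_le_sum fun K hK => ?_
    simp only [T, if_pos hK, ← Finset.mul_sum]
    rw [← mul_assoc]
    exact mul_le_mul_of_nonneg_right (H.pow_le_vol hK)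
      (Finset.sum_nonneg fun _ _ => sq_nonneg _)
  have h7 : ∑ j, ∑ K ∈ M.cells, ∑ q : Fin d → Bool, M.vol K * M.deriv u i j K q ^ 2 ≤
      2 ^ d * M.gradSq u := by
    rw [Finset.sum_comm, gradSq, Finset.mul_sum]
    refine Finset.sum_le_sum fun K hK => ?_
    rw [Finset.sum_comm, Finset.mul_sum]
    refine Finset.sum_le_sum fun q hq => ?_
    have h8 := Finset.single_le_sum (f := fun i => ∑ j, M.deriv u i j K q ^ 2)
      (fun i _ => Finset.sum_nonneg fun j _ => sq_nonneg _) (Finset.mem_univ i)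
    rw [← Finset.mul_sum]
    calc _ ≤ M.vol K * _ := mul_le_mul_of_nonneg_left h8 (M.vol_pos K).le
      _ = _ := by field_simp
  calc h ^ d * ∑ j, incrSq (u i) j ≤ h ^ d * ∑ j, 2 * (κ * h) ^ 2 * ∑' K, T j K := by
        gcongr with j
        exact h1 j
    _ = 2 * (κ * h) ^ 2 * ∑ j, h ^ d * ∑' K, T j K := by
        simp only [Finset.mul_sum]
        refine Finset.sum_congr rfl fun j _ => ?_
        ring
    _ ≤ 2 * (κ * h) ^ 2 * ∑ j, κ ^ d *
          ∑ K ∈ M.cells, ∑ q : Fin d → Bool, M.vol K * M.deriv u i j K q ^ 2 := by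
        exact mul_le_mul_of_nonneg_left (Finset.sum_le_sum fun j _ => h6 j) (by positivity)
    _ ≤ 2 * (κ * h) ^ 2 * (κ ^ d * (2 ^ d * M.gradSq u)) := by
        rw [← Finset.mul_sum]
        gcongr
    _ = _ := by ring

theorem pow_mul_tsum_pow_four_le (H : M.QuasiUniform h κ) (hd : d = 2 ∨ d = 3)
    {u : Fin d → (Fin d → ℤ) → ℝ} (hu : M.IsVelocity u) (i : Fin d) :
    h ^ d * ∑' K, u i K ^ 4 ≤ 4 * (2 * 2 ^ d * κ ^ (d + 2) * M.h1Sq u) ^ 2 := by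
  have hκ : 1 ≤ κ := H.one_le
  have hI := M.inner_self_nonneg u
  have hG := M.gradSq_nonneg u
  have hc : κ ^ d ≤ 2 * 2 ^ d * κ ^ (d + 2) := by
    have h1 : κ ^ d ≤ κ ^ (d + 2) := pow_le_pow_right₀ hκ (by omega)
    have h2 : (1 : ℝ) ≤ 2 ^ d := one_le_pow₀ (by norm_num)
    have h3 : 0 < κ ^ (d + 2) := by positivity
    nlinarith
  refine _root_.pow_mul_tsum_pow_four_le hd (hu.hasFiniteSupport i) H.pos ?_ ?_
  · refine (H.pow_mul_tsum_sq_le hu i).trans ?_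
    unfold h1Sq
    gcongr
    linarith
  · refine (H.pow_mul_incrSq_le hu i).trans ?_
    unfold h1Sq
    have := H.pos
    gcongr
    linarith

theorem pow_mul_incrSq_le_h1Sq (H : M.QuasiUniform h κ) {u : Fin d → (Fin d → ℤ) → ℝ}
    (hu : M.IsVelocity u) (i j : Fin d) :
    h ^ d * incrSq (u i) j ≤ h ^ 2 * (2 * 2 ^ d * κ ^ (d + 2) * M.h1Sq u) := by
  have hκ : 1 ≤ κ := H.one_le
  have hI := M.inner_self_nonneg u
  have hh := H.pos
  calc h ^ d * incrSq (u i) j ≤ h ^ d * ∑ j, incrSq (u i) j := by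
        gcongr
        exact Finset.single_le_sum (fun j _ => incrSq_nonneg _ j) (Finset.mem_univ j)
    _ ≤ _ := H.pow_mul_incrSq_le hu i
    _ ≤ _ := by
        unfold h1Sq
        gcongr
        linarith

end QuasiUniform

end MACGrid

/-! ### A discrete Korn inequality -/

/-- The sum over the three cells around a reentrant edge, with widths `a₀`, `a₁` in the direction `i`
and `b₀`, `b₁` in the direction `j`, and `A`, `B` the increments of `u_i` and `u_j` across the edge.
The cross terms exceed those of a full edge, because some of the difference quotients are taken over
the half widths `a₀ / 2` and `b₀ / 2`, and the squares compensate for the excess. -/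
theorem reentrant_edge_sum_ge {a₀ a₁ b₀ b₁ : ℝ} (ha₀ : 0 < a₀) (ha₁ : 0 < a₁) (hb₀ : 0 < b₀)
    (hb₁ : 0 < b₁) (A B : ℝ) :
    2 * (A * B) ≤
      a₀ * b₀ / 4 * (((A / ((b₀ + b₁) / 2)) ^ 2 + (B / ((a₀ + a₁) / 2)) ^ 2) / 4
          + 2 * (A / ((b₀ + b₁) / 2)) * (B / ((a₀ + a₁) / 2)))
        + a₁ * b₀ / 4 * (((A / (b₀ / 2)) ^ 2 + (B / ((a₀ + a₁) / 2)) ^ 2) / 4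
          + 2 * (A / (b₀ / 2)) * (B / ((a₀ + a₁) / 2)))
        + a₀ * b₁ / 4 * (((A / ((b₀ + b₁) / 2)) ^ 2 + (B / (a₀ / 2)) ^ 2) / 4
          + 2 * (A / ((b₀ + b₁) / 2)) * (B / (a₀ / 2))) := by
  -- in terms of the following `x` and `y`, the difference of the two sides is a sum of squares
  set x := A / (b₀ + b₁)
  set y := B / (a₀ + a₁)
  have hA : A = x * (b₀ + b₁) := by simp only [x]; field_simp
  have hB : B = y * (a₀ + a₁) := by simp only [y]; field_simp
  rw [hA, hB, ← sub_nonneg]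
  have key : 0 ≤ (x ^ 2 * (a₀ * (b₀ + b₁) + (a₁ * (b₁ - b₀) ^ 2 / b₀)) +
      y ^ 2 * (b₀ * (a₀ + a₁) + (b₁ * (a₁ - a₀) ^ 2 / a₀))) / 4 + a₁ * b₁ * (x + y) ^ 2 := by
    positivity
  refine key.trans (le_of_eq ?_)
  field_simp
  ring

/-- The sum over the cells around an edge; `c₀₀`, `c₁₀`, `c₀₁`, `c₁₁` say which of the four cells
belong to the mesh. The hypotheses say that a velocity vanishes on the faces that are not interior:
if `A` and `B` do not vanish, at least three of the cells belong to the mesh. -/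
theorem edge_sum_ge {a₀ a₁ b₀ b₁ : ℝ} (ha₀ : 0 < a₀) (ha₁ : 0 < a₁) (hb₀ : 0 < b₀)
    (hb₁ : 0 < b₁) (A B : ℝ) (c₀₀ c₁₀ c₀₁ c₁₁ : Prop) [Decidable c₀₀] [Decidable c₁₀]
    [Decidable c₀₁] [Decidable c₁₁]
    (hA : A ≠ 0 → c₀₁ ∧ c₁₁ ∨ c₀₀ ∧ c₁₀) (hB : B ≠ 0 → c₁₀ ∧ c₁₁ ∨ c₀₀ ∧ c₀₁)
    (Ψ : ℝ → ℝ → ℝ) (hΨ : ∀ x y, Ψ x y = (x ^ 2 + y ^ 2) / 4 + 2 * x * y) :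
    2 * (A * B) ≤
      (if c₀₀ then a₀ * b₀ / 4 * Ψ (A / if c₀₁ then (b₀ + b₁) / 2 else b₀ / 2)
        (B / if c₁₀ then (a₀ + a₁) / 2 else a₀ / 2) else 0)
      + (if c₁₀ then a₁ * b₀ / 4 * Ψ (A / if c₁₁ then (b₀ + b₁) / 2 else b₀ / 2)
        (B / if c₀₀ then (a₁ + a₀) / 2 else a₁ / 2) else 0)
      + (if c₀₁ then a₀ * b₁ / 4 * Ψ (A / if c₀₀ then (b₁ + b₀) / 2 else b₁ / 2)
        (B / if c₁₁ then (a₀ + a₁) / 2 else a₀ / 2) else 0)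
      + (if c₁₁ then a₁ * b₁ / 4 * Ψ (A / if c₁₀ then (b₁ + b₀) / 2 else b₁ / 2)
        (B / if c₀₁ then (a₁ + a₀) / 2 else a₁ / 2) else 0) := by
  by_cases hAB : A = 0 ∨ B = 0
  · have h0 : A * B = 0 := by rcases hAB with h | h <;> simp [h]
    have hpos : ∀ l l', 0 ≤ Ψ (A / l) (B / l') := fun l l' => by
      rw [hΨ, mul_assoc, div_mul_div_comm, h0, zero_div, mul_zero, add_zero]
      positivity
    rw [h0, mul_zero]
    have hite : ∀ (c : Prop) [Decidable c] (w z : ℝ), 0 ≤ w → 0 ≤ z →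
        0 ≤ if c then w * z else 0 := fun c _ w z hw hz => by
      split_ifs
      · exact mul_nonneg hw hz
      · exact le_rfl
    exact add_nonneg (add_nonneg (add_nonneg (hite _ _ _ (by positivity) (hpos _ _))
      (hite _ _ _ (by positivity) (hpos _ _))) (hite _ _ _ (by positivity) (hpos _ _)))
      (hite _ _ _ (by positivity) (hpos _ _))
  · rw [not_or] at hAB
    have h1 := hA hAB.1
    have h2 := hB hAB.2
    by_cases h00 : c₀₀ <;> by_cases h10 : c₁₀ <;> by_cases h01 : c₀₁ <;> by_cases h11 : c₁₁ <;>
      simp only [h00, h10, h01, h11, and_true, and_false, or_false, or_true, and_self, if_true,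
        if_false, add_zero, zero_add, hΨ] at h1 h2 ⊢
    · rw [add_comm a₁ a₀, add_comm b₁ b₀, ← sub_nonneg]
      have key : 0 ≤ (a₀ + a₁) * (b₀ + b₁) / 4 *
          (((A / ((b₀ + b₁) / 2)) ^ 2 + (B / ((a₀ + a₁) / 2)) ^ 2) / 4) := by positivity
      refine key.trans (le_of_eq ?_)
      field_simp
      ring
    · have := reentrant_edge_sum_ge ha₀ ha₁ hb₀ hb₁ A B
      rw [add_comm a₁ a₀, add_comm b₁ b₀]
      linarith
    · have := reentrant_edge_sum_ge ha₁ ha₀ hb₀ hb₁ A B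
      rw [add_comm a₁ a₀, add_comm b₁ b₀] at *
      linarith
    · have := reentrant_edge_sum_ge ha₀ ha₁ hb₁ hb₀ A B
      rw [add_comm a₁ a₀, add_comm b₁ b₀] at *
      linarith
    · have := reentrant_edge_sum_ge ha₁ ha₀ hb₁ hb₀ A B
      rw [add_comm a₁ a₀, add_comm b₁ b₀] at *
      linarith

/-- A sum over the orthants of a function of two of the half-spaces. -/
theorem sum_orthants {d : ℕ} (hd : d = 2 ∨ d = 3) {i j : Fin d} (hij : i ≠ j)
    (g : Bool → Bool → ℝ) :
    ∑ q : Fin d → Bool, g (q i) (q j) = 2 ^ d / 4 * ∑ a, ∑ b, g a b := by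
  have h1 : ∀ a b, (Finset.univ.filter fun q : Fin d → Bool => (q i, q j) = (a, b)).card =
      2 ^ (d - 2) := by
    obtain rfl | rfl := hd <;> revert i j <;> decide
  rw [← Finset.sum_fiberwise_of_maps_to (s := Finset.univ) (t := Finset.univ)
    (g := fun q : Fin d → Bool => (q i, q j)) (fun _ _ => Finset.mem_univ _),
    Fintype.sum_prod_type, Finset.mul_sum]
  refine Finset.sum_congr rfl fun a _ => ?_
  rw [Finset.mul_sum]
  refine Finset.sum_congr rfl fun b _ => ?_
  rw [Finset.sum_congr rfl (g := fun _ => g a b), Finset.sum_const, h1, nsmul_eq_mul]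
  · obtain rfl | rfl := hd <;> norm_num
  · intro q hq
    have := (Finset.mem_filter.mp hq).2
    rw [Prod.mk.injEq] at this
    rw [this.1, this.2]

namespace MACGrid

open Function

variable {d : ℕ} {M : MACGrid d}

/-- The derivative `∂_j u_i`, `i ≠ j`, on an orthant of `L`, in terms of the increment of `u i`
across the edge that touches the orthant. -/
theorem deriv_eq_div {u : Fin d → (Fin d → ℤ) → ℝ} (hu : M.IsVelocity u) {i j : Fin d}
    (hij : i ≠ j) {L : Fin d → ℤ} (q : Fin d → Bool) {P : Fin d → ℤ}
    (hP : P = L + off (q i) • unitIdx i + off (q j) • unitIdx j) :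
    M.deriv u i j L q = (u i P - u i (P - unitIdx j)) /
      if L + sgn (q j) • unitIdx j ∈ M.cells then
        (M.width j (L j) + M.width j (L j + sgn (q j))) / 2 else M.width j (L j) / 2 := by
  subst hP
  rw [deriv, if_neg hij]
  cases hj : q j
  · simp only [sgn, off, Bool.false_eq_true, if_false, neg_smul, one_smul, zero_smul, add_zero,
      ← sub_eq_add_neg]
    by_cases h : L - unitIdx j ∈ M.cells
    · simp only [h, if_true]
      push_cast
      ring_nf
    · have hz : u i (L + (if q i = true then 1 else 0 : ℤ) • unitIdx i - unitIdx j) = 0 := by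
        cases hi : q i
        · simpa using hu.eq_zero_of_notMem h
        · refine hu.eq_zero_of_sub_notMem ?_
          simpa [add_sub_right_comm] using h
      simp only [h, if_false, hz]
      push_cast
      ring_nf
  · simp only [sgn, off, if_true, one_smul, add_sub_cancel_right]
    by_cases h : L + unitIdx j ∈ M.cells
    · simp only [h, if_true]
      push_cast
      ring_nf
    · have hz : u i (L + (if q i = true then 1 else 0 : ℤ) • unitIdx i + unitIdx j) = 0 := by
        cases hi : q i
        · simpa using hu.eq_zero_of_notMem h
        · refine hu.eq_zero_of_sub_notMem ?_
          simpa [add_sub_right_comm] using h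
      simp only [h, if_false, hz]
      push_cast
      ring_nf

/-- The product of the widths of `K` in the directions other than `i` and `j`. -/
noncomputable def edgeLength (M : MACGrid d) (i j : Fin d) (K : Fin d → ℤ) : ℝ :=
  ∏ k ∈ (Finset.univ.erase i).erase j, M.width k (K k)

theorem edgeLength_pos (M : MACGrid d) (i j : Fin d) (K : Fin d → ℤ) : 0 < M.edgeLength i j K :=
  Finset.prod_pos fun k _ => M.width_pos k _

theorem edgeLength_sub_left (M : MACGrid d) (i j : Fin d) (K : Fin d → ℤ) :
    M.edgeLength i j (K - unitIdx i) = M.edgeLength i j K := by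
  refine Finset.prod_congr rfl fun k hk => ?_
  simp [unitIdx, Finset.ne_of_mem_erase (Finset.mem_of_mem_erase hk)]

theorem edgeLength_sub_right (M : MACGrid d) (i j : Fin d) (K : Fin d → ℤ) :
    M.edgeLength i j (K - unitIdx j) = M.edgeLength i j K := by
  refine Finset.prod_congr rfl fun k hk => ?_
  simp [unitIdx, Finset.ne_of_mem_erase hk]

theorem vol_eq_mul_edgeLength (M : MACGrid d) {i j : Fin d} (hij : i ≠ j) (K : Fin d → ℤ) :
    M.vol K = M.width i (K i) * M.width j (K j) * M.edgeLength i j K := by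
  rw [vol_eq M i, area, ← Finset.mul_prod_erase _ _
    (Finset.mem_erase.mpr ⟨hij.symm, Finset.mem_univ j⟩), edgeLength]
  ring

/-- A discrete form of the identity `∫ ∂_j u_i ∂_i u_j = ∫ ∂_i u_i ∂_j u_j`. -/
theorem tsum_cross_eq {u : Fin d → (Fin d → ℤ) → ℝ} (hu : M.IsVelocity u) {i j : Fin d}
    (hij : i ≠ j) :
    ∑' P, M.edgeLength i j P * ((u i P - u i (P - unitIdx j)) * (u j P - u j (P - unitIdx i))) =
      ∑ K ∈ M.cells, M.vol K * ((u i (K + unitIdx i) - u i K) / M.width i (K i) *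
        ((u j (K + unitIdx j) - u j K) / M.width j (K j))) := by
  set γ := M.edgeLength i j
  have hi := hu.hasFiniteSupport i
  have hj := hu.hasFiniteSupport j
  have g1 : ∀ P, γ (P + unitIdx i) = γ P := fun P => by
    simpa using (M.edgeLength_sub_left i j (P + unitIdx i)).symm
  have g2 : ∀ P, γ (P + unitIdx j) = γ P := fun P => by
    simpa using (M.edgeLength_sub_right i j (P + unitIdx j)).symm
  have t1 := tsum_add_const (fun P => γ P * (u i P * u j (P - unitIdx i))) (unitIdx i)
  have t2 := tsum_add_const (fun P => γ P * (u i (P - unitIdx j) * u j P)) (unitIdx j)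
  have t3 := tsum_add_const (fun P => γ P * (u i (P - unitIdx j) * u j (P - unitIdx i)))
    (unitIdx i + unitIdx j)
  have e1 : ∀ P : Fin d → ℤ, P + (unitIdx i + unitIdx j) - unitIdx i = P + unitIdx j :=
    fun P => by abel
  have e2 : ∀ P : Fin d → ℤ, P + (unitIdx i + unitIdx j) - unitIdx j = P + unitIdx i :=
    fun P => by abel
  simp only [add_sub_cancel_right, g1, g2, e1, e2] at t1 t2 t3
  simp only [← add_assoc, g1, g2] at t3
  have s0 : Summable fun P => γ P * (u i P * u j P) :=
    HasFiniteSupport.summable (by fun_prop (disch := simp))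
  have s1 : Summable fun P => γ P * (u i P * u j (P - unitIdx i)) :=
    HasFiniteSupport.summable (by fun_prop (disch := simp))
  have s2 : Summable fun P => γ P * (u i (P - unitIdx j) * u j P) :=
    HasFiniteSupport.summable (by fun_prop (disch := simp))
  have s3 : Summable fun P => γ P * (u i (P - unitIdx j) * u j (P - unitIdx i)) :=
    HasFiniteSupport.summable (by fun_prop (disch := simp))
  have s1' : Summable fun P => γ P * (u i (P + unitIdx i) * u j P) :=
    HasFiniteSupport.summable (by fun_prop (disch := simp))
  have s2' : Summable fun P => γ P * (u i P * u j (P + unitIdx j)) :=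
    HasFiniteSupport.summable (by fun_prop (disch := simp))
  have s3' : Summable fun P => γ P * (u i (P + unitIdx i) * u j (P + unitIdx j)) :=
    HasFiniteSupport.summable (by fun_prop (disch := simp))
  have hL : ∑' P, γ P * ((u i P - u i (P - unitIdx j)) * (u j P - u j (P - unitIdx i))) =
      ∑' P, γ P * ((u i (P + unitIdx i) - u i P) * (u j (P + unitIdx j) - u j P)) := by
    have l1 := ((s0.sub s1).sub s2).tsum_add s3
    rw [(s0.sub s1).tsum_sub s2, s0.tsum_sub s1] at l1
    have l2 := ((s0.sub s1').sub s2').tsum_add s3'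
    rw [(s0.sub s1').tsum_sub s2', s0.tsum_sub s1'] at l2
    calc _ = ∑' P, (γ P * (u i P * u j P) - γ P * (u i P * u j (P - unitIdx i))
          - γ P * (u i (P - unitIdx j) * u j P)
          + γ P * (u i (P - unitIdx j) * u j (P - unitIdx i))) := by
          congr 1; ext P; ring
      _ = ∑' P, (γ P * (u i P * u j P) - γ P * (u i (P + unitIdx i) * u j P)
          - γ P * (u i P * u j (P + unitIdx j))
          + γ P * (u i (P + unitIdx i) * u j (P + unitIdx j))) := by
          rw [l1, l2, t1, t2, t3]
      _ = _ := by
          congr 1; ext P; ring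
  rw [hL, tsum_eq_sum (s := M.cells)]
  · refine Finset.sum_congr rfl fun K _ => ?_
    have h1 := (M.width_pos i (K i)).ne'
    have h2 := (M.width_pos j (K j)).ne'
    rw [M.vol_eq_mul_edgeLength hij]
    simp only [γ]
    field_simp
  · intro K hK
    have h1 : u i (K + unitIdx i) = 0 := hu.eq_zero_of_sub_notMem (by simpa using hK)
    rw [h1, hu.eq_zero_of_notMem hK]
    simp

theorem sub_unitIdx_apply_of_ne {i j : Fin d} (hij : j ≠ i) (K : Fin d → ℤ) :
    (K - unitIdx i) j = K j := by
  simp [unitIdx, hij]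

/-- The mixed terms of the strain rate, for one pair of directions: the orthants are collected
around the edges orthogonal to `e_i` and `e_j`, where `edge_sum_ge` applies. -/
theorem sum_mixed_ge (hd : d = 2 ∨ d = 3) {u : Fin d → (Fin d → ℤ) → ℝ} (hu : M.IsVelocity u)
    {i j : Fin d} (hij : i ≠ j) :
    2 * ∑ K ∈ M.cells, M.vol K * ((u i (K + unitIdx i) - u i K) / M.width i (K i) *
        ((u j (K + unitIdx j) - u j K) / M.width j (K j))) ≤
      ∑ K ∈ M.cells, ∑ q : Fin d → Bool, M.vol K / 2 ^ d *
        ((M.deriv u i j K q ^ 2 + M.deriv u j i K q ^ 2) / 4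
          + 2 * M.deriv u i j K q * M.deriv u j i K q) := by
  classical
  set Ψ : ℝ → ℝ → ℝ := fun x y => (x ^ 2 + y ^ 2) / 4 + 2 * x * y with hΨ
  -- the orthant of `K` that lies on the sides `a` and `b` in the directions `i` and `j`
  set o : Bool → Bool → Fin d → Bool := fun a b k => if k = i then a else b with ho
  have oi : ∀ a b, o a b i = a := fun a b => by simp [o]
  have oj : ∀ a b, o a b j = b := fun a b => by simp [o, hij.symm]
  set T : Bool → Bool → (Fin d → ℤ) → ℝ := fun a b K => if K ∈ M.cells then
    M.vol K / 4 * Ψ (M.deriv u i j K (o a b)) (M.deriv u j i K (o a b)) else 0 with hT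
  have hTs : ∀ a b, HasFiniteSupport (T a b) := fun a b =>
    hasFiniteSupport_of_finset M.cells fun K hK => by simp [T, hK]
  have hder : ∀ K q, M.deriv u i j K q = M.deriv u i j K (o (q i) (q j)) ∧
      M.deriv u j i K q = M.deriv u j i K (o (q i) (q j)) := fun K q => by
    simp only [deriv, oi, oj, hij, hij.symm, if_false, and_self]
  have h1 : ∑ K ∈ M.cells, ∑ q : Fin d → Bool, M.vol K / 2 ^ d *
      Ψ (M.deriv u i j K q) (M.deriv u j i K q) = ∑ a, ∑ b, ∑' K, T a b K := by
    have h2 : ∀ a b, ∑' K, T a b K = ∑ K ∈ M.cells, T a b K := fun a b =>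
      tsum_eq_sum fun K hK => by simp [T, hK]
    simp only [h2]
    trans ∑ K ∈ M.cells, ∑ a, ∑ b, T a b K
    swap
    · rw [Finset.sum_comm]
      exact Finset.sum_congr rfl fun a _ => Finset.sum_comm
    refine Finset.sum_congr rfl fun K hK => ?_
    have h3 := sum_orthants hd hij fun a b => M.vol K / 2 ^ d *
      Ψ (M.deriv u i j K (o a b)) (M.deriv u j i K (o a b))
    rw [Finset.sum_congr rfl fun q _ => by rw [(hder K q).1, (hder K q).2], h3, Finset.mul_sum]
    refine Finset.sum_congr rfl fun a _ => ?_
    rw [Finset.mul_sum]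
    refine Finset.sum_congr rfl fun b _ => ?_
    simp only [T, if_pos hK]
    field_simp
  change _ ≤ ∑ K ∈ M.cells, ∑ q : Fin d → Bool, M.vol K / 2 ^ d *
      Ψ (M.deriv u i j K q) (M.deriv u j i K q)
  rw [h1, ← tsum_cross_eq hu hij, ← tsum_mul_left]
  simp only [Fintype.sum_bool]
  -- collect the four orthants around the edge with index `P`
  have s1 := (hTs true true).fun_comp_of_injective (injective_sub_const (unitIdx i + unitIdx j))
  have s2 := (hTs true false).fun_comp_of_injective (injective_sub_const (unitIdx i))
  have s3 := (hTs false true).fun_comp_of_injective (injective_sub_const (unitIdx j))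
  have s4 := hTs false false
  rw [← tsum_sub_const (T true true) (unitIdx i + unitIdx j),
    ← tsum_sub_const (T true false) (unitIdx i), ← tsum_sub_const (T false true) (unitIdx j),
    ← s1.summable.tsum_add s2.summable, ← s3.summable.tsum_add s4.summable,
    ← (s1.fun_add s2).summable.tsum_add (s3.fun_add s4).summable]
  have hui := hu.hasFiniteSupport i
  have huj := hu.hasFiniteSupport j
  refine tsum_le_tsum_of_hasFiniteSupport (fun P => ?_) (by fun_prop (disch := simp))
    ((s1.fun_add s2).fun_add (s3.fun_add s4))
  set A := u i P - u i (P - unitIdx j) with hA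
  set B := u j P - u j (P - unitIdx i) with hB
  have key := edge_sum_ge (M.width_pos i (P i - 1)) (M.width_pos i (P i))
    (M.width_pos j (P j - 1)) (M.width_pos j (P j)) A B
    (P - (unitIdx i + unitIdx j) ∈ M.cells) (P - unitIdx j ∈ M.cells) (P - unitIdx i ∈ M.cells)
    (P ∈ M.cells) ?_ ?_ Ψ fun _ _ => rfl
  · have hγ := M.edgeLength_pos i j P
    have key' := mul_le_mul_of_nonneg_left key hγ.le
    have q00 : P - (unitIdx i + unitIdx j) = P - unitIdx i - unitIdx j := by abel
    have q00' : P - (unitIdx i + unitIdx j) = P - unitIdx j - unitIdx i := by abel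
    have w1 := sub_unitIdx_apply_of_ne (K := P) hij
    have w2 := sub_unitIdx_apply_of_ne (K := P) hij.symm
    have hii : (P - unitIdx i) i = P i - 1 := by simp [unitIdx]
    have hjj : (P - unitIdx j) j = P j - 1 := by simp [unitIdx]
    have hii' : (P - (unitIdx i + unitIdx j)) i = P i - 1 := by simp [unitIdx, hij]
    have hjj' : (P - (unitIdx i + unitIdx j)) j = P j - 1 := by simp [unitIdx, hij.symm]
    have T4 : T false false P = M.edgeLength i j P *
        (if P ∈ M.cells then M.width i (P i) * M.width j (P j) / 4 *
          Ψ (A / if P - unitIdx j ∈ M.cells then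
              (M.width j (P j) + M.width j (P j - 1)) / 2 else M.width j (P j) / 2)
            (B / if P - unitIdx i ∈ M.cells then
              (M.width i (P i) + M.width i (P i - 1)) / 2 else M.width i (P i) / 2) else 0) := by
      by_cases hc : P ∈ M.cells
      · simp only [T, if_pos hc]
        rw [deriv_eq_div hu hij (P := P) _ (by simp [oi, oj, off]),
          deriv_eq_div hu hij.symm (P := P) _ (by simp [oi, oj, off]),
          M.vol_eq_mul_edgeLength hij]
        simp only [oi, oj, sgn, Bool.false_eq_true, if_false, neg_smul, one_smul,
          ← sub_eq_add_neg]
        ring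
      · simp [T, hc]
    have T2 : T true false (P - unitIdx i) = M.edgeLength i j P *
        (if P - unitIdx i ∈ M.cells then M.width i (P i - 1) * M.width j (P j) / 4 *
          Ψ (A / if P - (unitIdx i + unitIdx j) ∈ M.cells then
              (M.width j (P j) + M.width j (P j - 1)) / 2 else M.width j (P j) / 2)
            (B / if P ∈ M.cells then
              (M.width i (P i - 1) + M.width i (P i)) / 2 else M.width i (P i - 1) / 2)
          else 0) := by
      by_cases hc : P - unitIdx i ∈ M.cells
      · simp only [T, if_pos hc]
        rw [deriv_eq_div hu hij (P := P) _ (by simp [oi, oj, off]),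
          deriv_eq_div hu hij.symm (P := P) _ (by simp [oi, oj, off]),
          M.vol_eq_mul_edgeLength hij, edgeLength_sub_left, q00]
        simp only [oi, oj, sgn, Bool.false_eq_true, if_false, neg_smul, one_smul,
          ← sub_eq_add_neg, if_true, sub_add_cancel, w2, hii]
        ring
      · simp [T, hc]
    have T3 : T false true (P - unitIdx j) = M.edgeLength i j P *
        (if P - unitIdx j ∈ M.cells then M.width i (P i) * M.width j (P j - 1) / 4 *
          Ψ (A / if P ∈ M.cells then
              (M.width j (P j - 1) + M.width j (P j)) / 2 else M.width j (P j - 1) / 2)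
            (B / if P - (unitIdx i + unitIdx j) ∈ M.cells then
              (M.width i (P i) + M.width i (P i - 1)) / 2 else M.width i (P i) / 2)
          else 0) := by
      by_cases hc : P - unitIdx j ∈ M.cells
      · simp only [T, if_pos hc]
        rw [deriv_eq_div hu hij (P := P) _ (by simp [oi, oj, off]),
          deriv_eq_div hu hij.symm (P := P) _ (by simp [oi, oj, off]),
          M.vol_eq_mul_edgeLength hij, edgeLength_sub_right, q00']
        simp only [oi, oj, sgn, Bool.false_eq_true, if_false, neg_smul, one_smul,
          ← sub_eq_add_neg, if_true, sub_add_cancel, w1, hjj]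
        ring
      · simp [T, hc]
    have T1 : T true true (P - (unitIdx i + unitIdx j)) = M.edgeLength i j P *
        (if P - (unitIdx i + unitIdx j) ∈ M.cells then
          M.width i (P i - 1) * M.width j (P j - 1) / 4 *
          Ψ (A / if P - unitIdx i ∈ M.cells then
              (M.width j (P j - 1) + M.width j (P j)) / 2 else M.width j (P j - 1) / 2)
            (B / if P - unitIdx j ∈ M.cells then
              (M.width i (P i - 1) + M.width i (P i)) / 2 else M.width i (P i - 1) / 2)
          else 0) := by
      by_cases hc : P - (unitIdx i + unitIdx j) ∈ M.cells
      · simp only [T, if_pos hc]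
        have x1 : P - (unitIdx i + unitIdx j) + unitIdx j = P - unitIdx i := by abel
        have x2 : P - (unitIdx i + unitIdx j) + unitIdx i = P - unitIdx j := by abel
        have x3 : M.edgeLength i j (P - (unitIdx i + unitIdx j)) = M.edgeLength i j P := by
          rw [q00, edgeLength_sub_right, edgeLength_sub_left]
        rw [deriv_eq_div hu hij (P := P) _
            (by simp only [oi, oj, off, if_true, one_smul, x2, sub_add_cancel]),
          deriv_eq_div hu hij.symm (P := P) _
            (by simp only [oi, oj, off, if_true, one_smul, x1, sub_add_cancel]),
          M.vol_eq_mul_edgeLength hij, x3]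
        simp only [oi, oj, sgn, one_smul, if_true, x1, x2, hii', hjj', sub_add_cancel]
        ring
      · simp [T, hc]
    rw [T1, T2, T3, T4]
    calc _ = M.edgeLength i j P * (2 * (A * B)) := by ring
      _ ≤ _ := key'
      _ = _ := by ring
  · intro h
    by_cases h1 : u i P = 0
    · have h2 : u i (P - unitIdx j) ≠ 0 := fun h2 => h (by rw [hA, h1, h2, sub_zero])
      have h3 := mem_intFaces.mp (not_imp_comm.mp (hu i (P - unitIdx j)) h2)
      refine Or.inr ⟨?_, h3.1⟩
      have : P - (unitIdx i + unitIdx j) = P - unitIdx j - unitIdx i := by abel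
      rw [this]
      exact h3.2
    · have h3 := mem_intFaces.mp (not_imp_comm.mp (hu i P) h1)
      exact Or.inl ⟨h3.2, h3.1⟩
  · intro h
    by_cases h1 : u j P = 0
    · have h2 : u j (P - unitIdx i) ≠ 0 := fun h2 => h (by rw [hB, h1, h2, sub_zero])
      have h3 := mem_intFaces.mp (not_imp_comm.mp (hu j (P - unitIdx i)) h2)
      refine Or.inr ⟨?_, h3.1⟩
      have : P - (unitIdx i + unitIdx j) = P - unitIdx i - unitIdx j := by abel
      rw [this]
      exact h3.2
    · have h3 := mem_intFaces.mp (not_imp_comm.mp (hu j P) h1)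
      exact Or.inl ⟨h3.2, h3.1⟩

theorem strain_sq_sum_le (M : MACGrid d) (u : Fin d → (Fin d → ℤ) → ℝ) (K : Fin d → ℤ)
    (q : Fin d → Bool) :
    ∑ i, ∑ j, M.strain u i j K q ^ 2 ≤ ∑ i, ∑ j, M.deriv u i j K q ^ 2 := by
  have h1 : ∑ i, ∑ j, M.deriv u j i K q ^ 2 = ∑ i, ∑ j, M.deriv u i j K q ^ 2 :=
    Finset.sum_comm
  calc ∑ i, ∑ j, M.strain u i j K q ^ 2
      ≤ ∑ i, ∑ j, (M.deriv u i j K q ^ 2 / 2 + M.deriv u j i K q ^ 2 / 2) := by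
        refine Finset.sum_le_sum fun i _ => Finset.sum_le_sum fun j _ => ?_
        unfold strain
        nlinarith [sq_nonneg (M.deriv u i j K q - M.deriv u j i K q)]
    _ = _ := by
        simp only [Finset.sum_add_distrib, ← Finset.sum_div]
        rw [h1]
        ring

/-- The **discrete Korn inequality**. For `i ≠ j`, the square of the strain rate is a quarter of the
form bounded in `sum_mixed_ge` plus `3 / 16` of the squares of the derivatives; the lower bounds of
`sum_mixed_ge` add up, with the diagonal terms, to half the integral of the square of the
divergence. -/
theorem gradSq_le_strain (hd : d = 2 ∨ d = 3) {u : Fin d → (Fin d → ℤ) → ℝ}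
    (hu : M.IsVelocity u) :
    3 / 8 * M.gradSq u ≤ ∑ K ∈ M.cells, ∑ q : Fin d → Bool, M.vol K / 2 ^ d *
      ∑ i, ∑ j, M.strain u i j K q ^ 2 := by
  set S : ((Fin d → ℤ) → (Fin d → Bool) → ℝ) → ℝ := fun g =>
    ∑ K ∈ M.cells, ∑ q : Fin d → Bool, M.vol K / 2 ^ d * g K q with hS
  have hSadd : ∀ g g', S (fun K q => g K q + g' K q) = S g + S g' := fun g g' => by
    simp only [S, mul_add, Finset.sum_add_distrib]
  have hSmul : ∀ (c : ℝ) g, S (fun K q => c * g K q) = c * S g := fun c g => by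
    simp only [S, Finset.mul_sum]
    refine Finset.sum_congr rfl fun K _ => Finset.sum_congr rfl fun q _ => ?_
    ring
  have hSsum : ∀ g : Fin d → Fin d → (Fin d → ℤ) → (Fin d → Bool) → ℝ,
      S (fun K q => ∑ i, ∑ j, g i j K q) = ∑ i, ∑ j, S (g i j) := fun g => by
    simp only [S, Finset.mul_sum]
    calc _ = ∑ K ∈ M.cells, ∑ i, ∑ j, ∑ q : Fin d → Bool, M.vol K / 2 ^ d * g i j K q := by
          refine Finset.sum_congr rfl fun K _ => ?_
          rw [Finset.sum_comm]
          exact Finset.sum_congr rfl fun i _ => Finset.sum_comm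
      _ = _ := by
          rw [Finset.sum_comm]
          exact Finset.sum_congr rfl fun i _ => Finset.sum_comm
  set δ : Fin d → (Fin d → ℤ) → ℝ := fun i K => (u i (K + unitIdx i) - u i K) / M.width i (K i)
  have hSK : ∀ g : (Fin d → ℤ) → ℝ, S (fun K _ => g K) = ∑ K ∈ M.cells, M.vol K * g K :=
    fun g => by
      refine Finset.sum_congr rfl fun K _ => ?_
      rw [Finset.sum_const, Finset.card_univ, Fintype.card_fun, Fintype.card_bool,
        Fintype.card_fin, nsmul_eq_mul]
      push_cast
      field_simp
  have hij : ∀ i j, 1 / 2 * S (fun K _ => δ i K * δ j K) +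
      3 / 16 * (S (fun K q => M.deriv u i j K q ^ 2) + S (fun K q => M.deriv u j i K q ^ 2)) ≤
      S (fun K q => M.strain u i j K q ^ 2) := by
    intro i j
    rcases eq_or_ne i j with rfl | hij
    · have h1 : (fun K q => M.strain u i i K q ^ 2) = fun K (_ : Fin d → Bool) => δ i K * δ i K := by
        ext K q
        simp only [strain, deriv, if_true, δ]
        ring
      have h2 : (fun K q => M.deriv u i i K q ^ 2) = fun K (_ : Fin d → Bool) => δ i K * δ i K := by
        ext K q
        simp only [deriv, if_true, δ]
        ring
      rw [h1, h2]
      have h3 : 0 ≤ S fun K _ => δ i K * δ i K := by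
        rw [hSK]
        exact Finset.sum_nonneg fun K _ => mul_nonneg (M.vol_pos K).le (mul_self_nonneg _)
      linarith
    · have h1 := sum_mixed_ge hd hu hij
      rw [← hSK fun K => δ i K * δ j K] at h1
      set Y : (Fin d → ℤ) → (Fin d → Bool) → ℝ := fun K q =>
        (M.deriv u i j K q ^ 2 + M.deriv u j i K q ^ 2) / 4
          + 2 * M.deriv u i j K q * M.deriv u j i K q with hY
      change 2 * _ ≤ S Y at h1
      have h2 : (fun K q => M.strain u i j K q ^ 2) = fun K q => 1 / 4 * Y K q +
          3 / 16 * (M.deriv u i j K q ^ 2 + M.deriv u j i K q ^ 2) := by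
        ext K q
        simp only [strain, Y]
        ring
      rw [h2, hSadd (fun K q => 1 / 4 * Y K q), hSmul (1 / 4) Y, hSmul,
        hSadd fun K q => M.deriv u i j K q ^ 2]
      linarith
  have h1 := Finset.sum_le_sum fun i (_ : i ∈ Finset.univ) =>
    Finset.sum_le_sum fun j (_ : j ∈ Finset.univ) => hij i j
  simp only [Finset.sum_add_distrib, ← Finset.mul_sum] at h1
  have h2 : ∑ i, ∑ j, S (fun K q => M.deriv u j i K q ^ 2) =
      ∑ i, ∑ j, S (fun K q => M.deriv u i j K q ^ 2) := Finset.sum_comm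
  have h3 : 0 ≤ ∑ i, ∑ j, S (fun K _ => δ i K * δ j K) := by
    rw [← hSsum fun i j K _ => δ i K * δ j K]
    simp only [← Finset.sum_mul_sum]
    rw [hSK fun K => (∑ i, δ i K) * ∑ j, δ j K]
    exact Finset.sum_nonneg fun K _ => mul_nonneg (M.vol_pos K).le (mul_self_nonneg _)
  have h4 : M.gradSq u = ∑ i, ∑ j, S (fun K q => M.deriv u i j K q ^ 2) :=
    hSsum fun i j K q => M.deriv u i j K q ^ 2
  change _ ≤ S fun K q => ∑ i, ∑ j, M.strain u i j K q ^ 2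
  rw [hSsum fun i j K q => M.strain u i j K q ^ 2, h4]
  rw [h2] at h1
  linarith

/-! ### Bounds for the diffusion term -/

theorem visc_mem_Icc {μ : ℝ → ℝ} {ρ : (Fin d → ℤ) → ℝ} {a b : ℝ}
    (h : ∀ K ∈ M.cells, a ≤ μ (ρ K) ∧ μ (ρ K) ≤ b) (i j : Fin d) {K : Fin d → ℤ}
    (hK : K ∈ M.cells) (q : Fin d → Bool) :
    a ≤ M.visc μ ρ i j K q ∧ M.visc μ ρ i j K q ≤ b := by
  unfold visc
  split_ifs
  · exact h K hK
  · have hcell : ∀ L ∈ M.edgeCells i j K q, L ∈ M.cells := fun L hL =>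
      (Finset.mem_filter.mp hL).1
    have hpos : 0 < ∑ L ∈ M.edgeCells i j K q, M.vol L :=
      Finset.sum_pos (fun L _ => M.vol_pos L)
        ⟨K, Finset.mem_filter.mpr ⟨hK, Or.inl rfl⟩⟩
    rw [le_div_iff₀ hpos, div_le_iff₀ hpos, Finset.mul_sum, Finset.mul_sum]
    constructor <;> refine Finset.sum_le_sum fun L hL => ?_
    · nlinarith [M.vol_pos L, (h L (hcell L hL)).1]
    · nlinarith [M.vol_pos L, (h L (hcell L hL)).2]

theorem diffusion_self_ge (hd : d = 2 ∨ d = 3) {u : Fin d → (Fin d → ℤ) → ℝ}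
    (hu : M.IsVelocity u) {μ : ℝ → ℝ} {ρ : (Fin d → ℤ) → ℝ} {a b : ℝ} (ha : 0 ≤ a)
    (h : ∀ K ∈ M.cells, a ≤ μ (ρ K) ∧ μ (ρ K) ≤ b) :
    3 / 8 * a * M.gradSq u ≤ M.diffusion μ ρ u u := by
  have h1 := mul_le_mul_of_nonneg_left (gradSq_le_strain hd hu) ha
  refine le_trans (le_of_eq (by ring)) (h1.trans ?_)
  unfold diffusion
  rw [Finset.mul_sum]
  refine Finset.sum_le_sum fun K hK => ?_
  rw [Finset.mul_sum]
  refine Finset.sum_le_sum fun q _ => ?_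
  rw [mul_left_comm]
  refine mul_le_mul_of_nonneg_left ?_ (div_nonneg (M.vol_pos K).le (by positivity))
  rw [Finset.mul_sum]
  refine Finset.sum_le_sum fun i _ => ?_
  rw [Finset.mul_sum]
  refine Finset.sum_le_sum fun j _ => ?_
  nlinarith [(visc_mem_Icc h i j hK q).1, sq_nonneg (M.strain u i j K q)]

theorem abs_diffusion_le {u v : Fin d → (Fin d → ℤ) → ℝ} {μ : ℝ → ℝ} {ρ : (Fin d → ℤ) → ℝ}
    {a b : ℝ} (ha : 0 ≤ a) (h : ∀ K ∈ M.cells, a ≤ μ (ρ K) ∧ μ (ρ K) ≤ b) :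
    |M.diffusion μ ρ u v| ≤ b * (M.gradSq u + M.gradSq v) := by
  unfold diffusion gradSq
  rw [← Finset.sum_add_distrib, Finset.mul_sum]
  refine (Finset.abs_sum_le_sum_abs _ _).trans (Finset.sum_le_sum fun K hK => ?_)
  have hb : 0 ≤ b := ha.trans ((h K hK).1.trans (h K hK).2)
  rw [← Finset.sum_add_distrib, Finset.mul_sum]
  refine (Finset.abs_sum_le_sum_abs _ _).trans (Finset.sum_le_sum fun q _ => ?_)
  have hw : 0 ≤ M.vol K / 2 ^ d := div_nonneg (M.vol_pos K).le (by positivity)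
  rw [abs_mul, abs_of_nonneg hw, ← mul_add, mul_left_comm]
  refine mul_le_mul_of_nonneg_left ?_ hw
  calc _ ≤ ∑ i, ∑ j, b * (M.strain u i j K q ^ 2 + M.strain v i j K q ^ 2) := by
        refine (Finset.abs_sum_le_sum_abs _ _).trans (Finset.sum_le_sum fun i _ => ?_)
        refine (Finset.abs_sum_le_sum_abs _ _).trans (Finset.sum_le_sum fun j _ => ?_)
        obtain ⟨h1, h2⟩ := visc_mem_Icc h i j hK q
        rw [mul_assoc, abs_mul, abs_of_nonneg (ha.trans h1)]
        refine mul_le_mul h2 ?_ (abs_nonneg _) hb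
        rw [abs_le]
        constructor <;>
          nlinarith [sq_nonneg (M.strain u i j K q + M.strain v i j K q),
            sq_nonneg (M.strain u i j K q - M.strain v i j K q)]
    _ = b * ((∑ i, ∑ j, M.strain u i j K q ^ 2) + ∑ i, ∑ j, M.strain v i j K q ^ 2) := by
        simp only [← Finset.mul_sum, Finset.sum_add_distrib]
    _ ≤ _ := by
        have h1 := M.strain_sq_sum_le u K q
        have h2 := M.strain_sq_sum_le v K q
        gcongr

end MACGrid

/-! ### Mass balances and density bounds -/

namespace MACGrid

open Function

variable {d : ℕ} {M : MACGrid d}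

/-- The mass of the cell `K`, extended by zero to all indices. -/
noncomputable def cellMass (M : MACGrid d) (ρ : (Fin d → ℤ) → ℝ) (K : Fin d → ℤ) : ℝ :=
  if K ∈ M.cells then M.vol K * ρ K else 0

/-- The mass of the dual cell of `(i, K)`, for all indices: the mean of the masses of the two cells
on its sides. -/
noncomputable def dualMass (M : MACGrid d) (ρ : (Fin d → ℤ) → ℝ) (i : Fin d)
    (K : Fin d → ℤ) : ℝ :=
  (M.cellMass ρ (K - unitIdx i) + M.cellMass ρ K) / 2

theorem dualMass_eq {ρ : (Fin d → ℤ) → ℝ} {i : Fin d} {K : Fin d → ℤ}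
    (hK : K ∈ M.intFaces i) : M.dualVol i K * M.rhoDual ρ i K = M.dualMass ρ i K := by
  obtain ⟨h1, h2⟩ := mem_intFaces.mp hK
  rw [rhoDual, mul_div_cancel₀ _ (M.dualVol_pos i K).ne', dualMass, cellMass, cellMass, if_pos h1,
    if_pos h2]
  ring

theorem flux_eq_zero_of_notMem {ρ : (Fin d → ℤ) → ℝ} {u : Fin d → (Fin d → ℤ) → ℝ}
    (hu : M.IsVelocity u) {i : Fin d} {K : Fin d → ℤ} (hK : K ∉ M.cells) :
    M.flux ρ u i K = 0 := by
  rw [flux, hu.eq_zero_of_notMem hK, mul_zero]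

theorem flux_add_eq_zero_of_notMem {ρ : (Fin d → ℤ) → ℝ} {u : Fin d → (Fin d → ℤ) → ℝ}
    (hu : M.IsVelocity u) {i : Fin d} {K : Fin d → ℤ} (hK : K ∉ M.cells) :
    M.flux ρ u i (K + unitIdx i) = 0 := by
  rw [flux, hu.eq_zero_of_sub_notMem (K := K + unitIdx i) (by simpa using hK), mul_zero]

theorem hasFiniteSupport_dualFlux {ρ : (Fin d → ℤ) → ℝ} {u : Fin d → (Fin d → ℤ) → ℝ}
    (hu : M.IsVelocity u) (i j : Fin d) : HasFiniteSupport (M.dualFlux ρ u i j) := by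
  have h := hu.hasFiniteSupport j
  unfold dualFlux flux
  fun_prop (disch := simp)

/-- The form `-(C(ρ u) v, w)`, after a discrete integration by parts. -/
noncomputable def convForm (M : MACGrid d) (ρ : (Fin d → ℤ) → ℝ)
    (u v w : Fin d → (Fin d → ℤ) → ℝ) : ℝ :=
  ∑ i, ∑ j, ∑' K, M.dualFlux ρ u i j K * (M.velUp ρ u v i j K * (w i K - w i (K - unitIdx j)))

theorem inner_conv {ρ : (Fin d → ℤ) → ℝ} {u v w : Fin d → (Fin d → ℤ) → ℝ}
    (hw : M.IsVelocity w) : M.inner (M.conv ρ u v) w = -M.convForm ρ u v w := by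
  rw [inner_eq_tsum hw, convForm, ← Finset.sum_neg_distrib]
  refine Finset.sum_congr rfl fun i _ => ?_
  have hwi := hw.hasFiniteSupport i
  rw [← Finset.sum_neg_distrib]
  calc _ = ∑' K, ∑ j, (M.dualFlux ρ u i j (K + unitIdx j) * M.velUp ρ u v i j (K + unitIdx j)
      - M.dualFlux ρ u i j K * M.velUp ρ u v i j K) * w i K := by
        congr 1
        ext K
        rw [conv, mul_div_cancel₀ _ (M.dualVol_pos i K).ne', Finset.sum_mul]
    _ = ∑ j, ∑' K, (M.dualFlux ρ u i j (K + unitIdx j) * M.velUp ρ u v i j (K + unitIdx j)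
      - M.dualFlux ρ u i j K * M.velUp ρ u v i j K) * w i K :=
        Summable.tsum_finsetSum fun j _ => HasFiniteSupport.summable (by fun_prop (disch := simp))
    _ = _ := by
        refine Finset.sum_congr rfl fun j _ => ?_
        rw [tsum_diff_mul (fun K => M.dualFlux ρ u i j K * M.velUp ρ u v i j K) hwi]
        simp only [mul_assoc]

/-- A discretely divergence-free velocity is orthogonal to the discrete gradients. -/
theorem inner_gradP {p : (Fin d → ℤ) → ℝ} {v : Fin d → (Fin d → ℤ) → ℝ} (hv : M.IsVelocity v)
    (hdiv : ∀ K ∈ M.cells, M.div v K = 0) : M.inner (M.gradP p) v = 0 := by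
  rw [inner_eq_tsum hv]
  have h0 : ∀ K, ∑ i, (M.area i (K + unitIdx i) * v i (K + unitIdx i) - M.area i K * v i K) = 0 := by
    intro K
    by_cases hK : K ∈ M.cells
    · have h1 := hdiv K hK
      rw [div, div_eq_zero_iff] at h1
      exact h1.resolve_right (M.vol_pos K).ne'
    · refine Finset.sum_eq_zero fun i _ => ?_
      rw [hv.eq_zero_of_notMem hK, hv.eq_zero_of_sub_notMem (K := K + unitIdx i) (by simpa using hK)]
      ring
  have h1 : ∀ i, ∑' K, M.dualVol i K * M.gradP p i K * v i K =
      ∑' K, -(p K * (M.area i (K + unitIdx i) * v i (K + unitIdx i) - M.area i K * v i K)) := by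
    intro i
    have hvi := hv.hasFiniteSupport i
    have s1 : Summable fun K => p K * (M.area i K * v i K) :=
      HasFiniteSupport.summable (by fun_prop (disch := simp))
    have s2 : Summable fun K => p (K - unitIdx i) * (M.area i K * v i K) :=
      HasFiniteSupport.summable (by fun_prop (disch := simp))
    have s3 : Summable fun K => p K * (M.area i (K + unitIdx i) * v i (K + unitIdx i)) := by
      have := hvi.fun_comp_of_injective (injective_add_const (unitIdx i))
      exact HasFiniteSupport.summable (by fun_prop (disch := simp))
    have s4 := tsum_add_const (fun K => p (K - unitIdx i) * (M.area i K * v i K)) (unitIdx i)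
    simp only [add_sub_cancel_right] at s4
    calc _ = ∑' K, (p K * (M.area i K * v i K) - p (K - unitIdx i) * (M.area i K * v i K)) := by
          congr 1
          ext K
          have := (M.dualVol_pos i K).ne'
          rw [gradP]
          field_simp
      _ = ∑' K, (p K * (M.area i K * v i K)
            - p K * (M.area i (K + unitIdx i) * v i (K + unitIdx i))) := by
          rw [s1.tsum_sub s2, s1.tsum_sub s3, s4]
      _ = _ := by
          congr 1
          ext K
          ring
  rw [Finset.sum_congr rfl fun i _ => h1 i, ← Summable.tsum_finsetSum]
  · have : ∀ K, ∑ i, -(p K * (M.area i (K + unitIdx i) * v i (K + unitIdx i)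
        - M.area i K * v i K)) = 0 := fun K => by
      rw [Finset.sum_neg_distrib, ← Finset.mul_sum, h0, mul_zero, neg_zero]
    simp only [this, tsum_zero]
  · intro i _
    have hvi := hv.hasFiniteSupport i
    have := hvi.fun_comp_of_injective (injective_add_const (unitIdx i))
    exact HasFiniteSupport.summable (by fun_prop (disch := simp))

theorem div_sub {u v : Fin d → (Fin d → ℤ) → ℝ} {K : Fin d → ℤ} (hu : M.div u K = 0)
    (hv : M.div v K = 0) : M.div (u - v) K = 0 := by
  have h : M.div (u - v) K = M.div u K - M.div v K := by
    unfold div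
    rw [← sub_div, ← Finset.sum_sub_distrib]
    congr 1
    refine Finset.sum_congr rfl fun i _ => ?_
    simp only [Pi.sub_apply]
    ring
  rw [h, hu, hv, sub_zero]

/-- The discrete **maximum principle** for one implicit upwind step with a divergence-free
velocity, for `ρ` (`s = 1`) and `-ρ` (`s = -1`). In a cell `K` where `s * ρ'` is maximal, the
divergence-free condition allows to subtract `ρ' K` from the upwind densities, and all terms of
`s * massDiv` become nonnegative. -/
theorem max_principle {ρ ρ' : (Fin d → ℤ) → ℝ} {u : Fin d → (Fin d → ℤ) → ℝ}
    (hu : M.IsVelocity u) {δt : ℝ} (hδt : 0 < δt)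
    (hmass : ∀ K ∈ M.cells, (ρ' K - ρ K) / δt + M.massDiv ρ' u K = 0)
    (hdiv : ∀ K ∈ M.cells, M.div u K = 0) {s b : ℝ} (h : ∀ K ∈ M.cells, s * ρ K ≤ b) :
    ∀ K ∈ M.cells, s * ρ' K ≤ b := by
  intro L hL
  obtain ⟨K, hK, hmax⟩ := M.cells.exists_max_image (fun K => s * ρ' K) ⟨L, hL⟩
  refine (hmax L hL).trans ?_
  refine le_trans ?_ (h K hK)
  have hd0 : ∑ i, (M.area i (K + unitIdx i) * u i (K + unitIdx i) - M.area i K * u i K) = 0 := by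
    have h1 := hdiv K hK
    rw [div, div_eq_zero_iff] at h1
    exact h1.resolve_right (M.vol_pos K).ne'
  have hnn : 0 ≤ s * M.massDiv ρ' u K := by
    have h2 : s * M.massDiv ρ' u K =
        (∑ i, (M.area i (K + unitIdx i) * (u i (K + unitIdx i) *
            (s * rhoUp ρ' u i (K + unitIdx i) - s * ρ' K))
          - M.area i K * (u i K * (s * rhoUp ρ' u i K - s * ρ' K)))) / M.vol K := by
      rw [massDiv, ← mul_div_assoc]
      congr 1
      have h3 : ∑ i, s * ρ' K *
          (M.area i (K + unitIdx i) * u i (K + unitIdx i) - M.area i K * u i K) = 0 := by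
        rw [← Finset.mul_sum, hd0, mul_zero]
      rw [← sub_zero (s * _), ← h3, Finset.mul_sum, ← Finset.sum_sub_distrib]
      refine Finset.sum_congr rfl fun i _ => ?_
      simp only [flux]
      ring
    rw [h2]
    refine div_nonneg (Finset.sum_nonneg fun i _ => ?_) (M.vol_pos K).le
    rw [sub_nonneg]
    refine le_trans (b := 0) ?_ ?_
    · refine mul_nonpos_of_nonneg_of_nonpos (M.area_pos _ _).le ?_
      unfold rhoUp
      split_ifs with hs
      · rcases eq_or_ne (u i K) 0 with h0 | h0
        · rw [h0, zero_mul]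
        · have := hmax _ (mem_intFaces.mp (not_imp_comm.mp (hu i K) h0)).2
          exact mul_nonpos_of_nonneg_of_nonpos hs (by linarith)
      · simp
    · refine mul_nonneg (M.area_pos _ _).le ?_
      unfold rhoUp
      split_ifs with hs
      · simp
      · have h0 : u i (K + unitIdx i) ≠ 0 := fun h0 => hs h0.ge
        have := hmax _ (mem_intFaces.mp (not_imp_comm.mp (hu i _) h0)).1
        exact mul_nonneg_of_nonpos_of_nonpos (not_le.mp hs).le (by linarith)
  have h4 := hmass K hK
  have h5 : s * ρ' K - s * ρ K = -(δt * (s * M.massDiv ρ' u K)) := by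
    have : ρ' K - ρ K = -(δt * M.massDiv ρ' u K) := by
      field_simp at h4
      linarith
    rw [← mul_sub, this]
    ring
  nlinarith

theorem cellMass_balance {ρ ρ' : (Fin d → ℤ) → ℝ} {u : Fin d → (Fin d → ℤ) → ℝ}
    (hu : M.IsVelocity u) {δt : ℝ} (hδt : 0 < δt)
    (hmass : ∀ K ∈ M.cells, (ρ' K - ρ K) / δt + M.massDiv ρ' u K = 0) (K : Fin d → ℤ) :
    M.cellMass ρ' K - M.cellMass ρ K =
      -(δt * ∑ j, (M.flux ρ' u j (K + unitIdx j) - M.flux ρ' u j K)) := by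
  by_cases hK : K ∈ M.cells
  · have h := hmass K hK
    have hv := (M.vol_pos K).ne'
    rw [massDiv] at h
    simp only [cellMass, if_pos hK]
    field_simp at h
    linarith
  · simp only [cellMass, if_neg hK]
    rw [Finset.sum_eq_zero fun j _ => by
      rw [flux_eq_zero_of_notMem hu hK, flux_add_eq_zero_of_notMem hu hK, sub_zero]]
    simp

/-- The mass balance on the dual cells: it is the mean of the balances on two primal cells. -/
theorem dualMass_balance {ρ ρ' : (Fin d → ℤ) → ℝ} {u : Fin d → (Fin d → ℤ) → ℝ}
    (hu : M.IsVelocity u) {δt : ℝ} (hδt : 0 < δt)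
    (hmass : ∀ K ∈ M.cells, (ρ' K - ρ K) / δt + M.massDiv ρ' u K = 0) (i : Fin d)
    (K : Fin d → ℤ) :
    M.dualMass ρ' i K - M.dualMass ρ i K =
      -(δt * ∑ j, (M.dualFlux ρ' u i j (K + unitIdx j) - M.dualFlux ρ' u i j K)) := by
  have h1 := cellMass_balance hu hδt hmass K
  have h2 := cellMass_balance hu hδt hmass (K - unitIdx i)
  have h3 : ∑ j, (M.dualFlux ρ' u i j (K + unitIdx j) - M.dualFlux ρ' u i j K) =
      ((∑ j, (M.flux ρ' u j (K - unitIdx i + unitIdx j) - M.flux ρ' u j (K - unitIdx i))) +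
        ∑ j, (M.flux ρ' u j (K + unitIdx j) - M.flux ρ' u j K)) / 2 := by
    rw [← Finset.sum_add_distrib, Finset.sum_div]
    refine Finset.sum_congr rfl fun j _ => ?_
    rw [dualFlux, dualFlux, sub_add_eq_add_sub]
    ring_nf
  rw [h3, dualMass, dualMass]
  linarith

/-- The weak form of the mass balance on the dual cells. -/
theorem tsum_dualMass_balance {ρ ρ' : (Fin d → ℤ) → ℝ} {u : Fin d → (Fin d → ℤ) → ℝ}
    (hu : M.IsVelocity u) {δt : ℝ} (hδt : 0 < δt)
    (hmass : ∀ K ∈ M.cells, (ρ' K - ρ K) / δt + M.massDiv ρ' u K = 0) (i : Fin d)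
    {z : (Fin d → ℤ) → ℝ} (hz : HasFiniteSupport z) :
    ∑' K, (M.dualMass ρ' i K - M.dualMass ρ i K) * z K =
      δt * ∑ j, ∑' K, M.dualFlux ρ' u i j K * (z K - z (K - unitIdx j)) := by
  calc _ = ∑' K, -δt * ∑ j, (M.dualFlux ρ' u i j (K + unitIdx j) - M.dualFlux ρ' u i j K) * z K := by
        congr 1
        ext K
        rw [dualMass_balance hu hδt hmass, ← Finset.sum_mul]
        ring
    _ = -δt * ∑ j, ∑' K, (M.dualFlux ρ' u i j (K + unitIdx j) - M.dualFlux ρ' u i j K) * z K := by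
        rw [tsum_mul_left, Summable.tsum_finsetSum fun j _ =>
          HasFiniteSupport.summable (by fun_prop (disch := simp))]
    _ = _ := by
        rw [Finset.sum_congr rfl fun j _ => tsum_diff_mul (M.dualFlux ρ' u i j) hz (unitIdx j),
          Finset.sum_neg_distrib]
        ring

end MACGrid

/-! ### The tested momentum balance and the energy estimate -/

namespace MACGrid

open Function

variable {d : ℕ} {M : MACGrid d}

theorem isVelocity_projFaces (M : MACGrid d) (v : Fin d → (Fin d → ℝ) → ℝ) :
    M.IsVelocity (M.projFaces v) := fun _ _ hK => if_neg hK

theorem inner_le (M : MACGrid d) (v w : Fin d → (Fin d → ℤ) → ℝ) {c : ℝ} (hc : 0 < c) :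
    2 * M.inner v w ≤ c * M.inner v v + M.inner w w / c := by
  simp only [inner, Finset.mul_sum, Finset.sum_div, ← Finset.sum_add_distrib]
  refine Finset.sum_le_sum fun i _ => Finset.sum_le_sum fun K _ => ?_
  have h1 := mul_nonneg (M.dualVol_pos i K).le (div_nonneg (sq_nonneg (c * v i K - w i K)) hc.le)
  have h2 : M.dualVol i K * ((c * v i K - w i K) ^ 2 / c) =
      c * (M.dualVol i K * v i K * v i K) + M.dualVol i K * w i K * w i K / c
        - 2 * (M.dualVol i K * v i K * w i K) := by
    field_simp
    ring
  linarith

/-- Twice the kinetic energy. -/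
noncomputable def energy (M : MACGrid d) (ρ : (Fin d → ℤ) → ℝ) (v : Fin d → (Fin d → ℤ) → ℝ) : ℝ :=
  ∑ i, ∑' K, M.dualMass ρ i K * v i K ^ 2

theorem dualMass_nonneg {ρ : (Fin d → ℤ) → ℝ} (h : ∀ K ∈ M.cells, 0 ≤ ρ K) (i : Fin d)
    (K : Fin d → ℤ) : 0 ≤ M.dualMass ρ i K := by
  have h1 : ∀ K, 0 ≤ M.cellMass ρ K := fun K => by
    unfold cellMass
    split_ifs with hK
    · exact mul_nonneg (M.vol_pos K).le (h K hK)
    · exact le_rfl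
  have h2 := h1 K
  have h3 := h1 (K - unitIdx i)
  unfold dualMass
  positivity

theorem dualMass_bounds {ρ : (Fin d → ℤ) → ℝ} {a b : ℝ} (h : ∀ K ∈ M.cells, a ≤ ρ K ∧ ρ K ≤ b)
    {i : Fin d} {K : Fin d → ℤ} (hK : K ∈ M.intFaces i) :
    a * M.dualVol i K ≤ M.dualMass ρ i K ∧ M.dualMass ρ i K ≤ b * M.dualVol i K := by
  obtain ⟨h1, h2⟩ := mem_intFaces.mp hK
  have h3 := h _ h1
  have h4 := h _ h2
  have h5 := M.vol_pos K
  have h6 := M.vol_pos (K - unitIdx i)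
  rw [dualMass, cellMass, cellMass, if_pos h1, if_pos h2, dualVol]
  constructor <;> nlinarith

theorem energy_bounds {ρ : (Fin d → ℤ) → ℝ} {a b : ℝ} (h : ∀ K ∈ M.cells, a ≤ ρ K ∧ ρ K ≤ b)
    {v : Fin d → (Fin d → ℤ) → ℝ} (hv : M.IsVelocity v) :
    a * M.inner v v ≤ M.energy ρ v ∧ M.energy ρ v ≤ b * M.inner v v := by
  have h1 : M.energy ρ v = ∑ i, ∑ K ∈ M.intFaces i, M.dualMass ρ i K * v i K ^ 2 :=
    Finset.sum_congr rfl fun i _ => tsum_eq_sum fun K hK => by simp [hv i K hK]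
  rw [h1, inner, Finset.mul_sum, Finset.mul_sum]
  simp only [Finset.mul_sum]
  constructor <;> refine Finset.sum_le_sum fun i _ => Finset.sum_le_sum fun K hK => ?_
  · nlinarith [(dualMass_bounds h hK).1, sq_nonneg (v i K)]
  · nlinarith [(dualMass_bounds h hK).2, sq_nonneg (v i K)]

namespace IsSolution

variable {N : ℕ} {T : ℝ} {μ : ℝ → ℝ} {ρ₀ : (Fin d → ℝ) → ℝ} {u₀ : Fin d → (Fin d → ℝ) → ℝ}
  {f : ℝ → Fin d → (Fin d → ℝ) → ℝ} {ρ : ℕ → (Fin d → ℤ) → ℝ} {u : ℕ → Fin d → (Fin d → ℤ) → ℝ}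
  {p : ℕ → (Fin d → ℤ) → ℝ}

theorem isVelocity (S : M.IsSolution N T μ ρ₀ u₀ f ρ u p) {n : ℕ} (hn : n ≤ N) :
    M.IsVelocity (u n) := by
  cases n with
  | zero =>
    rw [S.initial_velocity]
    exact M.isVelocity_projFaces u₀
  | succ n => exact S.velocity n hn

theorem density_mem (S : M.IsSolution N T μ ρ₀ u₀ f ρ u p) (hδ : 0 < T / N) {a b : ℝ}
    (h0 : ∀ K ∈ M.cells, a ≤ ρ 0 K ∧ ρ 0 K ≤ b) {n : ℕ} (hn : n ≤ N) :
    ∀ K ∈ M.cells, a ≤ ρ n K ∧ ρ n K ≤ b := by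
  induction n with
  | zero => exact h0
  | succ n ih =>
    have ih := ih (by omega)
    intro K hK
    have h1 := max_principle (S.velocity n hn) hδ (S.mass n hn) (S.divergence_free n hn)
      (s := 1) (b := b) (fun K hK => by linarith [ih K hK]) K hK
    have h2 := max_principle (S.velocity n hn) hδ (S.mass n hn) (S.divergence_free n hn)
      (s := -1) (b := -a) (fun K hK => by linarith [ih K hK]) K hK
    constructor <;> linarith

/-- The momentum balance tested with a divergence-free velocity. -/
theorem momentum_tested (S : M.IsSolution N T μ ρ₀ u₀ f ρ u p) (hδ : 0 < T / N) {n : ℕ}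
    (hn : n < N) {w : Fin d → (Fin d → ℤ) → ℝ} (hw : M.IsVelocity w)
    (hdiv : ∀ K ∈ M.cells, M.div w K = 0) :
    ∑ i, ∑' K, (M.dualMass (ρ (n + 1)) i K * u (n + 1) i K
        - M.dualMass (ρ n) i K * u n i K) * w i K =
      T / N * (M.convForm (ρ (n + 1)) (u (n + 1)) (u (n + 1)) w
        - M.diffusion μ (ρ (n + 1)) (u (n + 1)) w
        + M.inner (M.projFaces (f ((n + 1 : ℕ) * (T / N)))) w) := by
  have h := S.momentum n hn w hw
  rw [inner_conv hw, inner_gradP hw hdiv] at h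
  have h1 : ∑ i, ∑' K, (M.dualMass (ρ (n + 1)) i K * u (n + 1) i K
        - M.dualMass (ρ n) i K * u n i K) * w i K =
      T / N * M.inner (fun i K => (M.rhoDual (ρ (n + 1)) i K * u (n + 1) i K
        - M.rhoDual (ρ n) i K * u n i K) / (T / N)) w := by
    rw [inner, Finset.mul_sum]
    refine Finset.sum_congr rfl fun i _ => ?_
    rw [tsum_eq_sum (s := M.intFaces i) fun K hK => by simp [hw i K hK], Finset.mul_sum]
    refine Finset.sum_congr rfl fun K hK => ?_
    have h2 : ∀ x : ℝ, T / N * (M.dualVol i K * (x / (T / N)) * w i K) =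
        M.dualVol i K * x * w i K := fun x => by
      calc _ = M.dualVol i K * (T / N * (x / (T / N))) * w i K := by ring
        _ = _ := by rw [mul_div_cancel₀ _ hδ.ne']
    rw [h2, ← dualMass_eq hK, ← dualMass_eq hK]
    ring
  rw [h1]
  congr 1
  linarith

/-- The kinetic energy balance of one time step. The identity
`2 (ρ' v - ρ v₀) v = ρ' v ^ 2 - ρ v₀ ^ 2 + (ρ' - ρ) v ^ 2 + ρ (v - v₀) ^ 2` leaves the term with
`ρ' - ρ`, which by the mass balance cancels the convection up to the upwind dissipation. -/
theorem energy_step (S : M.IsSolution N T μ ρ₀ u₀ f ρ u p) (hδ : 0 < T / N)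
    {n : ℕ} (hn : n < N) (hρ : ∀ K ∈ M.cells, 0 ≤ ρ n K) :
    M.energy (ρ (n + 1)) (u (n + 1)) +
        2 * (T / N) * M.diffusion μ (ρ (n + 1)) (u (n + 1)) (u (n + 1)) ≤
      M.energy (ρ n) (u n) +
        2 * (T / N) * M.inner (M.projFaces (f ((n + 1 : ℕ) * (T / N)))) (u (n + 1)) := by
  have hv := S.isVelocity (n := n + 1) hn
  have hv0 := S.isVelocity (n := n) hn.le
  have h1 := S.momentum_tested hδ hn hv (S.divergence_free n hn)
  set m' := M.dualMass (ρ (n + 1))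
  set m := M.dualMass (ρ n)
  set v := u (n + 1)
  set v0 := u n
  set G := M.dualFlux (ρ (n + 1)) v
  have hvs := hv.hasFiniteSupport
  have hv0s := hv0.hasFiniteSupport
  have h2 : ∀ i, ∑' K, m' i K * v i K ^ 2 - ∑' K, m i K * v0 i K ^ 2
      + ∑' K, (m' i K - m i K) * v i K ^ 2 ≤
      2 * ∑' K, (m' i K * v i K - m i K * v0 i K) * v i K := by
    intro i
    have q := hvs i
    have q0 := hv0s i
    have s1 : Summable fun K => m' i K * v i K ^ 2 :=
      HasFiniteSupport.summable (by fun_prop (disch := simp))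
    have s2 : Summable fun K => m i K * v0 i K ^ 2 :=
      HasFiniteSupport.summable (by fun_prop (disch := simp))
    have s3 : Summable fun K => (m' i K - m i K) * v i K ^ 2 :=
      HasFiniteSupport.summable (by fun_prop (disch := simp))
    rw [← s1.tsum_sub s2, ← (s1.sub s2).tsum_add s3, ← tsum_mul_left]
    refine tsum_le_tsum_of_hasFiniteSupport (fun K => ?_) (by fun_prop (disch := simp))
      (by fun_prop (disch := simp))
    nlinarith [mul_nonneg (dualMass_nonneg hρ i K) (sq_nonneg (v i K - v0 i K))]
  have h3 : ∀ i, ∑' K, (m' i K - m i K) * v i K ^ 2 =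
      T / N * ∑ j, ∑' K, G i j K * (v i K ^ 2 - v i (K - unitIdx j) ^ 2) := fun i => by
    have q := hvs i
    exact tsum_dualMass_balance hv hδ (S.mass n hn) i (z := fun K => v i K ^ 2)
      (by fun_prop (disch := simp))
  -- the upwind choice makes the convection dissipative
  have h4 : ∀ i j, 2 * ∑' K, G i j K * (M.velUp (ρ (n + 1)) v v i j K *
      (v i K - v i (K - unitIdx j))) ≤
      ∑' K, G i j K * (v i K ^ 2 - v i (K - unitIdx j) ^ 2) := by
    intro i j
    have q := hvs i
    have qG : HasFiniteSupport (G i j) := hasFiniteSupport_dualFlux hv i j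
    rw [← tsum_mul_left]
    refine tsum_le_tsum_of_hasFiniteSupport (fun K => ?_) (by fun_prop (disch := simp))
      (by fun_prop (disch := simp))
    unfold velUp
    split_ifs with hs
    · nlinarith [mul_nonneg hs (sq_nonneg (v i K - v i (K - unitIdx j)))]
    · nlinarith [mul_nonneg (neg_nonneg.mpr (not_le.mp hs).le)
        (sq_nonneg (v i K - v i (K - unitIdx j)))]
  have h5 := Finset.sum_le_sum fun i (_ : i ∈ Finset.univ) => h2 i
  rw [← Finset.mul_sum, h1, Finset.sum_add_distrib, Finset.sum_sub_distrib,
    Finset.sum_congr rfl fun i _ => h3 i, ← Finset.mul_sum] at h5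
  have h6 : 2 * M.convForm (ρ (n + 1)) v v v ≤
      ∑ i, ∑ j, ∑' K, G i j K * (v i K ^ 2 - v i (K - unitIdx j) ^ 2) := by
    unfold convForm
    rw [Finset.mul_sum]
    refine Finset.sum_le_sum fun i _ => ?_
    rw [Finset.mul_sum]
    exact Finset.sum_le_sum fun j _ => h4 i j
  have h7 := mul_le_mul_of_nonneg_left h6 hδ.le
  unfold energy
  linarith

/-- The **energy estimate**, in `L²(0, T; H¹)`. The maximum in time of the `L²` norm absorbs the
source term, so that neither a Poincaré nor a Gronwall inequality is used. -/
theorem sum_h1Sq_le (S : M.IsSolution N T μ ρ₀ u₀ f ρ u p) (hd : d = 2 ∨ d = 3) (hN : 0 < N)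
    (hT : 0 < T) {ρmin ρmax a b U F : ℝ} (hρmin : 0 < ρmin) (ha : 0 < a)
    (hρ : ∀ n ≤ N, ∀ K ∈ M.cells, ρmin ≤ ρ n K ∧ ρ n K ≤ ρmax) (hle : ρmin ≤ ρmax)
    (hμ : ∀ r ∈ Set.Icc ρmin ρmax, a ≤ μ r ∧ μ r ≤ b)
    (hU : M.inner (u 0) (u 0) ≤ U ^ 2)
    (hF : ∑ n ∈ Finset.range N, T / N * M.inner (M.projFaces (f ((n + 1 : ℕ) * (T / N))))
      (M.projFaces (f ((n + 1 : ℕ) * (T / N)))) ≤ F ^ 2) :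
    ∑ n ∈ Finset.range N, T / N * M.h1Sq (u (n + 1)) ≤
      (2 * T / ρmin + 8 / (3 * a)) * (ρmax * U ^ 2 + 2 * T / ρmin * F ^ 2) := by
  have hNr : (0 : ℝ) < N := by exact_mod_cast hN
  have hδ : 0 < T / N := div_pos hT hNr
  set δ := T / (N : ℝ)
  set c := 2 * T / ρmin with hc
  have hc0 : 0 < c := by positivity
  set A := ρmax * U ^ 2 + c * F ^ 2
  set y : ℕ → ℝ := fun n => M.inner (u (n + 1)) (u (n + 1)) with hy
  set φ : ℕ → ℝ := fun n => M.inner (M.projFaces (f ((n + 1 : ℕ) * δ)))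
      (M.projFaces (f ((n + 1 : ℕ) * δ))) with hφ
  have hy0 : ∀ n, 0 ≤ y n := fun n => M.inner_self_nonneg _
  have hφ0 : ∀ n, 0 ≤ φ n := fun n => M.inner_self_nonneg _
  have step : ∀ n < N, M.energy (ρ (n + 1)) (u (n + 1)) + δ * (3 / 4 * a * M.gradSq (u (n + 1))) ≤
      M.energy (ρ n) (u n) + (c * (δ * φ n) + δ * y n / c) := by
    intro n hn
    have h1 := S.energy_step hδ hn fun K hK => hρmin.le.trans (hρ n hn.le K hK).1
    have h2 := diffusion_self_ge hd (S.velocity n hn) (μ := μ) (ρ := ρ (n + 1)) ha.le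
      fun K hK => hμ _ (hρ (n + 1) hn K hK)
    have h3 := M.inner_le (M.projFaces (f ((n + 1 : ℕ) * δ))) (u (n + 1)) hc0
    have h2' := mul_le_mul_of_nonneg_left h2 hδ.le
    have h3' := mul_le_mul_of_nonneg_left h3 hδ.le
    have h4 : δ * (c * φ n + y n / c) = c * (δ * φ n) + δ * y n / c := by ring
    rw [← h4]
    simp only [δ, φ, y] at h1 h2' h3' ⊢
    linarith
  have total : ∀ m ≤ N, M.energy (ρ m) (u m) +
      ∑ n ∈ Finset.range m, δ * (3 / 4 * a * M.gradSq (u (n + 1))) ≤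
      M.energy (ρ 0) (u 0) + ∑ n ∈ Finset.range m, (c * (δ * φ n) + δ * y n / c) := by
    intro m hm
    induction m with
    | zero => simp
    | succ m ih =>
      have h1 := ih (by omega)
      have h2 := step m (by omega)
      rw [Finset.sum_range_succ, Finset.sum_range_succ]
      linarith
  have hE0 : M.energy (ρ 0) (u 0) ≤ ρmax * U ^ 2 :=
    (energy_bounds (hρ 0 (Nat.zero_le _)) (S.isVelocity (Nat.zero_le _))).2.trans
      (mul_le_mul_of_nonneg_left hU (hρmin.le.trans hle))
  -- `c` is such that the sum of the terms `δ * y n / c` is at most half of `ρmin * y k`, which the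
  -- energy at the time `k + 1` controls
  obtain ⟨k, hk, hmax⟩ := (Finset.range N).exists_max_image y ⟨0, Finset.mem_range.mpr hN⟩
  have hkN := Finset.mem_range.mp hk
  have hrhs : ∀ m ≤ N, ∑ n ∈ Finset.range m, (c * (δ * φ n) + δ * y n / c) ≤
      c * F ^ 2 + ρmin / 2 * y k := by
    intro m hm
    rw [Finset.sum_add_distrib, ← Finset.mul_sum]
    have hsub := Finset.range_subset_range.mpr hm
    have h1 : ∑ n ∈ Finset.range m, δ * φ n ≤ F ^ 2 :=
      (Finset.sum_le_sum_of_subset_of_nonneg hsub fun n _ _ => mul_nonneg hδ.le (hφ0 n)).trans hF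
    have h2 : ∑ n ∈ Finset.range m, δ * y n / c ≤ ∑ n ∈ Finset.range N, δ * y k / c := by
      refine (Finset.sum_le_sum_of_subset_of_nonneg hsub fun n _ _ =>
        div_nonneg (mul_nonneg hδ.le (hy0 n)) hc0.le).trans (Finset.sum_le_sum fun n hn => ?_)
      have := hmax n hn
      gcongr
    have h3 : ∑ n ∈ Finset.range N, δ * y k / c = ρmin / 2 * y k := by
      rw [Finset.sum_const, Finset.card_range, nsmul_eq_mul]
      simp only [δ, c]
      field_simp
    have h4 := mul_le_mul_of_nonneg_left h1 hc0.le
    linarith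
  have hG0 : ∀ n, 0 ≤ δ * (3 / 4 * a * M.gradSq (u (n + 1))) := fun n => by
    have := M.gradSq_nonneg (u (n + 1))
    positivity
  have hyk : ρmin * y k ≤ 2 * A := by
    have h1 := total (k + 1) hkN
    have h2 := hrhs (k + 1) hkN
    have h3 := (energy_bounds (hρ (k + 1) hkN) (S.velocity k hkN)).1
    have h4 := Finset.sum_nonneg fun n (_ : n ∈ Finset.range (k + 1)) => hG0 n
    simp only [A, y] at *
    linarith
  have hgrad : ∑ n ∈ Finset.range N, δ * (3 / 4 * a * M.gradSq (u (n + 1))) ≤ 2 * A := by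
    have h1 := total N le_rfl
    have h2 := hrhs N le_rfl
    have h3 := (energy_bounds (hρ N le_rfl) (S.isVelocity le_rfl)).1
    have h4 := mul_nonneg hρmin.le (M.inner_self_nonneg (u N))
    simp only [A] at *
    linarith
  have hsumy : ∑ n ∈ Finset.range N, δ * y n ≤ c * A := by
    have h1 : ∑ n ∈ Finset.range N, δ * y n ≤ ∑ n ∈ Finset.range N, δ * y k :=
      Finset.sum_le_sum fun n hn => mul_le_mul_of_nonneg_left (hmax n hn) hδ.le
    have h2 : ∑ n ∈ Finset.range N, δ * y k = T / ρmin * (ρmin * y k) := by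
      rw [Finset.sum_const, Finset.card_range, nsmul_eq_mul]
      simp only [δ]
      field_simp
    have h3 := mul_le_mul_of_nonneg_left hyk (div_pos hT hρmin).le
    have h4 : T / ρmin * (2 * A) = c * A := by rw [hc]; ring
    linarith
  have hsumg : ∑ n ∈ Finset.range N, δ * M.gradSq (u (n + 1)) ≤ 8 / (3 * a) * A := by
    have h1 : ∑ n ∈ Finset.range N, δ * (3 / 4 * a * M.gradSq (u (n + 1))) =
        3 / 4 * a * ∑ n ∈ Finset.range N, δ * M.gradSq (u (n + 1)) := by
      rw [Finset.mul_sum]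
      exact Finset.sum_congr rfl fun n _ => by ring
    rw [h1] at hgrad
    rw [div_mul_eq_mul_div, le_div_iff₀ (by positivity)]
    linarith
  calc ∑ n ∈ Finset.range N, δ * M.h1Sq (u (n + 1))
      = ∑ n ∈ Finset.range N, δ * y n + ∑ n ∈ Finset.range N, δ * M.gradSq (u (n + 1)) := by
        rw [← Finset.sum_add_distrib]
        exact Finset.sum_congr rfl fun n _ => by rw [h1Sq, mul_add]
    _ ≤ c * A + 8 / (3 * a) * A := add_le_add hsumy hsumg
    _ = _ := by ring

end IsSolution

end MACGrid

/-! ### The trilinear form and the time increments -/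

namespace MACGrid

open Function

variable {d : ℕ} {M : MACGrid d}

/-- The discrete `H¹` norm. -/
noncomputable def h1Norm (M : MACGrid d) (u : Fin d → (Fin d → ℤ) → ℝ) : ℝ := √(M.h1Sq u)

theorem h1Norm_nonneg (M : MACGrid d) (u : Fin d → (Fin d → ℤ) → ℝ) : 0 ≤ M.h1Norm u :=
  Real.sqrt_nonneg _

theorem h1Norm_sq (M : MACGrid d) (u : Fin d → (Fin d → ℤ) → ℝ) : M.h1Norm u ^ 2 = M.h1Sq u :=
  Real.sq_sqrt (M.h1Sq_nonneg u)

theorem h1Norm_sub_le (M : MACGrid d) (u v : Fin d → (Fin d → ℤ) → ℝ) :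
    M.h1Norm (u - v) ≤ 2 * (M.h1Norm u + M.h1Norm v) := by
  have h := M.h1Sq_sub_le u v
  have h1 := M.h1Norm_nonneg u
  have h2 := M.h1Norm_nonneg v
  refine Real.sqrt_le_iff.mpr ⟨by positivity, h.trans ?_⟩
  rw [← h1Norm_sq, ← h1Norm_sq]
  nlinarith [mul_nonneg h1 h2]

theorem tsum_add_abs_pow_four_le {α : Type*} [AddCommGroup α] {a : α → ℝ}
    (ha : HasFiniteSupport a) (e : α) :
    ∑' K, (|a K| + |a (K - e)|) ^ 4 ≤ 16 * ∑' K, a K ^ 4 := by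
  have s1 : HasFiniteSupport fun K => a K ^ 4 := by fun_prop (disch := simp)
  have s2 : HasFiniteSupport fun K => a (K - e) ^ 4 := by fun_prop (disch := simp)
  calc ∑' K, (|a K| + |a (K - e)|) ^ 4 ≤ ∑' K, (8 * a K ^ 4 + 8 * a (K - e) ^ 4) := by
        refine tsum_le_tsum_of_hasFiniteSupport (fun K => ?_) (by fun_prop (disch := simp))
          (by fun_prop (disch := simp))
        have h := add_pow_le (abs_nonneg (a K)) (abs_nonneg (a (K - e))) 4
        have h4 : ∀ x : ℝ, |x| ^ 4 = x ^ 4 := fun x => Even.pow_abs (by decide) x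
        rw [h4, h4] at h
        norm_num at h
        linarith
    _ = _ := by
        rw [(s1.summable.mul_left 8).tsum_add (s2.summable.mul_left 8), tsum_mul_left,
          tsum_mul_left, tsum_sub_const (fun K => a K ^ 4)]
        ring

namespace QuasiUniform

variable {h κ : ℝ}

theorem abs_flux_le (H : M.QuasiUniform h κ) {ρ : (Fin d → ℤ) → ℝ} {R : ℝ}
    (hρ : ∀ K ∈ M.cells, 0 ≤ ρ K ∧ ρ K ≤ R) {a : Fin d → (Fin d → ℤ) → ℝ} (ha : M.IsVelocity a)
    (j : Fin d) (K : Fin d → ℤ) : |M.flux ρ a j K| ≤ (κ * h) ^ (d - 1) * R * |a j K| := by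
  by_cases hK : K ∈ M.intFaces j
  · obtain ⟨h1, h2⟩ := mem_intFaces.mp hK
    have hup : 0 ≤ rhoUp ρ a j K ∧ rhoUp ρ a j K ≤ R := by
      unfold rhoUp
      split_ifs
      · exact hρ _ h2
      · exact hρ _ h1
    have hκh : 0 ≤ κ * h := mul_nonneg (zero_le_one.trans H.one_le) H.pos.le
    rw [flux, abs_mul, abs_mul, abs_of_pos (M.area_pos j K), abs_of_nonneg hup.1]
    have := H.area_le (i := j) h1
    exact mul_le_mul_of_nonneg_right (mul_le_mul this hup.2 hup.1 (pow_nonneg hκh _))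
      (abs_nonneg _)
  · simp [flux, ha j K hK]

/-- The trilinear bound in `H¹` for one pair of directions, from the Hölder inequality with exponents `4`, `4`, `2` and the
embedding into `L⁴`. -/
theorem abs_tsum_dualFlux_le (H : M.QuasiUniform h κ) (hd : d = 2 ∨ d = 3)
    {ρ : (Fin d → ℤ) → ℝ} {R : ℝ} (hR : 0 ≤ R) (hρ : ∀ K ∈ M.cells, 0 ≤ ρ K ∧ ρ K ≤ R)
    {a b c : Fin d → (Fin d → ℤ) → ℝ} (ha : M.IsVelocity a) (hb : M.IsVelocity b)
    (hc : M.IsVelocity c) (i j : Fin d) {s : (Fin d → ℤ) → ℝ}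
    (hs : ∀ K, |s K| ≤ |b i K| + |b i (K - unitIdx j)|) :
    |∑' K, M.dualFlux ρ a i j K * (s K * (c i K - c i (K - unitIdx j)))| ≤
      κ ^ (d - 1) * R * (8 * (2 * 2 ^ d * κ ^ (d + 2)) ^ 2) *
        (M.h1Norm a * M.h1Norm b * M.h1Norm c) := by
  have hh := H.pos
  have hκ := H.one_le
  have hκ0 : 0 < κ := zero_lt_one.trans_le hκ
  have sa := ha.hasFiniteSupport j
  have sb := hb.hasFiniteSupport i
  have sc := hc.hasFiniteSupport i
  set Γ := 2 * 2 ^ d * κ ^ (d + 2) with hΓ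
  have hΓ1 : 1 ≤ Γ := by
    have h1 : (1 : ℝ) ≤ κ ^ (d + 2) := one_le_pow₀ hκ
    have h2 : (1 : ℝ) ≤ 2 ^ d := one_le_pow₀ (by norm_num)
    nlinarith
  set A : (Fin d → ℤ) → ℝ := fun K => |a j K| + |a j (K - unitIdx i)| with hA
  set B : (Fin d → ℤ) → ℝ := fun K => |b i K| + |b i (K - unitIdx j)| with hB
  set C : (Fin d → ℤ) → ℝ := fun K => |c i K - c i (K - unitIdx j)| with hC
  have sA : HasFiniteSupport A := by fun_prop (disch := simp)
  have sB : HasFiniteSupport B := by fun_prop (disch := simp)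
  have sC : HasFiniteSupport C := by fun_prop (disch := simp)
  have hA0 : ∀ K, 0 ≤ A K := fun K => by positivity
  have hB0 : ∀ K, 0 ≤ B K := fun K => by positivity
  have hC0 : ∀ K, 0 ≤ C K := fun K => abs_nonneg _
  set P := (κ * h) ^ (d - 1) * R with hP
  have hP0 : 0 ≤ P := by positivity
  set X := ∑' K, A K * B K * C K with hX
  have hX0 : 0 ≤ X := tsum_nonneg fun K => mul_nonneg (mul_nonneg (hA0 K) (hB0 K)) (hC0 K)
  have sG : HasFiniteSupport (M.dualFlux ρ a i j) := hasFiniteSupport_dualFlux ha i j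
  have h1 : |∑' K, M.dualFlux ρ a i j K * (s K * (c i K - c i (K - unitIdx j)))| ≤ P * X := by
    rw [← Real.norm_eq_abs]
    have sN : HasFiniteSupport fun K =>
        ‖M.dualFlux ρ a i j K * (s K * (c i K - c i (K - unitIdx j)))‖ := by
      simp only [Real.norm_eq_abs]
      fun_prop (disch := simp)
    refine (norm_tsum_le_tsum_norm sN.summable).trans ?_
    rw [hX, ← tsum_mul_left]
    refine tsum_le_tsum_of_hasFiniteSupport (fun K => ?_) sN (by fun_prop (disch := simp))
    rw [Real.norm_eq_abs, abs_mul, abs_mul]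
    have hG : |M.dualFlux ρ a i j K| ≤ P * A K := by
      have f1 := H.abs_flux_le hρ ha j K
      have f2 := H.abs_flux_le hρ ha j (K - unitIdx i)
      rw [dualFlux, abs_div, abs_two]
      have f3 := abs_add_le (M.flux ρ a j (K - unitIdx i)) (M.flux ρ a j K)
      have f4 : 0 ≤ P * A K := mul_nonneg hP0 (hA0 K)
      simp only [A] at f4 ⊢
      linarith
    calc _ ≤ P * A K * (B K * C K) :=
          mul_le_mul hG (mul_le_mul_of_nonneg_right (hs K) (hC0 K))
            (mul_nonneg (abs_nonneg _) (abs_nonneg _)) (mul_nonneg hP0 (hA0 K))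
      _ = _ := by ring
  have h2 : X ^ 4 ≤ (16 * ∑' K, a j K ^ 4) * (16 * ∑' K, b i K ^ 4) * incrSq (c i) j ^ 2 := by
    have hC2 : ∑' K, C K ^ 2 = incrSq (c i) j := by
      rw [incrSq, ← tsum_sub_const (fun K => (c i (K + unitIdx j) - c i K) ^ 2) (unitIdx j)]
      congr 1
      ext K
      simp only [C, sq_abs, sub_add_cancel]
    refine (abs_tsum_mul_mul_pow_four_le sA sB sC).trans ?_
    rw [hC2]
    have b1 := tsum_add_abs_pow_four_le sa (unitIdx i)
    have b2 := tsum_add_abs_pow_four_le sb (unitIdx j)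
    have b3 : 0 ≤ ∑' K, b i K ^ 4 := tsum_nonneg fun K => by positivity
    have b4 : 0 ≤ ∑' K, B K ^ 4 := tsum_nonneg fun K => by positivity
    have b5 : 0 ≤ ∑' K, a j K ^ 4 := tsum_nonneg fun K => by positivity
    exact mul_le_mul_of_nonneg_right (mul_le_mul b1 b2 b4 (by positivity)) (sq_nonneg _)
  -- in terms of `h ^ d * X`, the powers of `h` cancel
  have h3 : h ^ d * X ≤ h * (8 * Γ ^ 2 * (M.h1Norm a * M.h1Norm b * M.h1Norm c)) := by
    have na := M.h1Norm_nonneg a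
    have nb := M.h1Norm_nonneg b
    have nc := M.h1Norm_nonneg c
    refine le_of_pow_le_pow_left₀ (n := 4) (by norm_num) (by positivity) ?_
    have k1 := H.pow_mul_tsum_pow_four_le hd ha j
    have k2 := H.pow_mul_tsum_pow_four_le hd hb i
    have k3 := H.pow_mul_incrSq_le_h1Sq hc i j
    rw [← hΓ, ← h1Norm_sq] at k1 k2 k3
    have n1 : 0 ≤ ∑' K, a j K ^ 4 := tsum_nonneg fun K => by positivity
    have n2 : 0 ≤ ∑' K, b i K ^ 4 := tsum_nonneg fun K => by positivity
    have n3 := incrSq_nonneg (c i) j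
    calc (h ^ d * X) ^ 4 = (h ^ d) ^ 4 * X ^ 4 := mul_pow _ _ _
      _ ≤ (h ^ d) ^ 4 *
          ((16 * ∑' K, a j K ^ 4) * (16 * ∑' K, b i K ^ 4) * incrSq (c i) j ^ 2) := by gcongr
      _ = 256 * ((h ^ d * ∑' K, a j K ^ 4) * (h ^ d * ∑' K, b i K ^ 4) *
          (h ^ d * incrSq (c i) j) ^ 2) := by ring
      _ ≤ 256 * ((4 * (Γ * M.h1Norm a ^ 2) ^ 2) * (4 * (Γ * M.h1Norm b ^ 2) ^ 2) *
          (h ^ 2 * (Γ * M.h1Norm c ^ 2)) ^ 2) := by gcongr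
      _ = 4096 * Γ ^ 6 * (h * (M.h1Norm a * M.h1Norm b * M.h1Norm c)) ^ 4 := by ring
      _ ≤ 4096 * Γ ^ 8 * (h * (M.h1Norm a * M.h1Norm b * M.h1Norm c)) ^ 4 := by
          have := pow_le_pow_right₀ hΓ1 (show 6 ≤ 8 by norm_num)
          gcongr
      _ = _ := by ring
  have h4 : h ^ (d - 1) * X ≤ 8 * Γ ^ 2 * (M.h1Norm a * M.h1Norm b * M.h1Norm c) := by
    refine le_of_mul_le_mul_left ?_ hh
    rw [← mul_assoc, ← pow_succ', Nat.sub_add_cancel (by omega)]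
    exact h3
  refine h1.trans ?_
  calc P * X = κ ^ (d - 1) * R * (h ^ (d - 1) * X) := by rw [hP, mul_pow]; ring
    _ ≤ κ ^ (d - 1) * R * (8 * Γ ^ 2 * (M.h1Norm a * M.h1Norm b * M.h1Norm c)) := by gcongr
    _ = _ := by ring

end QuasiUniform

/-- The constant in the trilinear bound on a mesh that is quasi-uniform with the factor `κ`, for
densities between `0` and `R`. -/
noncomputable def trilinearConst (d : ℕ) (κ R : ℝ) : ℝ :=
  d * (d * (κ ^ (d - 1) * R * (8 * (2 * 2 ^ d * κ ^ (d + 2)) ^ 2)))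

theorem trilinearConst_nonneg (d : ℕ) {κ R : ℝ} (hκ : 0 ≤ κ) (hR : 0 ≤ R) :
    0 ≤ trilinearConst d κ R := by
  unfold trilinearConst
  positivity

theorem QuasiUniform.abs_sum_tsum_dualFlux_le {h κ : ℝ} (H : M.QuasiUniform h κ)
    (hd : d = 2 ∨ d = 3) {ρ : (Fin d → ℤ) → ℝ} {R : ℝ} (hR : 0 ≤ R)
    (hρ : ∀ K ∈ M.cells, 0 ≤ ρ K ∧ ρ K ≤ R)
    {a b c : Fin d → (Fin d → ℤ) → ℝ} (ha : M.IsVelocity a) (hb : M.IsVelocity b)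
    (hc : M.IsVelocity c) {s : Fin d → Fin d → (Fin d → ℤ) → ℝ}
    (hs : ∀ i j K, |s i j K| ≤ |b i K| + |b i (K - unitIdx j)|) :
    |∑ i, ∑ j, ∑' K, M.dualFlux ρ a i j K * (s i j K * (c i K - c i (K - unitIdx j)))| ≤
      trilinearConst d κ R * (M.h1Norm a * M.h1Norm b * M.h1Norm c) := by
  refine (Finset.abs_sum_le_sum_abs _ _).trans ((Finset.sum_le_sum fun i _ =>
    (Finset.abs_sum_le_sum_abs _ _).trans (Finset.sum_le_sum fun j _ =>
      H.abs_tsum_dualFlux_le hd hR hρ ha hb hc i j (hs i j))).trans (le_of_eq ?_))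
  simp only [Finset.sum_const, Finset.card_univ, Fintype.card_fin, nsmul_eq_mul, trilinearConst]
  ring

namespace IsSolution

variable {N : ℕ} {T : ℝ} {μ : ℝ → ℝ} {ρ₀ : (Fin d → ℝ) → ℝ} {u₀ : Fin d → (Fin d → ℝ) → ℝ}
  {f : ℝ → Fin d → (Fin d → ℝ) → ℝ} {ρ : ℕ → (Fin d → ℤ) → ℝ} {u : ℕ → Fin d → (Fin d → ℤ) → ℝ}
  {p : ℕ → (Fin d → ℤ) → ℝ}

/-- The increment of the velocity between two discrete times, in terms of a quantity `e` whose
square is summable in time. For the times `n` and `m` the velocities are divergence-free, hence the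
hypothesis `0 < n`. The momentum balance controls the increment of `ρ u`, and the mass
balance controls that of `ρ`. -/
theorem inner_increment_le (S : M.IsSolution N T μ ρ₀ u₀ f ρ u p) (hd : d = 2 ∨ d = 3)
    (hδ : 0 < T / N) {ρmin ρmax a b h κ : ℝ} (hρmin : 0 < ρmin) (ha : 0 ≤ a)
    (hle : ρmin ≤ ρmax) (hab : a ≤ b) (H : M.QuasiUniform h κ)
    (hρ : ∀ n ≤ N, ∀ K ∈ M.cells, ρmin ≤ ρ n K ∧ ρ n K ≤ ρmax)
    (hμ : ∀ r ∈ Set.Icc ρmin ρmax, a ≤ μ r ∧ μ r ≤ b) {e : ℕ → ℝ}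
    (he : ∀ l, e l = 1 + M.h1Norm (u l) +
      √(M.inner (M.projFaces (f (l * (T / N)))) (M.projFaces (f (l * (T / N))))))
    {n m : ℕ} (hn : 0 < n) (hnm : n ≤ m) (hm : m ≤ N) :
    ρmin * M.inner (u m - u n) (u m - u n) ≤
      (6 * trilinearConst d κ ρmax + 4 * (b + 1)) * ∑ l ∈ Finset.Ico n m, T / N *
        (e (l + 1) ^ 2 * (e m + e n) + e (l + 1) * (e m + e n) ^ 2) := by
  have hR : 0 ≤ ρmax := hρmin.le.trans hle
  have hb : 0 ≤ b := ha.trans hab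
  have hκ : 0 ≤ κ := zero_le_one.trans H.one_le
  have hC := trilinearConst_nonneg d hκ hR
  set Ct := trilinearConst d κ ρmax
  set δ := T / (N : ℝ)
  have hum := S.isVelocity hm
  have hun := S.isVelocity (hnm.trans hm)
  set w := u m - u n with hwdef
  have hw : M.IsVelocity w := hum.sub hun
  have hdivm : ∀ k, 0 < k → k ≤ N → ∀ K ∈ M.cells, M.div (u k) K = 0 := by
    intro k hk hkN
    obtain ⟨k, rfl⟩ := Nat.exists_eq_succ_of_ne_zero hk.ne'
    exact S.divergence_free k hkN
  have hdiv : ∀ K ∈ M.cells, M.div w K = 0 := fun K hK =>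
    div_sub (hdivm m (hn.trans_le hnm) hm K hK) (hdivm n hn (hnm.trans hm) K hK)
  have sw := hw.hasFiniteSupport
  have sum' := hum.hasFiniteSupport
  set g := e m + e n with hg
  have hpos : ∀ l, 0 ≤ M.h1Norm (u l) := fun l => M.h1Norm_nonneg _
  have hEe : ∀ l, M.h1Norm (u l) ≤ e l := fun l => by
    rw [he]
    have := Real.sqrt_nonneg
      (M.inner (M.projFaces (f (l * δ))) (M.projFaces (f (l * δ))))
    linarith
  have he1 : ∀ l, 1 ≤ e l := fun l => by
    rw [he]
    have := Real.sqrt_nonneg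
      (M.inner (M.projFaces (f (l * δ))) (M.projFaces (f (l * δ))))
    have := hpos l
    linarith
  have hg1 : 1 ≤ g := by
    have := he1 m
    have := he1 n
    linarith
  have hEw : M.h1Norm w ≤ 2 * g := by
    have := M.h1Norm_sub_le (u m) (u n)
    have := hEe m
    have := hEe n
    linarith
  have hEw0 := M.h1Norm_nonneg w
  have hEm : M.h1Norm (u m) ≤ g := by
    have := hEe m
    have := he1 n
    linarith
  -- the increments of the momentum and of the mass, tested with `w` and `u m * w`
  set Φ : ℕ → ℝ := fun l => ∑ i, ∑' K, M.dualMass (ρ l) i K * u l i K * w i K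
  set Θ : ℕ → ℝ := fun l => ∑ i, ∑' K, M.dualMass (ρ l) i K * (u m i K * w i K)
  have hΦ : ∀ l, l < N → Φ (l + 1) - Φ l = δ * (M.convForm (ρ (l + 1)) (u (l + 1)) (u (l + 1)) w
        - M.diffusion μ (ρ (l + 1)) (u (l + 1)) w
        + M.inner (M.projFaces (f ((l + 1 : ℕ) * δ))) w) := by
    intro l hl
    rw [← S.momentum_tested hδ hl hw hdiv, ← Finset.sum_sub_distrib]
    refine Finset.sum_congr rfl fun i _ => ?_
    have q := sw i
    rw [← Summable.tsum_sub (HasFiniteSupport.summable (by fun_prop (disch := simp)))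
      (HasFiniteSupport.summable (by fun_prop (disch := simp)))]
    simp only [sub_mul]
  have hΘ : ∀ l, l < N → Θ (l + 1) - Θ l = δ * ((∑ i, ∑ j, ∑' K,
        M.dualFlux (ρ (l + 1)) (u (l + 1)) i j K * (u m i K * (w i K - w i (K - unitIdx j))))
      + ∑ i, ∑ j, ∑' K, M.dualFlux (ρ (l + 1)) (u (l + 1)) i j K *
        (w i (K - unitIdx j) * (u m i K - u m i (K - unitIdx j)))) := by
    intro l hl
    rw [← Finset.sum_sub_distrib, ← Finset.sum_add_distrib, Finset.mul_sum]
    refine Finset.sum_congr rfl fun i _ => ?_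
    have q := sw i
    have q' := sum' i
    rw [← Summable.tsum_sub (HasFiniteSupport.summable (by fun_prop (disch := simp)))
      (HasFiniteSupport.summable (by fun_prop (disch := simp)))]
    simp only [← sub_mul]
    rw [tsum_dualMass_balance (S.velocity l hl) hδ (S.mass l hl) i (z := fun K => u m i K * w i K)
      (by fun_prop (disch := simp)), ← Finset.sum_add_distrib]
    congr 1
    refine Finset.sum_congr rfl fun j _ => ?_
    rw [← Summable.tsum_add (HasFiniteSupport.summable (by fun_prop (disch := simp)))
      (HasFiniteSupport.summable (by fun_prop (disch := simp)))]
    congr 1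
    ext K
    ring
  -- pointwise `ρ n * w ^ 2 = (ρ m * u m - ρ n * u n) * w - (ρ m - ρ n) * (u m * w)`
  have hstart : ρmin * M.inner w w ≤ (Φ m - Φ n) - (Θ m - Θ n) := by
    have h1 := (energy_bounds (hρ n (hnm.trans hm)) hw).1
    refine h1.trans (le_of_eq ?_)
    simp only [energy, Φ, Θ]
    simp only [← Finset.sum_sub_distrib]
    refine Finset.sum_congr rfl fun i _ => ?_
    have q := sw i
    rw [← Summable.tsum_sub (HasFiniteSupport.summable (by fun_prop (disch := simp)))
      (HasFiniteSupport.summable (by fun_prop (disch := simp))),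
      ← Summable.tsum_sub (HasFiniteSupport.summable (by fun_prop (disch := simp)))
      (HasFiniteSupport.summable (by fun_prop (disch := simp))),
      ← Summable.tsum_sub (HasFiniteSupport.summable (by fun_prop (disch := simp)))
      (HasFiniteSupport.summable (by fun_prop (disch := simp)))]
    congr 1
    ext K
    simp only [hwdef, Pi.sub_apply]
    ring
  have htel : (Φ m - Φ n) - (Θ m - Θ n) =
      ∑ l ∈ Finset.Ico n m, ((Φ (l + 1) - Φ l) - (Θ (l + 1) - Θ l)) := by
    rw [Finset.sum_sub_distrib, Finset.sum_Ico_sub _ hnm, Finset.sum_Ico_sub _ hnm]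
  rw [htel] at hstart
  refine hstart.trans ?_
  rw [Finset.mul_sum]
  refine Finset.sum_le_sum fun l hl => ?_
  have hlN : l < N := (Finset.mem_Ico.mp hl).2.trans_le hm
  rw [hΦ l hlN, hΘ l hlN, ← mul_sub, mul_left_comm]
  refine mul_le_mul_of_nonneg_left ?_ hδ.le
  have hul := S.velocity l hlN
  have hρl : ∀ K ∈ M.cells, 0 ≤ ρ (l + 1) K ∧ ρ (l + 1) K ≤ ρmax := fun K hK =>
    ⟨hρmin.le.trans (hρ (l + 1) hlN K hK).1, (hρ (l + 1) hlN K hK).2⟩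
  set v := u (l + 1)
  have t1 := H.abs_sum_tsum_dualFlux_le hd hR hρl hul hul hw
    (s := fun i j => M.velUp (ρ (l + 1)) v v i j) fun i j K => by
      unfold velUp
      split_ifs
      · linarith [abs_nonneg (v i K)]
      · linarith [abs_nonneg (v i (K - unitIdx j))]
  have t2 := H.abs_sum_tsum_dualFlux_le hd hR hρl hul hum hw
    (s := fun i _ => u m i) fun i j K => by linarith [abs_nonneg (u m i (K - unitIdx j))]
  have t3 := H.abs_sum_tsum_dualFlux_le hd hR hρl hul hw hum
    (s := fun i j K => w i (K - unitIdx j)) fun i j K => by linarith [abs_nonneg (w i K)]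
  have t4 := abs_diffusion_le (u := v) (v := w) (μ := μ) (ρ := ρ (l + 1)) ha
    fun K hK => hμ _ (hρ (l + 1) hlN K hK)
  have t5 := M.inner_le (M.projFaces (f ((l + 1 : ℕ) * δ))) w one_pos
  set ε := e (l + 1)
  have hε1 : 1 ≤ ε := he1 _
  have hEv : M.h1Norm v ≤ ε := hEe _
  have hEv0 : 0 ≤ M.h1Norm v := hpos _
  have hφ : M.inner (M.projFaces (f ((l + 1 : ℕ) * δ))) (M.projFaces (f ((l + 1 : ℕ) * δ))) ≤
      ε ^ 2 := by
    rw [← Real.sqrt_le_left (by linarith)]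
    simp only [ε, he (l + 1)]
    have := hpos (l + 1)
    linarith
  have hww : M.inner w w ≤ (2 * g) ^ 2 := by
    have h1 := M.gradSq_nonneg w
    have h2 := M.h1Norm_sq w
    rw [h1Sq] at h2
    nlinarith
  have hgv : M.gradSq v ≤ ε ^ 2 := by
    have h1 := M.inner_self_nonneg v
    have h2 := M.h1Norm_sq v
    rw [h1Sq] at h2
    nlinarith
  have hgw : M.gradSq w ≤ (2 * g) ^ 2 := by
    have h1 := M.inner_self_nonneg w
    have h2 := M.h1Norm_sq w
    rw [h1Sq] at h2
    nlinarith
  have q1 : M.h1Norm v * M.h1Norm v * M.h1Norm w ≤ ε * ε * (2 * g) := by gcongr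
  have q2 : M.h1Norm v * M.h1Norm (u m) * M.h1Norm w ≤ ε * g * (2 * g) := by
    have := hpos m
    gcongr
  have q3 : M.h1Norm v * M.h1Norm w * M.h1Norm (u m) ≤ ε * (2 * g) * g := by
    have := hpos m
    gcongr
  have t1' := (abs_le.mp t1).2.trans (mul_le_mul_of_nonneg_left q1 hC)
  have t2' := neg_le_of_abs_le (t2.trans (mul_le_mul_of_nonneg_left q2 hC))
  have t3' := neg_le_of_abs_le (t3.trans (mul_le_mul_of_nonneg_left q3 hC))
  have t4' := neg_le_of_abs_le (t4.trans (mul_le_mul_of_nonneg_left (add_le_add hgv hgw) hb))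
  have x1 : ε ^ 2 ≤ ε ^ 2 * g := le_mul_of_one_le_right (by positivity) hg1
  have x2 : g ^ 2 ≤ ε * g ^ 2 := le_mul_of_one_le_left (by positivity) hε1
  have x3 : b * (ε ^ 2 + (2 * g) ^ 2) ≤ b * (4 * (ε ^ 2 * g + ε * g ^ 2)) := by
    refine mul_le_mul_of_nonneg_left ?_ hb
    have : 0 ≤ ε ^ 2 * g := by positivity
    linarith
  have x4 : 0 ≤ Ct * (ε ^ 2 * g) := by positivity
  have x5 : 0 ≤ Ct * (ε * g ^ 2) := by positivity
  have x6 : 0 ≤ ε ^ 2 * g := by positivity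
  have x7 : 0 ≤ ε * g ^ 2 := by positivity
  unfold convForm
  rw [div_one, one_mul] at t5
  linarith only [t1', t2', t3', t4', t5, hφ, hww, x1, x2, x3, x4, x5, x6, x7]

end IsSolution

end MACGrid

/-! ### Measures of the cells, projections and the norm of the velocity function -/

open MeasureTheory in
theorem volume_Icc_inter_Icc_eq_zero {ι : Type*} [Fintype ι] {a b a' b' : ι → ℝ} {j : ι}
    (h : b j ≤ a' j) : volume (Set.Icc a b ∩ Set.Icc a' b') = 0 := by
  rw [Set.Icc_inter_Icc, Real.volume_Icc_pi]
  refine Finset.prod_eq_zero (Finset.mem_univ j) (ENNReal.ofReal_of_nonpos ?_)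
  simp only [Pi.inf_apply, Pi.sup_apply]
  linarith [min_le_left (b j) (b' j), le_max_right (a j) (a' j)]

namespace MACGrid

open MeasureTheory Function

variable {d : ℕ} {M : MACGrid d}

theorem mid_mono (M : MACGrid d) (i : Fin d) : Monotone (M.mid i) := fun m n h => by
  have h1 := (M.strictMono_x i).monotone h
  have h2 := (M.strictMono_x i).monotone (add_le_add_left h 1)
  unfold mid
  linarith

theorem volume_cell (M : MACGrid d) (K : Fin d → ℤ) :
    volume (M.cell K) = ENNReal.ofReal (M.vol K) := by
  rw [cell, Real.volume_Icc_pi, vol, ENNReal.ofReal_prod_of_nonneg fun i _ => (M.width_pos i _).le]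
  rfl

theorem volume_dualCell (M : MACGrid d) (i : Fin d) (K : Fin d → ℤ) :
    volume (M.dualCell i K) = ENNReal.ofReal (M.dualVol i K) := by
  have h : M.dualVol i K = (M.mid i (K i) - M.mid i (K i - 1)) * M.area i K := by
    rw [dualVol, M.vol_eq i, M.vol_eq i, area_sub]
    simp only [mid, width, unitIdx, Pi.sub_apply, Pi.single_eq_same, sub_add_cancel]
    ring
  rw [h, dualCell, Real.volume_Icc_pi, ← ENNReal.ofReal_prod_of_nonneg, ←
    Finset.mul_prod_erase _ _ (Finset.mem_univ i)]
  · congr 2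
    · simp
    · refine Finset.prod_congr rfl fun j hj => ?_
      simp [Finset.ne_of_mem_erase hj, width]
  · intro j _
    split_ifs
    · subst_vars
      exact sub_nonneg.mpr (M.mid_mono _ (by omega))
    · exact (M.width_pos j _).le

theorem volume_real_dualCell (M : MACGrid d) (i : Fin d) (K : Fin d → ℤ) :
    volume.real (M.dualCell i K) = M.dualVol i K := by
  rw [measureReal_def, volume_dualCell, ENNReal.toReal_ofReal (M.dualVol_pos i K).le]

theorem volume_dualCell_inter (M : MACGrid d) (i : Fin d) {K L : Fin d → ℤ} (h : K ≠ L) :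
    volume (M.dualCell i K ∩ M.dualCell i L) = 0 := by
  obtain ⟨j, hj⟩ := Function.ne_iff.mp h
  have key : ∀ {K L : Fin d → ℤ}, K j < L j → volume (M.dualCell i K ∩ M.dualCell i L) = 0 := by
    intro K L hlt
    refine volume_Icc_inter_Icc_eq_zero (j := j) ?_
    split_ifs with hji
    · subst hji
      exact M.mid_mono _ (by omega)
    · exact (M.strictMono_x j).monotone (by omega)
  rcases lt_or_gt_of_ne hj with hlt | hlt
  · exact key hlt
  · rw [Set.inter_comm]
    exact key hlt

theorem measurableSet_dualCell (M : MACGrid d) (i : Fin d) (K : Fin d → ℤ) :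
    MeasurableSet (M.dualCell i K) := measurableSet_Icc

/-- The interior of a cell lies in `Ω`, and its boundary is a null set. -/
theorem IsMeshOf.cell_ae_le {Ω : Set (Fin d → ℝ)} (hM : M.IsMeshOf Ω) {K : Fin d → ℤ}
    (hK : K ∈ M.cells) : M.cell K ≤ᵐ[volume] Ω := by
  rw [ae_le_set]
  refine measure_mono_null ?_ ((convex_Icc (fun i => M.x i (K i))
    fun i => M.x i (K i + 1)).addHaar_frontier volume)
  rintro y ⟨hy, hy'⟩
  refine ⟨subset_closure hy, fun hint => hy' ?_⟩
  rw [show Ω = _ from hM]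
  exact interior_mono (Set.subset_biUnion_of_mem (u := fun K => M.cell K) hK) hint

theorem dualCell_subset (M : MACGrid d) (i : Fin d) (K : Fin d → ℤ) :
    M.dualCell i K ⊆ M.cell (K - unitIdx i) ∪ M.cell K := by
  intro y hy
  have hlo := hy.1
  have hhi := hy.2
  have hj : ∀ j, j ≠ i → M.x j (K j) ≤ y j ∧ y j ≤ M.x j (K j + 1) := fun j hji => by
    have h1 := hlo j
    have h2 := hhi j
    simp only [hji, if_false] at h1 h2
    exact ⟨h1, h2⟩
  have hi1 := hlo i
  have hi2 := hhi i
  simp only [if_true, mid, sub_add_cancel] at hi1 hi2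
  have hx1 := M.strictMono_x i (sub_one_lt (K i))
  have hx2 := M.strictMono_x i (lt_add_one (K i))
  rcases le_total (y i) (M.x i (K i)) with h | h
  · refine Or.inl ⟨fun j => ?_, fun j => ?_⟩ <;> rcases eq_or_ne j i with rfl | hji
    · simp only [unitIdx, Pi.sub_apply, Pi.single_eq_same]
      linarith
    · simpa [unitIdx, hji] using (hj j hji).1
    · simp only [unitIdx, Pi.sub_apply, Pi.single_eq_same, sub_add_cancel]
      linarith
    · simpa [unitIdx, hji] using (hj j hji).2
  · refine Or.inr ⟨fun j => ?_, fun j => ?_⟩ <;> rcases eq_or_ne j i with rfl | hji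
    · exact h
    · exact (hj j hji).1
    · dsimp only
      linarith
    · exact (hj j hji).2

theorem IsMeshOf.dualCell_ae_le {Ω : Set (Fin d → ℝ)} (hM : M.IsMeshOf Ω) {i : Fin d}
    {K : Fin d → ℤ} (hK : K ∈ M.intFaces i) : M.dualCell i K ≤ᵐ[volume] Ω := by
  obtain ⟨h1, h2⟩ := mem_intFaces.mp hK
  have h3 := hM.cell_ae_le h1
  have h4 := hM.cell_ae_le h2
  filter_upwards [h3, h4] with y hy1 hy2 hy
  rcases M.dualCell_subset i K hy with h | h
  · exact hy2 h
  · exact hy1 h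

theorem IsMeshOf.projCells_mem {Ω : Set (Fin d → ℝ)} (hM : M.IsMeshOf Ω) {q : (Fin d → ℝ) → ℝ}
    {a b : ℝ} (hq : MemLp q ⊤ (volume.restrict Ω))
    (hab : ∀ᵐ y ∂volume.restrict Ω, a ≤ q y ∧ q y ≤ b) {K : Fin d → ℤ} (hK : K ∈ M.cells) :
    a ≤ M.projCells q K ∧ M.projCells q K ≤ b := by
  have hle : volume.restrict (M.cell K) ≤ volume.restrict Ω :=
    Measure.restrict_mono_ae (hM.cell_ae_le hK)
  have : IsFiniteMeasure (volume.restrict (M.cell K)) := ⟨by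
    rw [Measure.restrict_apply_univ, volume_cell]
    exact ENNReal.ofReal_lt_top⟩
  have hint : Integrable q (volume.restrict (M.cell K)) := (hq.mono_measure hle).integrable le_top
  have hae : ∀ᵐ y ∂volume.restrict (M.cell K), a ≤ q y ∧ q y ≤ b := ae_mono hle hab
  have hvol : volume.real (M.cell K) = M.vol K := by
    rw [measureReal_def, volume_cell, ENNReal.toReal_ofReal (M.vol_pos K).le]
  have hc : ∀ c : ℝ, ∫ _y in M.cell K, c = c * M.vol K := fun c => by
    rw [setIntegral_const, hvol, smul_eq_mul, mul_comm]
  rw [projCells, le_div_iff₀ (M.vol_pos K), div_le_iff₀ (M.vol_pos K), ← hc, ← hc]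
  exact ⟨integral_mono_ae (integrable_const _) hint (hae.mono fun y hy => hy.1),
    integral_mono_ae hint (integrable_const _) (hae.mono fun y hy => hy.2)⟩

/-- The projection on the discrete velocities is a contraction in `L²`. -/
theorem IsMeshOf.inner_projFaces_le {Ω : Set (Fin d → ℝ)} (hM : M.IsMeshOf Ω)
    {v : Fin d → (Fin d → ℝ) → ℝ} (hv : ∀ i, MemLp (v i) 2 (volume.restrict Ω)) :
    M.inner (M.projFaces v) (M.projFaces v) ≤ ∑ i, ∫ y in Ω, v i y ^ 2 := by
  refine Finset.sum_le_sum fun i _ => ?_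
  have hle : ∀ K ∈ M.intFaces i, volume.restrict (M.dualCell i K) ≤ volume.restrict Ω :=
    fun K hK => Measure.restrict_mono_ae (hM.dualCell_ae_le hK)
  have hsq := (hv i).integrable_sq
  -- on each dual cell, by the nonnegativity of the variance
  have h1 : ∀ K ∈ M.intFaces i, M.dualVol i K * M.projFaces v i K * M.projFaces v i K ≤
      ∫ y in M.dualCell i K, v i y ^ 2 := by
    intro K hK
    have : IsFiniteMeasure (volume.restrict (M.dualCell i K)) := ⟨by
      rw [Measure.restrict_apply_univ, volume_dualCell]
      exact ENNReal.ofReal_lt_top⟩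
    have hint : Integrable (v i) (volume.restrict (M.dualCell i K)) :=
      ((hv i).mono_measure (hle K hK)).integrable one_le_two
    have hint2 : Integrable (fun y => v i y ^ 2) (volume.restrict (M.dualCell i K)) :=
      hsq.mono_measure (hle K hK)
    rw [projFaces, if_pos hK]
    set m := (∫ y in M.dualCell i K, v i y) / M.dualVol i K with hm
    have hmean : ∫ y in M.dualCell i K, v i y = m * M.dualVol i K := by
      rw [hm, div_mul_cancel₀ _ (M.dualVol_pos i K).ne']
    have h2 : 0 ≤ ∫ y in M.dualCell i K, (v i y ^ 2 - (2 * m * v i y - m ^ 2)) := by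
      refine integral_nonneg fun y => ?_
      simp only [Pi.zero_apply]
      nlinarith [sq_nonneg (v i y - m)]
    have hint3 : Integrable (fun y => 2 * m * v i y - m ^ 2)
        (volume.restrict (M.dualCell i K)) := (hint.const_mul _).sub (integrable_const _)
    rw [integral_sub hint2 hint3,
      integral_sub (hint.const_mul _) (integrable_const _), integral_const_mul, hmean,
      setIntegral_const, volume_real_dualCell, smul_eq_mul] at h2
    linarith
  refine (Finset.sum_le_sum h1).trans ?_
  -- the half-open dual cells are disjoint
  set B : (Fin d → ℤ) → Set (Fin d → ℝ) := fun K => Set.univ.pi fun j =>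
    Set.Ico (if j = i then M.mid i (K i - 1) else M.x j (K j))
      (if j = i then M.mid i (K i) else M.x j (K j + 1)) with hB
  have hBae : ∀ K, B K =ᵐ[volume] M.dualCell i K := fun K => Measure.univ_pi_Ico_ae_eq_Icc
  have hdisj : Pairwise (Disjoint on B) := by
    intro K L hKL
    obtain ⟨j, hj⟩ := Function.ne_iff.mp hKL
    have key : ∀ {K L : Fin d → ℤ}, K j < L j → Disjoint (B K) (B L) := by
      intro K L hlt
      refine Set.disjoint_left.mpr fun y hy1 hy2 => ?_
      have h1 := (hy1 j (Set.mem_univ j)).2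
      have h2 := (hy2 j (Set.mem_univ j)).1
      refine absurd (h1.trans_le (le_trans ?_ h2)) (lt_irrefl _)
      split_ifs with hji
      · exact M.mid_mono _ (by subst hji; omega)
      · exact (M.strictMono_x j).monotone (by omega)
    rcases lt_or_gt_of_ne hj with hlt | hlt
    · exact key hlt
    · exact (key hlt).symm
  have hBΩ : ∀ K ∈ M.intFaces i, B K ≤ᵐ[volume] Ω := fun K hK =>
    (hBae K).le.trans (hM.dualCell_ae_le hK)
  have hU : (⋃ K ∈ M.intFaces i, B K) ≤ᵐ[volume] Ω := by
    have h3 := (Finset.eventually_all (M.intFaces i)).mpr hBΩ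
    filter_upwards [h3] with y hy hyU
    obtain ⟨K, hK, hyK⟩ := Set.mem_iUnion₂.mp hyU
    exact hy K hK hyK
  calc ∑ K ∈ M.intFaces i, ∫ y in M.dualCell i K, v i y ^ 2
      = ∑ K ∈ M.intFaces i, ∫ y in B K, v i y ^ 2 :=
        Finset.sum_congr rfl fun K _ => (setIntegral_congr_set (hBae K)).symm
    _ = ∫ y in ⋃ K ∈ M.intFaces i, B K, v i y ^ 2 := by
        refine (integral_biUnion_finset _ (fun K _ => ?_) (fun K _ L _ h => hdisj h)
          fun K hK => ?_).symm
        · exact MeasurableSet.univ_pi fun j => measurableSet_Ico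
        · exact hsq.mono_measure (Measure.restrict_mono_ae (hBΩ K hK))
    _ ≤ _ := setIntegral_mono_set hsq (Filter.Eventually.of_forall fun y => sq_nonneg _) hU

theorem velocityFn_eq {N : ℕ} {T : ℝ} (hδ : 0 < T / N) (u : ℕ → Fin d → (Fin d → ℤ) → ℝ)
    (i : Fin d) {k : ℕ} (hk : k < N) {t : ℝ}
    (ht : t ∈ Set.Ioc (k * (T / N)) ((k + 1 : ℕ) * (T / N))) (y : Fin d → ℝ) :
    M.velocityFn N T u i t y =
      ∑ K ∈ M.intFaces i, u (k + 1) i K * (M.dualCell i K).indicator 1 y := by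
  rw [velocityFn, Finset.sum_eq_single k]
  · refine Finset.sum_congr rfl fun K _ => ?_
    rw [Set.indicator_of_mem ht, Pi.one_apply, mul_one]
  · intro n _ hnk
    refine Finset.sum_eq_zero fun K _ => ?_
    have hn : t ∉ Set.Ioc (n * (T / N)) ((n + 1 : ℕ) * (T / N)) := by
      intro hn
      rcases lt_or_gt_of_ne hnk with h | h
      · have h1 : ((n + 1 : ℕ) : ℝ) ≤ k := by exact_mod_cast h
        have h2 := mul_le_mul_of_nonneg_right h1 hδ.le
        exact absurd (ht.1.trans_le (hn.2.trans h2)) (lt_irrefl _)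
      · have h1 : ((k + 1 : ℕ) : ℝ) ≤ n := by exact_mod_cast h
        have h2 := mul_le_mul_of_nonneg_right h1 hδ.le
        exact absurd (hn.1.trans_le (ht.2.trans h2)) (lt_irrefl _)
    rw [Set.indicator_of_notMem hn, mul_zero]
  · intro h
    exact absurd (Finset.mem_range.mpr hk) h

/-- The discrete norm bounds the `L²` norm of the piecewise constant function: the dual cells of
one component overlap only in null sets. -/
theorem integral_sum_indicator_sq_le (M : MACGrid d) (Ω : Set (Fin d → ℝ))
    (w : Fin d → (Fin d → ℤ) → ℝ) :
    ∫ y in Ω, ∑ i, (∑ K ∈ M.intFaces i, w i K * (M.dualCell i K).indicator 1 y) ^ 2 ≤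
      M.inner w w := by
  have hind : ∀ i (K L : Fin d → ℤ) (y : Fin d → ℝ),
      w i K * (M.dualCell i K).indicator 1 y * (w i L * (M.dualCell i L).indicator 1 y) =
        (M.dualCell i K ∩ M.dualCell i L).indicator (fun _ => w i K * w i L) y := by
    intro i K L y
    by_cases h1 : y ∈ M.dualCell i K <;> by_cases h2 : y ∈ M.dualCell i L <;> simp [h1, h2]
  have hmeas : ∀ i (K L : Fin d → ℤ), MeasurableSet (M.dualCell i K ∩ M.dualCell i L) :=
    fun i K L => (M.measurableSet_dualCell i K).inter (M.measurableSet_dualCell i L)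
  have hfin : ∀ i (K L : Fin d → ℤ),
      volume.restrict Ω (M.dualCell i K ∩ M.dualCell i L) ≠ ⊤ := fun i K L => by
    refine ((Measure.restrict_le_self _).trans_lt
      ((measure_mono Set.inter_subset_left).trans_lt ?_)).ne
    rw [volume_dualCell]
    exact ENNReal.ofReal_lt_top
  have hintg : ∀ i (K L : Fin d → ℤ), Integrable ((M.dualCell i K ∩ M.dualCell i L).indicator
      fun _ => w i K * w i L) (volume.restrict Ω) := fun i K L =>
    (integrable_indicator_iff (hmeas i K L)).mpr (integrableOn_const (hfin i K L))
  simp only [sq, Finset.sum_mul_sum, hind]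
  rw [integral_finsetSum _ fun i _ => integrable_finsetSum _ fun K _ =>
    integrable_finsetSum _ fun L _ => hintg i K L]
  refine Finset.sum_le_sum fun i _ => ?_
  rw [integral_finsetSum _ fun K _ => integrable_finsetSum _ fun L _ => hintg i K L]
  refine Finset.sum_le_sum fun K hK => ?_
  rw [integral_finsetSum _ fun L _ => hintg i K L, Finset.sum_eq_single K]
  · rw [integral_indicator_const _ (hmeas i K K), Set.inter_self, smul_eq_mul, mul_assoc]
    refine mul_le_mul_of_nonneg_right ?_ (mul_self_nonneg _)
    rw [← volume_real_dualCell]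
    refine ENNReal.toReal_mono ?_ (Measure.restrict_le_self _)
    rw [volume_dualCell]
    exact ENNReal.ofReal_ne_top
  · intro L _ hLK
    have h0 : (volume.restrict Ω).real (M.dualCell i K ∩ M.dualCell i L) = 0 := by
      rw [measureReal_def, le_antisymm ((Measure.restrict_le_self _).trans
        (M.volume_dualCell_inter i hLK.symm).le) zero_le, ENNReal.toReal_zero]
    rw [integral_indicator_const _ (hmeas i K L), h0, zero_smul]
  · exact fun h => absurd hK h

end MACGrid

/-! ### Time translates of step functions -/

section TimeTranslates

open MeasureTheory

variable {δ : ℝ} {N : ℕ}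

/-- `⌈t / δ⌉₊` is the index of the time step that contains `t`. -/
theorem mem_Ioc_ceil (hδ : 0 < δ) {t : ℝ} (ht : 0 < t) :
    t ∈ Set.Ioc (((⌈t / δ⌉₊ - 1 : ℕ) : ℝ) * δ) ((⌈t / δ⌉₊ : ℝ) * δ) := by
  have h1 : 0 < ⌈t / δ⌉₊ := Nat.ceil_pos.mpr (div_pos ht hδ)
  refine ⟨?_, (div_le_iff₀ hδ).mp (Nat.le_ceil _)⟩
  rw [← lt_div_iff₀ hδ]
  exact Nat.lt_ceil.mp (Nat.sub_lt h1 one_pos)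

theorem ceil_div_le (hδ : 0 < δ) {t : ℝ} (ht : t ≤ N * δ) : ⌈t / δ⌉₊ ≤ N :=
  Nat.ceil_le.mpr ((div_le_iff₀ hδ).mpr ht)

theorem ceil_div_eq (hδ : 0 < δ) {n : ℕ} {t : ℝ}
    (ht : t ∈ Set.Ioc ((n : ℝ) * δ) ((n + 1 : ℕ) * δ)) : ⌈t / δ⌉₊ = n + 1 := by
  rw [Nat.ceil_eq_iff (Nat.succ_ne_zero n)]
  exact ⟨by simpa using (lt_div_iff₀ hδ).mpr ht.1, (div_le_iff₀ hδ).mpr ht.2⟩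

/-- The integral of a function that is constant on the time steps. -/
theorem integral_step (hδ : 0 < δ) (φ : ℕ → ℝ) :
    ∫ t in (0 : ℝ)..N * δ, φ ⌈t / δ⌉₊ = ∑ n ∈ Finset.range N, δ * φ (n + 1) := by
  have hcongr : ∀ n : ℕ, Set.EqOn (fun _ : ℝ => φ (n + 1)) (fun t => φ ⌈t / δ⌉₊)
      (Set.uIoc ((n : ℝ) * δ) ((n + 1 : ℕ) * δ)) := fun n t ht => by
    rw [Set.uIoc_of_le (by push_cast; nlinarith)] at ht
    simp only [ceil_div_eq hδ ht]
  have h := intervalIntegral.sum_integral_adjacent_intervals (μ := volume)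
    (f := fun t : ℝ => φ ⌈t / δ⌉₊) (a := fun n : ℕ => (n : ℝ) * δ) (n := N) fun n _ =>
      (intervalIntegrable_const (c := φ (n + 1))).congr (hcongr n)
  simp only [Nat.cast_zero, zero_mul] at h
  rw [← h]
  refine Finset.sum_congr rfl fun n _ => ?_
  rw [← intervalIntegral.integral_congr_ae (Filter.Eventually.of_forall fun t ht => hcongr n ht),
    intervalIntegral.integral_const, smul_eq_mul]
  push_cast
  ring

theorem integrableOn_step (hδ : 0 < δ) {τ : ℝ} (hτ : 0 ≤ τ) (Φ : ℕ → ℕ → ℝ) :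
    IntegrableOn (fun t => Φ ⌈t / δ⌉₊ ⌈(t + τ) / δ⌉₊) (Set.Ioc 0 (N * δ - τ)) := by
  have hmeas : Measurable fun t : ℝ => Φ ⌈t / δ⌉₊ ⌈(t + τ) / δ⌉₊ := by
    have h1 : Measurable fun p : ℕ × ℕ => Φ p.1 p.2 := measurable_of_countable _
    have h2 : Measurable fun t : ℝ => (⌈t / δ⌉₊, ⌈(t + τ) / δ⌉₊) := by fun_prop
    exact h1.comp h2
  refine Measure.integrableOn_of_bounded (M := ∑ n ∈ Finset.range (N + 1),
    ∑ m ∈ Finset.range (N + 1), |Φ n m|) ?_ hmeas.aestronglyMeasurable ?_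
  · rw [Real.volume_Ioc]
    exact ENNReal.ofReal_ne_top
  · refine (ae_restrict_iff' measurableSet_Ioc).mpr (Filter.Eventually.of_forall fun t ht => ?_)
    have h1 : ⌈t / δ⌉₊ ∈ Finset.range (N + 1) :=
      Finset.mem_range.mpr (Nat.lt_succ_of_le (ceil_div_le hδ (by linarith [ht.2])))
    have h2 : ⌈(t + τ) / δ⌉₊ ∈ Finset.range (N + 1) :=
      Finset.mem_range.mpr (Nat.lt_succ_of_le (ceil_div_le hδ (by linarith [ht.2])))
    rw [Real.norm_eq_abs]
    exact (Finset.single_le_sum (f := fun m => |Φ ⌈t / δ⌉₊ m|) (fun _ _ => abs_nonneg _) h2).trans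
      (Finset.single_le_sum (f := fun n => ∑ m ∈ Finset.range (N + 1), |Φ n m|)
        (fun _ _ => Finset.sum_nonneg fun _ _ => abs_nonneg _) h1)

/-- The estimate behind the time translates. In the first kind of terms the square summable
factor `e (l + 1) ^ 2` is integrated last, and each `l` is seen on a set of times of measure `τ`;
in the second kind the sum over `l` is bounded by the Cauchy-Schwarz inequality. -/
theorem integral_translate_le (hδ : 0 < δ) {τ : ℝ} (hτ : 0 < τ) (hτN : τ < N * δ) {e : ℕ → ℝ}
    (he : ∀ n, 0 ≤ e n) {B : ℝ} (hB : ∑ n ∈ Finset.range N, δ * e (n + 1) ^ 2 ≤ B) :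
    ∫ t in Set.Ioc 0 (N * δ - τ), ∑ l ∈ Finset.Ico ⌈t / δ⌉₊ ⌈(t + τ) / δ⌉₊, δ *
      (e (l + 1) ^ 2 * (e ⌈(t + τ) / δ⌉₊ + e ⌈t / δ⌉₊) +
        e (l + 1) * (e ⌈(t + τ) / δ⌉₊ + e ⌈t / δ⌉₊) ^ 2) ≤
      (2 * B ^ 2 + B / 2 + 4 * B * √B) * √(τ + δ) := by
  have hB0 : 0 ≤ B := le_trans (Finset.sum_nonneg fun n _ => mul_nonneg hδ.le (sq_nonneg _)) hB
  set D := Set.Ioc 0 (N * δ - τ)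
  set Q : ℝ → ℝ := fun t => e ⌈(t + τ) / δ⌉₊ ^ 2 + e ⌈t / δ⌉₊ ^ 2 with hQdef
  have hQ0 : ∀ t, 0 ≤ Q t := fun t => by positivity
  set χ : ℕ → ℝ → ℝ := fun l => (Set.Ioc (l * δ - τ) (l * δ)).indicator fun _ => 1 with hχdef
  have hχ0 : ∀ l t, 0 ≤ χ l t := fun l t => Set.indicator_nonneg (fun _ _ => zero_le_one) t
  set s := √τ with hs
  have hs0 : 0 < s := Real.sqrt_pos.mpr hτ
  have hss : s * s = τ := Real.mul_self_sqrt hτ.le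
  have hsle : s ≤ √(τ + δ) := Real.sqrt_le_sqrt (by linarith)
  -- the integral of `Q`
  have hstep := integral_step (N := N) hδ fun n => e n ^ 2
  have hfull : IntervalIntegrable (fun t => e ⌈t / δ⌉₊ ^ 2) volume 0 (N * δ) := by
    rw [intervalIntegrable_iff_integrableOn_Ioc_of_le (by positivity)]
    simpa using integrableOn_step (N := N) hδ le_rfl fun n _ => e n ^ 2
  have hQint : IntegrableOn Q D := integrableOn_step hδ hτ.le fun n m => e m ^ 2 + e n ^ 2
  have hQ1 : ∫ t in D, e ⌈t / δ⌉₊ ^ 2 ≤ B := by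
    refine le_trans ?_ (hstep.le.trans hB)
    rw [intervalIntegral.integral_of_le (by positivity)]
    refine setIntegral_mono_set ?_ (Filter.Eventually.of_forall fun t => sq_nonneg _)
      (Filter.Eventually.of_forall fun t ht => ⟨ht.1, ht.2.trans (by linarith)⟩)
    exact (intervalIntegrable_iff_integrableOn_Ioc_of_le (by positivity)).mp hfull
  have hQ2 : ∫ t in D, e ⌈(t + τ) / δ⌉₊ ^ 2 ≤ B := by
    refine le_trans ?_ (hstep.le.trans hB)
    rw [← intervalIntegral.integral_of_le (by linarith),
      intervalIntegral.integral_comp_add_right (fun t => e ⌈t / δ⌉₊ ^ 2) τ, zero_add,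
      sub_add_cancel, intervalIntegral.integral_of_le hτN.le,
      intervalIntegral.integral_of_le (by positivity)]
    refine setIntegral_mono_set ?_ (Filter.Eventually.of_forall fun t => sq_nonneg _)
      (Filter.Eventually.of_forall fun t ht => ⟨hτ.trans ht.1, ht.2⟩)
    exact (intervalIntegrable_iff_integrableOn_Ioc_of_le (by positivity)).mp hfull
  have hQB : ∫ t in D, Q t ≤ 2 * B := by
    have h1 : IntegrableOn (fun t => e ⌈(t + τ) / δ⌉₊ ^ 2) D :=
      integrableOn_step hδ hτ.le fun _ m => e m ^ 2
    have h2 : IntegrableOn (fun t => e ⌈t / δ⌉₊ ^ 2) D :=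
      integrableOn_step hδ hτ.le fun n _ => e n ^ 2
    rw [hQdef, integral_add h1 h2]
    linarith
  -- `χ l` is the indicator of the times for which `l` may occur in the sum
  have hχint : ∀ l, Integrable (χ l) volume := fun l =>
    (integrable_indicator_iff measurableSet_Ioc).mpr (integrableOn_const (by
      rw [Real.volume_Ioc]
      exact ENNReal.ofReal_ne_top))
  have hχτ : ∀ l, ∫ t in D, χ l t ≤ τ := fun l => by
    refine (setIntegral_le_integral (hχint l) (Filter.Eventually.of_forall (hχ0 l))).trans ?_
    rw [hχdef]
    simp only
    rw [integral_indicator_const _ measurableSet_Ioc, Real.volume_real_Ioc, smul_eq_mul, mul_one]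
    simp [hτ.le]
  -- the pointwise bound
  have hpt : ∀ t ∈ D, ∑ l ∈ Finset.Ico ⌈t / δ⌉₊ ⌈(t + τ) / δ⌉₊, δ *
      (e (l + 1) ^ 2 * (e ⌈(t + τ) / δ⌉₊ + e ⌈t / δ⌉₊) +
        e (l + 1) * (e ⌈(t + τ) / δ⌉₊ + e ⌈t / δ⌉₊) ^ 2) ≤
      (B * s * Q t + ∑ l ∈ Finset.range N, δ * e (l + 1) ^ 2 / (2 * s) * χ l t) +
        2 * (√B * √(τ + δ)) * Q t := by
    intro t ht
    have ht0 : 0 < t + τ := by linarith [ht.1]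
    have hn := mem_Ioc_ceil hδ ht.1
    have hm := mem_Ioc_ceil hδ ht0
    have hmN : ⌈(t + τ) / δ⌉₊ ≤ N := ceil_div_le hδ (by linarith [ht.2])
    have hnm : ⌈t / δ⌉₊ ≤ ⌈(t + τ) / δ⌉₊ := Nat.ceil_mono (by gcongr; linarith)
    have hm1 : 0 < ⌈(t + τ) / δ⌉₊ := Nat.ceil_pos.mpr (div_pos ht0 hδ)
    set n := ⌈t / δ⌉₊
    set m := ⌈(t + τ) / δ⌉₊
    set g := e m + e n with hg
    have hg0 : 0 ≤ g := add_nonneg (he m) (he n)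
    have hgQ : g ^ 2 ≤ 2 * Q t := by
      simp only [hg, Q]
      nlinarith [sq_nonneg (e m - e n)]
    have hsub : Finset.Ico n m ⊆ Finset.range N := fun l hl =>
      Finset.mem_range.mpr ((Finset.mem_Ico.mp hl).2.trans_le hmN)
    have hchi : ∀ l ∈ Finset.Ico n m, χ l t = 1 := by
      intro l hl
      obtain ⟨h1, h2⟩ := Finset.mem_Ico.mp hl
      suffices hmem : t ∈ Set.Ioc ((l : ℝ) * δ - τ) (l * δ) from Set.indicator_of_mem hmem _
      refine ⟨?_, ?_⟩
      · have h3 : (l : ℝ) ≤ ((m - 1 : ℕ) : ℝ) := by exact_mod_cast Nat.le_sub_one_of_lt h2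
        have h4 := mul_le_mul_of_nonneg_right h3 hδ.le
        linarith [hm.1]
      · have h3 : (n : ℝ) ≤ l := by exact_mod_cast h1
        have h4 := mul_le_mul_of_nonneg_right h3 hδ.le
        linarith [hn.2]
    simp only [mul_add, Finset.sum_add_distrib]
    refine add_le_add ?_ ?_
    · have h1 : ∀ l ∈ Finset.Ico n m, δ * (e (l + 1) ^ 2 * g) ≤
          δ * e (l + 1) ^ 2 * (s * Q t + 1 / (2 * s) * χ l t) := by
        intro l hl
        rw [hchi l hl, ← mul_assoc]
        refine mul_le_mul_of_nonneg_left ?_ (mul_nonneg hδ.le (sq_nonneg _))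
        have h2 : g ≤ s * (g ^ 2 / 2) + 1 / (2 * s) * 1 := by
          -- the inequality of Young with the weight `s = √τ`
          have h3 : s * (g ^ 2 / 2) + 1 / (2 * s) * 1 - g = (s * g - 1) ^ 2 / (2 * s) := by
            field_simp
            ring
          have h4 : 0 ≤ (s * g - 1) ^ 2 / (2 * s) := by positivity
          linarith
        have h5 := mul_le_mul_of_nonneg_left (show g ^ 2 / 2 ≤ Q t by linarith) hs0.le
        linarith
      have h6 : ∀ l, 0 ≤ δ * e (l + 1) ^ 2 * (s * Q t + 1 / (2 * s) * χ l t) := fun l => by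
        have := hQ0 t
        have := hχ0 l t
        positivity
      refine ((Finset.sum_le_sum h1).trans
        (Finset.sum_le_sum_of_subset_of_nonneg hsub fun l _ _ => h6 l)).trans ?_
      have h7 : ∑ l ∈ Finset.range N, δ * e (l + 1) ^ 2 * (s * Q t + 1 / (2 * s) * χ l t) =
          (∑ l ∈ Finset.range N, δ * e (l + 1) ^ 2) * (s * Q t) +
            ∑ l ∈ Finset.range N, δ * e (l + 1) ^ 2 / (2 * s) * χ l t := by
        rw [Finset.sum_mul, ← Finset.sum_add_distrib]
        exact Finset.sum_congr rfl fun l _ => by ring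
      rw [h7, mul_assoc B]
      have := mul_le_mul_of_nonneg_right hB (mul_nonneg hs0.le (hQ0 t))
      linarith
    · -- the Cauchy-Schwarz inequality in `l`, where `(m - n) * δ ≤ τ + δ`
      have h1 : (∑ l ∈ Finset.Ico n m, δ * e (l + 1)) ≤ √B * √(τ + δ) := by
        rw [← Real.sqrt_mul hB0]
        refine Real.le_sqrt_of_sq_le ?_
        have h2 := Finset.sum_sq_le_sum_mul_sum_of_sq_le_mul (Finset.Ico n m)
          (r := fun l => δ * e (l + 1)) (f := fun _ => δ) (g := fun l => δ * e (l + 1) ^ 2)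
          (fun _ _ => hδ.le) (fun _ _ => mul_nonneg hδ.le (sq_nonneg _))
          (fun l _ => le_of_eq (by ring))
        refine h2.trans ?_
        rw [Finset.sum_const, Nat.card_Ico, nsmul_eq_mul, mul_comm]
        have h3 : ∑ l ∈ Finset.Ico n m, δ * e (l + 1) ^ 2 ≤ B :=
          (Finset.sum_le_sum_of_subset_of_nonneg hsub fun l _ _ =>
            mul_nonneg hδ.le (sq_nonneg _)).trans hB
        refine mul_le_mul h3 ?_ (by positivity) hB0
        rw [Nat.cast_sub hnm]
        have h4 := hm.1
        rw [Nat.cast_sub hm1] at h4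
        push_cast at h4
        linarith [hn.2]
      have h2 : ∑ l ∈ Finset.Ico n m, δ * (e (l + 1) * g ^ 2) =
          (∑ l ∈ Finset.Ico n m, δ * e (l + 1)) * g ^ 2 := by
        rw [Finset.sum_mul]
        exact Finset.sum_congr rfl fun l _ => by ring
      rw [h2]
      calc _ ≤ √B * √(τ + δ) * (2 * Q t) := by gcongr
        _ = _ := by ring
  have i1 : IntegrableOn (fun t => B * s * Q t) D := hQint.const_mul _
  have i2 : ∀ l ∈ Finset.range N,
      IntegrableOn (fun t => δ * e (l + 1) ^ 2 / (2 * s) * χ l t) D := fun l _ =>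
    (hχint l).integrableOn.const_mul _
  have i3 : IntegrableOn (fun t => ∑ l ∈ Finset.range N,
      δ * e (l + 1) ^ 2 / (2 * s) * χ l t) D := integrable_finsetSum _ i2
  have i4 : IntegrableOn (fun t => 2 * (√B * √(τ + δ)) * Q t) D := hQint.const_mul _
  have i12 : IntegrableOn (fun t => B * s * Q t + ∑ l ∈ Finset.range N,
      δ * e (l + 1) ^ 2 / (2 * s) * χ l t) D := i1.add i3
  refine (setIntegral_mono_on (integrableOn_step hδ hτ.le fun n m =>
    ∑ l ∈ Finset.Ico n m, δ * (e (l + 1) ^ 2 * (e m + e n) + e (l + 1) * (e m + e n) ^ 2))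
    (i12.add i4) measurableSet_Ioc hpt).trans ?_
  rw [Pi.add_def, integral_add i12 i4, integral_add i1 i3, integral_const_mul, integral_const_mul,
    integral_finsetSum _ i2]
  have k1 : B * s * ∫ t in D, Q t ≤ 2 * B ^ 2 * √(τ + δ) := by
    have h1 : 0 ≤ B * s := by positivity
    calc B * s * ∫ t in D, Q t ≤ B * s * (2 * B) := mul_le_mul_of_nonneg_left hQB h1
      _ = 2 * B ^ 2 * s := by ring
      _ ≤ _ := by gcongr
  have k2 : ∑ l ∈ Finset.range N, ∫ t in D, δ * e (l + 1) ^ 2 / (2 * s) * χ l t ≤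
      B / 2 * √(τ + δ) := by
    calc _ ≤ ∑ l ∈ Finset.range N, δ * e (l + 1) ^ 2 * (s / 2) := by
          refine Finset.sum_le_sum fun l _ => ?_
          rw [integral_const_mul]
          have h1 : 0 ≤ δ * e (l + 1) ^ 2 / (2 * s) := by positivity
          refine (mul_le_mul_of_nonneg_left (hχτ l) h1).trans (le_of_eq ?_)
          rw [← hss]
          field_simp
      _ = (∑ l ∈ Finset.range N, δ * e (l + 1) ^ 2) * (s / 2) := by rw [Finset.sum_mul]
      _ ≤ B * (√(τ + δ) / 2) := by gcongr
      _ = _ := by ring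
  have k3 : 2 * (√B * √(τ + δ)) * ∫ t in D, Q t ≤ 4 * B * √B * √(τ + δ) := by
    have h1 : 0 ≤ 2 * (√B * √(τ + δ)) := by positivity
    exact (mul_le_mul_of_nonneg_left hQB h1).trans (le_of_eq (by ring))
  linarith

end TimeTranslates

/-! ### The bound for the time translates of a discrete solution -/

theorem exists_pos_bounds_of_continuousOn_Icc {μ : ℝ → ℝ} {r s : ℝ}
    (hμ : ContinuousOn μ (Set.Icc r s)) (hpos : ∀ x ∈ Set.Icc r s, 0 < μ x) :
    ∃ a b, 0 < a ∧ a ≤ b ∧ ∀ x ∈ Set.Icc r s, a ≤ μ x ∧ μ x ≤ b := by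
  rcases Set.eq_empty_or_nonempty (Set.Icc r s) with h | h
  · exact ⟨1, 1, one_pos, le_rfl, by simp [h]⟩
  · obtain ⟨x, hx, hmin⟩ := isCompact_Icc.exists_isMinOn h hμ
    obtain ⟨y, hy, hmax⟩ := isCompact_Icc.exists_isMaxOn h hμ
    exact ⟨μ x, μ y, hpos x hx, hmin hy, fun z hz => ⟨hmin hz, hmax hz⟩⟩

namespace MACGrid

open MeasureTheory

variable {d : ℕ} {M : MACGrid d}

theorem IsMeshOf.cells_nonempty {Ω : Set (Fin d → ℝ)} (hM : M.IsMeshOf Ω) (hΩ : Ω.Nonempty) :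
    M.cells.Nonempty := by
  rw [Finset.nonempty_iff_ne_empty]
  intro h
  rw [IsMeshOf, h] at hM
  simp [hM] at hΩ

/-- The difference of the velocity functions at two times is the piecewise constant function given
by the difference of the discrete velocities of the time steps that contain these times. -/
theorem integral_velocityFn_sub_sq_le (M : MACGrid d) (Ω : Set (Fin d → ℝ)) {N : ℕ} {T : ℝ}
    (hδ : 0 < T / N) (u : ℕ → Fin d → (Fin d → ℤ) → ℝ) {s t : ℝ} (hs0 : 0 < s)
    (hs : s ≤ N * (T / N)) (ht0 : 0 < t) (ht : t ≤ N * (T / N)) :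
    ∫ y in Ω, ∑ i, (M.velocityFn N T u i s y - M.velocityFn N T u i t y) ^ 2 ≤
      M.inner (u ⌈s / (T / N)⌉₊ - u ⌈t / (T / N)⌉₊) (u ⌈s / (T / N)⌉₊ - u ⌈t / (T / N)⌉₊) := by
  have key : ∀ {r : ℝ}, 0 < r → r ≤ N * (T / N) → ∀ i y, M.velocityFn N T u i r y =
      ∑ K ∈ M.intFaces i, u ⌈r / (T / N)⌉₊ i K * (M.dualCell i K).indicator 1 y := by
    intro r hr0 hr i y
    have h1 : 0 < ⌈r / (T / N)⌉₊ := Nat.ceil_pos.mpr (div_pos hr0 hδ)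
    have h2 := ceil_div_le hδ hr
    have h3 := mem_Ioc_ceil hδ hr0
    have h4 : ⌈r / (T / N)⌉₊ - 1 + 1 = ⌈r / (T / N)⌉₊ := Nat.sub_add_cancel h1
    have h5 := velocityFn_eq (M := M) hδ u i (k := ⌈r / (T / N)⌉₊ - 1) (t := r) (by omega)
      (by rwa [h4]) y
    rwa [h4] at h5
  refine le_trans (le_of_eq ?_) (integral_sum_indicator_sq_le M Ω _)
  refine integral_congr_ae (Filter.Eventually.of_forall fun y => ?_)
  simp only [key hs0 hs, key ht0 ht, Pi.sub_apply, sub_mul, Finset.sum_sub_distrib]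

end MACGrid

theorem mainTheorem7 (d : ℕ) (hd : d = 2 ∨ d = 3)
    (Ω : Set (Fin d → ℝ)) (hΩ : IsConnected Ω)
    (T : ℝ) (hT : 0 < T)
    (ρmin ρmax : ℝ) (hρmin : 0 < ρmin)
    (μ : ℝ → ℝ) (hμ : ContinuousOn μ (Set.Icc ρmin ρmax))
    (hμpos : ∀ r ∈ Set.Icc ρmin ρmax, 0 < μ r)
    (U F η : ℝ) :
    ∃ C : ℝ, 0 < C ∧
      ∀ (M : MACGrid d), M.IsMeshOf Ω → M.eta ≤ η →
      ∀ (N : ℕ), 0 < N →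
      ∀ (ρ₀ : (Fin d → ℝ) → ℝ),
        MeasureTheory.MemLp ρ₀ ⊤ (MeasureTheory.volume.restrict Ω) →
        (∀ᵐ y ∂(MeasureTheory.volume.restrict Ω), ρmin ≤ ρ₀ y ∧ ρ₀ y ≤ ρmax) →
      ∀ (u₀ : Fin d → (Fin d → ℝ) → ℝ),
        (∀ i, MeasureTheory.MemLp (u₀ i) 2 (MeasureTheory.volume.restrict Ω)) →
        ∑ i, ∫ y in Ω, (u₀ i y) ^ 2 ≤ U ^ 2 →
      ∀ (f : ℝ → Fin d → (Fin d → ℝ) → ℝ),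
        (∀ n < N, ∀ i, MeasureTheory.MemLp (f ((n + 1 : ℕ) * (T / N)) i) 2
          (MeasureTheory.volume.restrict Ω)) →
        ∑ n ∈ Finset.range N, (T / N) *
          ∑ i, ∫ y in Ω, (f ((n + 1 : ℕ) * (T / N)) i y) ^ 2 ≤ F ^ 2 →
      ∀ (ρ : ℕ → (Fin d → ℤ) → ℝ) (u : ℕ → Fin d → (Fin d → ℤ) → ℝ)
        (p : ℕ → (Fin d → ℤ) → ℝ),
        M.IsSolution N T μ ρ₀ u₀ f ρ u p →
      ∀ (τ : ℝ), 0 < τ → τ < T →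
        ∫ t in (0 : ℝ)..(T - τ), ∫ y in Ω,
            ∑ i, (M.velocityFn N T u i (t + τ) y - M.velocityFn N T u i t y) ^ 2
          ≤ C * Real.sqrt (τ + T / N) := by
  obtain ⟨a, b, ha, hab, hμab⟩ := exists_pos_bounds_of_continuousOn_Icc hμ hμpos
  set c := 6 * MACGrid.trilinearConst d (η ^ 3) ρmax + 4 * (b + 1) with hc
  -- `B` bounds the sum over the time steps of `δt * e ^ 2`, for the `e` chosen below
  set B := 3 * (T + (2 * T / ρmin + 8 / (3 * a)) * (ρmax * U ^ 2 + 2 * T / ρmin * F ^ 2) + F ^ 2)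
    with hB
  -- the absolute value is only there to make the constant positive without further assumptions
  refine ⟨|c / ρmin * (2 * B ^ 2 + B / 2 + 4 * B * √B)| + 1, by positivity, ?_⟩
  intro M hM hη N hN ρ₀ hρ₀ hρ₀b u₀ hu₀ hU f hf hF ρ u p S τ hτ hτT
  have hNr : (0 : ℝ) < N := by exact_mod_cast hN
  have hδ : 0 < T / N := div_pos hT hNr
  have hNδ : N * (T / N) = T := mul_div_cancel₀ T hNr.ne'
  have hne := hM.cells_nonempty hΩ.nonempty
  obtain ⟨h, H⟩ := M.exists_quasiUniform (by omega) hη hne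
  have h0 : ∀ K ∈ M.cells, ρmin ≤ ρ 0 K ∧ ρ 0 K ≤ ρmax := fun K hK => by
    rw [S.initial_density K hK]
    exact hM.projCells_mem hρ₀ hρ₀b hK
  have hle : ρmin ≤ ρmax := by
    obtain ⟨K, hK⟩ := hne
    exact (h0 K hK).1.trans (h0 K hK).2
  have hρ : ∀ n ≤ N, ∀ K ∈ M.cells, ρmin ≤ ρ n K ∧ ρ n K ≤ ρmax :=
    fun n hn => S.density_mem hδ h0 hn
  have hU' : M.inner (u 0) (u 0) ≤ U ^ 2 := by
    rw [S.initial_velocity]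
    exact (hM.inner_projFaces_le hu₀).trans hU
  set φ : ℕ → ℝ := fun l => M.inner (M.projFaces (f (l * (T / N)))) (M.projFaces (f (l * (T / N))))
    with hφ
  have hF' : ∑ n ∈ Finset.range N, T / N * φ (n + 1) ≤ F ^ 2 :=
    (Finset.sum_le_sum fun n hn => mul_le_mul_of_nonneg_left
      (hM.inner_projFaces_le (hf n (Finset.mem_range.mp hn))) hδ.le).trans hF
  have hE := S.sum_h1Sq_le hd hN hT hρmin ha hρ hle hμab hU' hF'
  set e : ℕ → ℝ := fun l => 1 + M.h1Norm (u l) + √(φ l) with he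
  have he0 : ∀ l, 0 ≤ e l := fun l =>
    add_nonneg (add_nonneg zero_le_one (M.h1Norm_nonneg _)) (Real.sqrt_nonneg _)
  have hesq : ∀ l, e l ^ 2 ≤ 3 * (1 + M.h1Sq (u l) + φ l) := fun l => by
    have h1 : M.h1Norm (u l) ^ 2 = M.h1Sq (u l) := M.h1Norm_sq _
    have h2 : √(φ l) ^ 2 = φ l := Real.sq_sqrt (M.inner_self_nonneg _)
    rw [← h1, ← h2]
    simp only [he]
    nlinarith [sq_nonneg (1 - M.h1Norm (u l)), sq_nonneg (1 - √(φ l)),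
      sq_nonneg (M.h1Norm (u l) - √(φ l))]
  have hsum : ∑ n ∈ Finset.range N, T / N * e (n + 1) ^ 2 ≤ B := by
    calc ∑ n ∈ Finset.range N, T / N * e (n + 1) ^ 2
        ≤ ∑ n ∈ Finset.range N, 3 * (T / N + T / N * M.h1Sq (u (n + 1)) + T / N * φ (n + 1)) :=
          Finset.sum_le_sum fun n _ =>
            (mul_le_mul_of_nonneg_left (hesq (n + 1)) hδ.le).trans (le_of_eq (by ring))
      _ = 3 * (N * (T / N) + ∑ n ∈ Finset.range N, T / N * M.h1Sq (u (n + 1)) +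
            ∑ n ∈ Finset.range N, T / N * φ (n + 1)) := by
          rw [← Finset.mul_sum, Finset.sum_add_distrib, Finset.sum_add_distrib, Finset.sum_const,
            Finset.card_range, nsmul_eq_mul]
      _ ≤ B := by
          rw [hNδ, hB]
          linarith
  have htrans := integral_translate_le hδ hτ (hτT.trans_eq hNδ.symm) he0 hsum
  have hint := integrableOn_step (N := N) hδ hτ.le fun n m => c / ρmin *
    ∑ l ∈ Finset.Ico n m, T / N * (e (l + 1) ^ 2 * (e m + e n) + e (l + 1) * (e m + e n) ^ 2)
  rw [hNδ] at htrans hint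
  have hpt : ∀ t ∈ Set.Ioc 0 (T - τ), ∫ y in Ω,
      ∑ i, (M.velocityFn N T u i (t + τ) y - M.velocityFn N T u i t y) ^ 2 ≤
      c / ρmin * ∑ l ∈ Finset.Ico ⌈t / (T / N)⌉₊ ⌈(t + τ) / (T / N)⌉₊, T / N *
        (e (l + 1) ^ 2 * (e ⌈(t + τ) / (T / N)⌉₊ + e ⌈t / (T / N)⌉₊) +
          e (l + 1) * (e ⌈(t + τ) / (T / N)⌉₊ + e ⌈t / (T / N)⌉₊) ^ 2) := by
    intro t ht
    have ht0 : 0 < t + τ := by linarith [ht.1]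
    have h1 := M.integral_velocityFn_sub_sq_le Ω hδ u ht0 (by linarith [ht.2]) ht.1
      (by linarith [ht.2])
    have h2 := S.inner_increment_le hd hδ hρmin ha.le hle hab H hρ hμab (e := e) (fun l => rfl)
      (n := ⌈t / (T / N)⌉₊) (m := ⌈(t + τ) / (T / N)⌉₊) (Nat.ceil_pos.mpr (div_pos ht.1 hδ))
      (Nat.ceil_mono (by gcongr; linarith)) (ceil_div_le hδ (by linarith [ht.2]))
    refine h1.trans ?_
    rwa [div_mul_eq_mul_div, le_div_iff₀' hρmin]
  have hc0 : 0 ≤ c / ρmin := by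
    have h1 := MACGrid.trilinearConst_nonneg d (zero_le_one.trans H.one_le) (hρmin.le.trans hle)
    have h2 := ha.le.trans hab
    positivity
  rw [intervalIntegral.integral_of_le (by linarith)]
  calc _ ≤ ∫ t in Set.Ioc 0 (T - τ), c / ρmin *
          ∑ l ∈ Finset.Ico ⌈t / (T / N)⌉₊ ⌈(t + τ) / (T / N)⌉₊, T / N *
            (e (l + 1) ^ 2 * (e ⌈(t + τ) / (T / N)⌉₊ + e ⌈t / (T / N)⌉₊) +
              e (l + 1) * (e ⌈(t + τ) / (T / N)⌉₊ + e ⌈t / (T / N)⌉₊) ^ 2) := by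
        refine MeasureTheory.integral_mono_of_nonneg ?_ hint ?_
        · exact Filter.Eventually.of_forall fun t => MeasureTheory.integral_nonneg fun y =>
            Finset.sum_nonneg fun i _ => sq_nonneg _
        · exact (MeasureTheory.ae_restrict_iff' measurableSet_Ioc).mpr
            (Filter.Eventually.of_forall hpt)
    _ ≤ c / ρmin * ((2 * B ^ 2 + B / 2 + 4 * B * √B) * √(τ + T / N)) := by
        rw [MeasureTheory.integral_const_mul]
        exact mul_le_mul_of_nonneg_left htrans hc0
    _ ≤ _ := by
        rw [← mul_assoc]
        refine mul_le_mul_of_nonneg_right ?_ (Real.sqrt_nonneg _)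
        linarith [le_abs_self (c / ρmin * (2 * B ^ 2 + B / 2 + 4 * B * √B))]
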